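/- **Setting.** Let $\mathcal H$ be a separable complex Hilbert space, $\mathcal I=(a,b)$, $-\infty\le a<b\le\infty$, an interval whose closure $\bar{\mathcal I}$ in $\mathbb R$ contains $0$, $D=d/dt$. A differential expression of order (at most) $k$ in divergent form is $L=\sum_{j=0}^{k} i^jL_j$, $L_{2j}=D^jp_jD^j$, $L_{2j-1}=\frac12D^{j-1}(Dq_j+s_jD)D^{j-1}$, with $p_j,q_j,s_j:\bar{\mathcal I}\to B(\mathcal H)$ of class $C^j$; $L^*$ is the expression with $p_j^*,s_j^*,q_j^*$ in place of $p_j,q_j,s_j$; $\Re L=\frac12(L+L^*)$, $\Im L=\frac1{2i}(L-L^*)$; and $$L\{f,g\}=\sum_j (p_jf^{(j)},g^{(j)})+\tfrac i2\sum_{j\ge1}\big[(s_jf^{(j)},g^{(j-1)})-(q_jf^{(j-1)},g^{(j)})\big].$$ Let $r\ge1$, $n=[r/2]$, and let $l_\lambda$ be expressions of order $r$ given for $\lambda$ in a set $\mathcal B\supseteq\mathbb C\setminus\mathbb R$, with coefficients $p_j,q_j,s_j$ depending on $(t,\lambda)$, such that: every $\lambda_0\in\mathcal B$ has a neighbourhood,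 not depending on $t\in\bar{\mathcal I}$, in which the coefficients are analytic in $\lambda$; $p_n(t,\lambda)$ ($r=2n$), respectively $q_{n+1}(t,\lambda)+s_{n+1}(t,\lambda)$ ($r=2n+1$), has a bounded inverse for $t\in\bar{\mathcal I}$, $\lambda\in\mathcal B$; $p_j(t,\lambda)=p_j^*(t,\bar\lambda)$, $q_j(t,\lambda)=s_j^*(t,\bar\lambda)$; and the quadratic form in $f,f',f'',\dots$ given by $(\Im l_\lambda)\{f,f\}/\Im\lambda$ is nonpositive for $t\in\bar{\mathcal I}$, $\Im\lambda\ne0$. Let $m=m^*$ be an expression of even order $s\le r$ with coefficients $\tilde p_j,\tilde q_j,\tilde s_j=\tilde q_j^*$ not depending on $\lambda$, such that, as quadratic forms in $f,f',f'',\dots$, $$0\le m\{f,f\}\le-(\Im l_\lambda)\{f,f\}/\Im\lambda,\qquad t\in\bar{\mathcal I},\ \Im\lambda\ne0 .$$ Put $l=\Re l_i$ and $n_\lambda=l-\lambda m-l_\lambda$, so that $l_\lambda[y]=m[f]$ reads $l[y]-\lambda m[y]-n_\lambda[y]=m[f]$. Let $m(t)$ be the three-diagonal $(n+1)\times(n+1)$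 operator matrix with diagonal $\tilde p_0,\dots,\tilde p_n$, subdiagonal $-\frac i2\tilde q_1,\dots,-\frac i2\tilde q_n$, superdiagonal $\frac i2\tilde s_1,\dots,\frac i2\tilde s_n$ (missing coefficients being $0$), and let $n(t,\lambda)$ be the same matrix for $n_\lambda$. Let $H$ be the space of $f\in C^s(\bar{\mathcal I},\mathcal H)$ with $m[f,f]=\int_{\mathcal I}m\{f,f\}\,dt<\infty$, with the semi-definite scalar product $m[f,g]=\int_{\mathcal I}m\{f,g\}\,dt$, and $L^2_m(\mathcal I)$ its completion. **First order system.** For an expression $L$ of order at most $r$ and $0\le j\le[(r+1)/2]$ let $$y^{[r-j]}(t|L)=-Dy^{[r-j-1]}(t|L)+p_jy^{(j)}+\tfrac i2\big[s_{j+1}y^{(j+1)}-q_jy^{(j-1)}\big],$$ where the first summand is absent for $j=[(r+1)/2]$, and so is the $q_j$-term for $j=0$ (coefficients beyond order $r$ are $0$). Put $$\vec y(t,L,m,f)=\mathrm{col}\{y,\dots,y^{(n-1)},\,y^{[r-1]}(t|L)-f^{[s-1]}(t|m),\dots,y^{[r-n]}(t|L)-f^{[s-n]}(t|m)\}\ (\text{and,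 for } r=2n+1,\text{ a last entry } -iy^{(n)}),$$ with $f^{[s-k]}(t|m)=0$ for $k>s/2$; for $r=1$, $\vec y=y$. Let $Q(t,L)=\begin{pmatrix}0&iI_n\\-iI_n&0\end{pmatrix}$, with the additional diagonal block $q_{n+1}$ if $r=2n+1$. Let $H(t,L)=\|h_{\alpha\beta}\|_{\alpha,\beta=1}^2$, the first blocks $\alpha=1$, $\beta=1$ having size $n$ and the second ones size $r-n$: $h_{11}$ is three-diagonal with diagonal $-p_0,\dots,-p_{n-1}$, subdiagonal $\frac i2q_1,\dots,\frac i2q_{n-1}$, superdiagonal $-\frac i2s_1,\dots,-\frac i2s_{n-1}$. For $r=2n$ the term $\frac14s_np_n^{-1}q_n$ is added to the last diagonal element of $h_{11}$, $h_{12}$ has $1$'s on the subdiagonal and last diagonal element $-\frac i2s_np_n^{-1}$, $h_{21}$ has $1$'s on the superdiagonal and last diagonal element $\frac i2p_n^{-1}q_n$, $h_{22}$ has the only nonzero element $p_n^{-1}$, the last diagonal one. For $r=2n+1\geq 3$, $h_{12}$ has $1$'s on the subdiagonal and $\frac12s_n$ as element $(n,n+1)$, $h_{21}$ has $1$'s on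 the superdiagonal and $\frac12q_n$ as element $(n+1,n)$, and $h_{22}$ has nonzero elements $(n+1,n+1)=-p_n$, $(n+1,n)=-i$, $(n,n+1)=i$ only; for $r=1$, $H=-p_0$. Let $T(t,L):\mathcal H^r\to\mathcal H^{n+1}$ be the operator that recovers $\mathrm{col}\{y,y',\dots,y^{(n)}\}$ from $\vec y(t,L,m,0)$ (for $r=2n$ by $y^{(n)}=p_n^{-1}(y^{[n]}+\frac i2q_ny^{(n-1)})$). For an expression $k$ of even order at most $r$ with form matrix $k(t)$ (built like $m(t)$) put $W(t,L,k)=T^*(t,L)\,k(t)\,T(t,L)$. Finally let $F(t,L,m)\in\mathcal H^r$ be, if $s<2n$, $\mathrm{col}\{f,\dots,f^{(s/2)},0,\dots,0\}$; if $s=2n=r$, $\mathrm{col}\{f,\dots,f^{(n-1)},f^{[r-1]}(t|L),\dots,f^{[n]}(t|L)\}$; if $s=2n=r-1>0$, $\mathrm{col}\{f,\dots,f^{(n-1)},0,\dots,0,-if^{(n)}\}$; if $r=1$, $F=f$. **The operators $R(\lambda)$.** For $\Im\lambda\ne0$ let $X_\lambda(t)\in B(\mathcal H^r)$ solve $\frac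 i2\big((Q(t,l_\lambda)X)'+Q^*(t,l_\lambda)X'\big)-H(t,l_\lambda)X=0$, $X_\lambda(0)=I$; $G=\Re Q(0,l_\lambda)$; $K_\lambda(t,\tau)=X_\lambda(t)\{M(\lambda)-\frac12\mathrm{sgn}(\tau-t)(iG)^{-1}\}X^*_{\bar\lambda}(\tau)$. Let $M(\lambda)$ be a characteristic operator of the equation $l_\lambda[y]=-\frac{(\Im l_\lambda)[f]}{\Im\lambda}$: $M:\mathbb C\setminus\mathbb R\to B(\mathcal H^r)$ is analytic, $M(\lambda)=M^*(\bar\lambda)$, and, with $W_\lambda(t)=W(t,l_\lambda,-\Im l_\lambda/\Im\lambda)$, for every compactly supported measurable $F:\bar{\mathcal I}\to\mathcal H^r$ with $\int(W_\lambda F,F)\,dt<\infty$ the function $x(t)=\int_{\mathcal I}K_\lambda(t,\tau)W_\lambda(\tau)F(\tau)\,d\tau$ satisfies $\lim_{\alpha\downarrow a,\beta\uparrow b}\Im\lambda\,(\Re Q(t,l_\lambda)x,x)|_\alpha^\beta\le0$. If $\mathcal I$ is infinite, assume moreover that for some $\lambda_0\in\mathcal B$, $[\alpha,\beta]\subseteq\bar{\mathcal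 I}$ containing $0$, and $\delta>0$, every solution $y\in C^r$ of $l_{\lambda_0}[y]=0$ satisfies $$-\int_\alpha^\beta\frac{\Im l_{\lambda_0}}{\Im\lambda_0}\{y,y\}\,dt\ge\delta\,\|\vec y(0,l_{\lambda_0},m,0)\|^2$$ (for real $\lambda_0$ the quotient means $\partial l_\lambda/\partial\lambda$ at $\lambda_0$). For $f\in H$ let $y_1=y_1(t,\lambda,f)$ be the first component of $\int_{\mathcal I}K_\lambda(t,\tau)W(\tau,l_{\bar\lambda},m)F(\tau,l_{\bar\lambda},m)\,d\tau$ (a norm convergent improper integral), and let $R(\lambda)$ be the bounded operator in $L^2_m(\mathcal I)$ that is the closure of $f\mapsto y_1(\cdot,\lambda,f)$, $f\in H$. Let $E_\mu$ be its generalized spectral family. Here a generalized spectral family in a Hilbert space is a family $E_\mu$, $\mu\in\mathbb R$, of bounded operators with $0\le E_\mu\le E_\nu\le1$ for $\mu<\nu$, $E_{\mu-0}=E_\mu$, $E_{-\infty}=0$; $E_\infty$ is the strong limit of $E_\mu$ as $\mu\to+\infty$; it corresponds to $R(\lambda)$ if $R(\lambda)=\int_{\mathbb R}\frac{dE_\mu}{\mu-\lambda}$,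 $\Im\lambda\ne0$. **The generalized resolvent.** Let $\mathcal L_0$ be the closure in $L^2_m(\mathcal I)\times L^2_m(\mathcal I)$ of the relation of pairs $\{y,g\}$, $y\in H\cap C^r$, $g\in H$, $l[y]=m[g]$, such that $\vec y(t,l,m,g)$ vanishes at each finite end of $\mathcal I$ and in a neighbourhood of each infinite end. Let $R_\lambda$ be a generalized resolvent of $\mathcal L_0$ (the compression to $L^2_m(\mathcal I)$ of the resolvent of a self-adjoint relation, in a Hilbert space containing $L^2_m(\mathcal I)$, that extends $\mathcal L_0$) such that for $f\in H$, $\Im\lambda\ne0$ the element $y=R_\lambda f$ is (represented by) a function $y\in H\cap C^r$ with $l[y]-\lambda m[y]=m[f]$; let $\mathcal E_\mu$ be the generalized spectral family of $R_\lambda$. **Theorem.** Let the order of $n_\lambda$ not exceed that of $l-\lambda m$ ($\Im\lambda\ne0$), and suppose that for all sufficiently large $\tau>0$, with $\lambda=i\tau$: 1°. for all $f\in H$, with $y_1=R(\lambda)f$, $y=R_\lambda f$ and $\vec z(t)=\vec y_1(t,l_\lambda,m,f)-\vec y(t,l-\lambda m,m,f)$, the following limit exists and $$\lim_{\alpha\downarrow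 a,\ \beta\uparrow b}\ \frac{(\Re Q(t,l_\lambda)\vec z(t),\vec z(t))}{\Im\lambda}\Big|_\alpha^\beta\le0;$$ 2°. $\Im n(t,\lambda)\le c(t,\tau)\,m(t)$, $t\in\bar{\mathcal I}$, where the scalar function $c(t,\tau)$ satisfies $\sup_{t\in\bar{\mathcal I}}c(t,\tau)=o(\tau)$ as $\tau\to+\infty$. Then $E_\infty=\mathcal E_\infty$. -/

import Mathlib

open Set Filter Topology MeasureTheory
open scoped ComplexConjugate

noncomputable section

set_option linter.unusedSectionVars false

namespace OpDiff

/-! ## Intervals, jets, operator matrices -/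

/-- A nondegenerate interval `(a, b)` of the real line, finite or infinite, whose closure
in `ℝ` contains `0`. -/
structure BaseInterval where
  a : EReal
  b : EReal
  lt : a < b
  zero_left : a ≤ 0
  zero_right : 0 ≤ b

/-- The closure of the interval in `ℝ` (finite end points included). -/
def BaseInterval.cl (J : BaseInterval) : Set ℝ := {t : ℝ | J.a ≤ (t : EReal) ∧ (t : EReal) ≤ J.b}

/-- The interval is finite. -/
def BaseInterval.Finite (J : BaseInterval) : Prop := J.a ≠ ⊥ ∧ J.b ≠ ⊤

/-- The filter `α ↓ a`. -/
def BaseInterval.atLeft (J : BaseInterval) : Filter ℝ :=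
  Filter.comap (fun t : ℝ => (t : EReal)) (𝓝[>] J.a)

/-- The filter `β ↑ b`. -/
def BaseInterval.atRight (J : BaseInterval) : Filter ℝ :=
  Filter.comap (fun t : ℝ => (t : EReal)) (𝓝[<] J.b)

/-- The filter `α ↓ a, β ↑ b` on pairs `(α, β)`. -/
def BaseInterval.ends (J : BaseInterval) : Filter (ℝ × ℝ) := J.atLeft ×ˢ J.atRight

theorem BaseInterval.convex_cl (J : BaseInterval) : Convex ℝ J.cl := by
  refine Set.OrdConnected.convex ⟨?_⟩
  rintro x ⟨hx, -⟩ y ⟨-, hy⟩ z ⟨hxz, hzy⟩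
  exact ⟨hx.trans (EReal.coe_le_coe_iff.2 hxz), (EReal.coe_le_coe_iff.2 hzy).trans hy⟩

theorem BaseInterval.uniqueDiffOn (J : BaseInterval) : UniqueDiffOn ℝ J.cl := by
  obtain ⟨x, hax, hxb⟩ := EReal.lt_iff_exists_real_btwn.1 J.lt
  obtain ⟨y, hxy, hyb⟩ := EReal.lt_iff_exists_real_btwn.1 hxb
  have hxy' : x < y := EReal.coe_lt_coe_iff.1 hxy
  refine uniqueDiffOn_convex J.convex_cl ⟨(x + y) / 2, ?_⟩
  refine mem_interior_iff_mem_nhds.2 (Filter.mem_of_superset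
    (Icc_mem_nhds (a := x) (b := y) (by linarith) (by linarith)) ?_)
  rintro z ⟨h1, h2⟩
  exact ⟨hax.le.trans (EReal.coe_le_coe_iff.2 h1), (EReal.coe_le_coe_iff.2 h2).trans hyb.le⟩

theorem BaseInterval.measurableSet_cl (J : BaseInterval) : MeasurableSet J.cl :=
  J.convex_cl.ordConnected.measurableSet

variable {ℋ : Type*} [NormedAddCommGroup ℋ] [InnerProductSpace ℂ ℋ] [CompleteSpace ℋ]

/-- The `j`-th derivative of `f` on the closed interval (one-sided at its end points). -/
def jet (J : BaseInterval) (f : ℝ → ℋ) (t : ℝ) (j : ℕ) : ℋ := iteratedDerivWithin j f J.cl t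

/-- `ℋ ^ k`, the orthogonal sum of `k` copies of `ℋ`. -/
abbrev HPow (ℋ : Type*) (k : ℕ) : Type _ := PiLp 2 (fun _ : Fin k => ℋ)

/-- The operator `ℋ ^ l → ℋ ^ k` given by an operator matrix (rows and columns are numbered
from `0`). -/
def opMatrix (k l : ℕ) (A : ℕ → ℕ → (ℋ →L[ℂ] ℋ)) : HPow ℋ l →L[ℂ] HPow ℋ k :=
  (PiLp.continuousLinearEquiv 2 ℂ (fun _ : Fin k => ℋ)).symm.toContinuousLinearMap ∘L
    ContinuousLinearMap.pi (fun i : Fin k =>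
      ∑ j : Fin l, (A i j) ∘L (PiLp.proj 2 (𝕜 := ℂ) (fun _ : Fin l => ℋ) j))

/-- The real part `(A + A*) / 2` of a bounded operator. -/
def rePart {E : Type*} [NormedAddCommGroup E] [InnerProductSpace ℂ E] [CompleteSpace E]
    (A : E →L[ℂ] E) : E →L[ℂ] E := (1 / 2 : ℂ) • (A + ContinuousLinearMap.adjoint A)

/-- The imaginary part `(A - A*) / 2i` of a bounded operator. -/
def imPart {E : Type*} [NormedAddCommGroup E] [InnerProductSpace ℂ E] [CompleteSpace E]
    (A : E →L[ℂ] E) : E →L[ℂ] E :=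
  (1 / (2 * Complex.I) : ℂ) • (A - ContinuousLinearMap.adjoint A)

/-! ## Differential expressions in divergent form -/

/-- The coefficients `p j`, `q j`, `s j` of a differential expression `∑ k, i ^ k l_k` in
divergent form, `l_{2j} = D^j p_j D^j`, `l_{2j-1} = (1/2) D^{j-1} (D q_j + s_j D) D^{j-1}`.
The values `q 0` and `s 0` are never used. -/
structure DiffExpr (ℋ : Type*) [NormedAddCommGroup ℋ] [InnerProductSpace ℂ ℋ] where
  p : ℕ → ℝ → (ℋ →L[ℂ] ℋ)
  q : ℕ → ℝ → (ℋ →L[ℂ] ℋ)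
  s : ℕ → ℝ → (ℋ →L[ℂ] ℋ)

namespace DiffExpr

/-- The expression has order at most `k` on the interval: the coefficients of `l_{k'}` vanish
for `k' > k`. -/
def OrderLE (L : DiffExpr ℋ) (J : BaseInterval) (k : ℕ) : Prop :=
  ∀ t ∈ J.cl, (∀ j, k < 2 * j → L.p j t = 0) ∧
    ∀ j, k < 2 * j + 1 → L.q (j + 1) t = 0 ∧ L.s (j + 1) t = 0

/-- The coefficients of index `j` of an expression of order `k` are of class `C^j`. -/
def Smooth (L : DiffExpr ℋ) (J : BaseInterval) (k : ℕ) : Prop :=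
  (∀ j, 2 * j ≤ k → ContDiffOn ℝ (j : ℕ) (L.p j) J.cl) ∧
    ∀ j, 2 * j + 1 ≤ k → ContDiffOn ℝ ((j + 1 : ℕ)) (L.q (j + 1)) J.cl ∧
      ContDiffOn ℝ ((j + 1 : ℕ)) (L.s (j + 1)) J.cl

/-- `x L + y L'`. -/
def comb (x : ℂ) (L : DiffExpr ℋ) (y : ℂ) (L' : DiffExpr ℋ) : DiffExpr ℋ where
  p j t := x • L.p j t + y • L'.p j t
  q j t := x • L.q j t + y • L'.q j t
  s j t := x • L.s j t + y • L'.s j t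

/-- The formally adjoint expression. -/
def adj (L : DiffExpr ℋ) : DiffExpr ℋ where
  p j t := ContinuousLinearMap.adjoint (L.p j t)
  q j t := ContinuousLinearMap.adjoint (L.s j t)
  s j t := ContinuousLinearMap.adjoint (L.q j t)

/-- `Re L = (L + L*) / 2`. -/
def re (L : DiffExpr ℋ) : DiffExpr ℋ := comb (1 / 2) L (1 / 2) L.adj

/-- `Im L = (L - L*) / 2i`. -/
def im (L : DiffExpr ℋ) : DiffExpr ℋ :=
  comb (1 / (2 * Complex.I)) L (-(1 / (2 * Complex.I))) L.adj

/-- The value `L[y]` of an expression of order `r`. -/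
def apply (r : ℕ) (J : BaseInterval) (L : DiffExpr ℋ) (y : ℝ → ℋ) (t : ℝ) : ℋ :=
  ∑ j ∈ Finset.range (r / 2 + 1),
      Complex.I ^ (2 * j) • jet J (fun τ => L.p j τ (jet J y τ j)) t j
    + ∑ j ∈ Finset.range ((r + 1) / 2), Complex.I ^ (2 * j + 1) • (1 / 2 : ℂ) •
      jet J (fun τ => derivWithin (fun σ => L.q (j + 1) σ (jet J y σ j)) J.cl τ
        + L.s (j + 1) τ (jet J y τ (j + 1))) t j

/-- The form `L{f, g}` at the point `t` (with upper limits of summation for the order `R`), as a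
function of the sequences `u j = f^{(j)}(t)`, `v j = g^{(j)}(t)`. The scalar product
`(x, y)`, linear in `x`, is `inner ℂ y x`. -/
def form (R : ℕ) (L : DiffExpr ℋ) (t : ℝ) (u v : ℕ → ℋ) : ℂ :=
  ∑ j ∈ Finset.range (R / 2 + 1), inner ℂ (v j) (L.p j t (u j))
    + Complex.I / 2 * ∑ j ∈ Finset.range ((R + 1) / 2),
      (inner ℂ (v j) (L.s (j + 1) t (u (j + 1))) - inner ℂ (v (j + 1)) (L.q (j + 1) t (u j)))

/-- `p_j y^{(j)} + (i/2) [s_{j+1} y^{(j+1)} - q_j y^{(j-1)}]`, without the last term if `j = 0`. -/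
def quasiTerm (J : BaseInterval) (L : DiffExpr ℋ) (y : ℝ → ℋ) (j : ℕ) (t : ℝ) : ℋ :=
  L.p j t (jet J y t j) + (Complex.I / 2) •
    (L.s (j + 1) t (jet J y t (j + 1)) - if j = 0 then 0 else L.q j t (jet J y t (j - 1)))

/-- Auxiliary downward recursion for quasi-derivatives. -/
def quasiAux (J : BaseInterval) (L : DiffExpr ℋ) (y : ℝ → ℋ) : ℕ → ℕ → ℝ → ℋ
  | 0, j => L.quasiTerm J y j
  | k + 1, j => fun t => - derivWithin (quasiAux J L y k (j + 1)) J.cl t + L.quasiTerm J y j t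

/-- The quasi-derivative `y^{[r-j]}(t | L)`, `j = 0, …, [(r+1)/2]`, for an expression `L` of
order at most `r`:
`y^{[r-j]} = -D y^{[r-j-1]} + p_j y^{(j)} + (i/2)[s_{j+1} y^{(j+1)} - q_j y^{(j-1)}]`,
starting at `j = [(r+1)/2]`, where the first summand is absent; it starts from
`y^{[n]} = p_n y^{(n)} - (i/2) q_n y^{(n-1)}` if `r = 2n`, and from
`y^{[n]} = -(i/2) q_{n+1} y^{(n)}` if `r = 2n+1`, the other coefficients being zero.
For `j > [(r+1)/2]` the value is `0` on the interval. -/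
def quasi (r : ℕ) (J : BaseInterval) (L : DiffExpr ℋ) (y : ℝ → ℋ) (j : ℕ) (t : ℝ) : ℋ :=
  L.quasiAux J y ((r + 1) / 2 - j) j t

/-! ### The first order system (`n = r / 2` throughout) -/

/-- The inverse of the leading coefficient `p_n`. -/
def pInv (r : ℕ) (L : DiffExpr ℋ) (t : ℝ) : ℋ →L[ℂ] ℋ := Ring.inverse (L.p (r / 2) t)

/-- `Q(t, L)`. -/
def Q (r : ℕ) (L : DiffExpr ℋ) (t : ℝ) : HPow ℋ r →L[ℂ] HPow ℋ r :=
  opMatrix r r fun i j =>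
    let n := r / 2
    if i < n ∧ j = i + n then Complex.I • (1 : ℋ →L[ℂ] ℋ)
    else if j < n ∧ i = j + n then -Complex.I • (1 : ℋ →L[ℂ] ℋ)
    else if i = 2 * n ∧ j = 2 * n then L.q (n + 1) t
    else 0

/-- The entries of `H(t, L)` for even `r = 2n`. -/
def HEven (r : ℕ) (L : DiffExpr ℋ) (t : ℝ) (i j : ℕ) : ℋ →L[ℂ] ℋ :=
  let n := r / 2
  if i < n then
    if j < n then
      if i = j then
        if i + 1 = n then (1 / 4 : ℂ) • (L.s n t * L.pInv r t * L.q n t) - L.p i t else - L.p i t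
      else if i = j + 1 then (Complex.I / 2) • L.q i t
      else if j = i + 1 then -(Complex.I / 2) • L.s j t
      else 0
    else
      if i = (j - n) + 1 then 1
      else if i = j - n ∧ i + 1 = n then -(Complex.I / 2) • (L.s n t * L.pInv r t)
      else 0
  else
    if j < n then
      if j = (i - n) + 1 then 1
      else if j = i - n ∧ j + 1 = n then (Complex.I / 2) • (L.pInv r t * L.q n t)
      else 0
    else if i = j ∧ i + 1 = 2 * n then L.pInv r t
    else 0

/-- The entries of `H(t, L)` for odd `r = 2n + 1`; for `n = 0` the only entry is `-p_0`. -/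
def HOdd (r : ℕ) (L : DiffExpr ℋ) (t : ℝ) (i j : ℕ) : ℋ →L[ℂ] ℋ :=
  let n := r / 2
  if i < n then
    if j < n then
      if i = j then - L.p i t
      else if i = j + 1 then (Complex.I / 2) • L.q i t
      else if j = i + 1 then -(Complex.I / 2) • L.s j t
      else 0
    else
      if i = (j - n) + 1 then 1
      else if i + 1 = n ∧ j = 2 * n then (1 / 2 : ℂ) • L.s n t
      else 0
  else
    if j < n then
      if j = (i - n) + 1 then 1
      else if j + 1 = n ∧ i = 2 * n then (1 / 2 : ℂ) • L.q n t
      else 0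
    else if i = 2 * n ∧ j = 2 * n then - L.p n t
    else if i = 2 * n ∧ j + 1 = 2 * n then -Complex.I • (1 : ℋ →L[ℂ] ℋ)
    else if i + 1 = 2 * n ∧ j = 2 * n then Complex.I • (1 : ℋ →L[ℂ] ℋ)
    else 0

/-- `H(t, L)`. -/
def H (r : ℕ) (L : DiffExpr ℋ) (t : ℝ) : HPow ℋ r →L[ℂ] HPow ℋ r :=
  opMatrix r r (if Even r then L.HEven r t else L.HOdd r t)

/-- The three-diagonal `(n+1) × (n+1)` operator matrix of the form of an expression of even
order `≤ 2n`. -/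
def formMatrix (n : ℕ) (m : DiffExpr ℋ) (t : ℝ) : HPow ℋ (n + 1) →L[ℂ] HPow ℋ (n + 1) :=
  opMatrix (n + 1) (n + 1) fun i j =>
    if i = j then m.p i t
    else if i = j + 1 then -(Complex.I / 2) • m.q i t
    else if j = i + 1 then (Complex.I / 2) • m.s j t
    else 0

/-- The operator `ℋ ^ r → ℋ ^ (n+1)` that recovers `y, y', …, y^{(n)}` from the column
of the first order system
`y, …, y^{(n-1)}, y^{[2n-1]}, …, y^{[n]}` (`r = 2n`),
`y, …, y^{(n-1)}, y^{[2n]}, …, y^{[n+1]}, -i y^{(n)}` (`r = 2n+1 > 1`), `y` (`r = 1`);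
for `r = 2n` it uses `y^{(n)} = p_n⁻¹ (y^{[n]} + (i/2) q_n y^{(n-1)})`. -/
def toJet (r : ℕ) (L : DiffExpr ℋ) (t : ℝ) : HPow ℋ r →L[ℂ] HPow ℋ (r / 2 + 1) :=
  opMatrix (r / 2 + 1) r fun i j =>
    let n := r / 2
    if i < n then (if i = j then 1 else 0)
    else if r = 1 then 1
    else if Even r then
      (if j + 1 = n then (Complex.I / 2) • (L.pInv r t * L.q n t)
      else if j + 1 = 2 * n then L.pInv r t
      else 0)
    else (if j = 2 * n then Complex.I • (1 : ℋ →L[ℂ] ℋ) else 0)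

/-- The weight `W(t, L, m)`. For `r = 2n` it is `C*⁻¹ ‖m_{αβ}‖ C⁻¹`, where `C(t, L)` sends
`(f, …, f^{(n-1)}, f^{(2n-1)}, …, f^{(n)})` to `(f, …, f^{(n-1)}, f^{[2n-1]}, …, f^{[n]})` and the
matrix `‖m_{αβ}‖` is `formMatrix n m` in the coordinates `f, …, f^{(n-1)}, f^{(n)}` and zero in the
others; so only the rows of `C⁻¹` that are collected in `toJet` enter. For odd `r` the same formula
gives the matrix with `-(1/2) s_n`, `-(1/2) q_n`, `p_n` in the last row and column. -/
def W (r : ℕ) (L m : DiffExpr ℋ) (t : ℝ) : HPow ℋ r →L[ℂ] HPow ℋ r :=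
  ContinuousLinearMap.adjoint (L.toJet r t) ∘L m.formMatrix (r / 2) t ∘L L.toJet r t

/-- The vector `F(t, L, m)` of a function `f`, for `m` of order `s`. -/
def bigF (r s : ℕ) (J : BaseInterval) (L : DiffExpr ℋ) (f : ℝ → ℋ) (t : ℝ) : HPow ℋ r :=
  WithLp.toLp 2 fun i : Fin r =>
    let n := r / 2
    if (i : ℕ) < n then (if (i : ℕ) ≤ s / 2 then jet J f t i else 0)
    else if r = 1 then f t
    else if s = 2 * n then
      (if Even r then L.quasi r J f (i - n + 1) t
      else if (i : ℕ) = 2 * n then -Complex.I • jet J f t n else 0)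
    else 0

/-- The vector `y⃗(t, L, m, f)`, for `L` of order at most `r` and `m` of order `s`. -/
def vec (r s : ℕ) (J : BaseInterval) (L m : DiffExpr ℋ) (y f : ℝ → ℋ) (t : ℝ) : HPow ℋ r :=
  WithLp.toLp 2 fun i : Fin r =>
    let n := r / 2
    if (i : ℕ) < n then jet J y t i
    else if (i : ℕ) < 2 * n then L.quasi r J y (i - n + 1) t - m.quasi s J f (i - n + 1) t
    else if r = 1 then y t
    else -Complex.I • jet J y t n

end DiffExpr

/-! ## The weight expression `m` and the space `L²_m` -/

/-- A symmetric differential expression of even order `ord` whose form is nonnegative on the closed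
interval. -/
structure WeightExpr (ℋ : Type*) [NormedAddCommGroup ℋ] [InnerProductSpace ℂ ℋ] [CompleteSpace ℋ]
    (J : BaseInterval) (ord : ℕ) extends DiffExpr ℋ where
  even : Even ord
  order : toDiffExpr.OrderLE J ord
  smooth : toDiffExpr.Smooth J ord
  p_symm : ∀ j, ∀ t ∈ J.cl, p j t = ContinuousLinearMap.adjoint (p j t)
  s_symm : ∀ j, ∀ t ∈ J.cl, s (j + 1) t = ContinuousLinearMap.adjoint (q (j + 1) t)
  nonneg : ∀ t ∈ J.cl, ∀ h : ℕ → ℋ, 0 ≤ (toDiffExpr.form ord t h h).re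

namespace WeightExpr

variable {J : BaseInterval} {s : ℕ} (m : WeightExpr ℋ J s)

theorem form_add_left (t : ℝ) (u u' v : ℕ → ℋ) :
    m.form s t (u + u') v = m.form s t u v + m.form s t u' v := by
  simp only [DiffExpr.form, Pi.add_apply, map_add, inner_add_right, Finset.sum_add_distrib,
    Finset.sum_sub_distrib]
  ring

theorem form_smul_left (t : ℝ) (c : ℂ) (u v : ℕ → ℋ) :
    m.form s t (c • u) v = c * m.form s t u v := by
  simp only [DiffExpr.form, Pi.smul_apply, map_smul, inner_smul_right, Finset.mul_sum, mul_add,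
    mul_sub, Finset.sum_sub_distrib]
  congr 1
  congr 1 <;> refine Finset.sum_congr rfl fun j _ => by ring

theorem form_conj {t : ℝ} (ht : t ∈ J.cl) (u v : ℕ → ℋ) :
    conj (m.form s t u v) = m.form s t v u := by
  have hp : ∀ j, ∀ x y : ℋ, inner ℂ (m.p j t x) y = inner ℂ x (m.p j t y) := fun j x y => by
    conv_lhs => rw [m.p_symm j t ht]
    rw [ContinuousLinearMap.adjoint_inner_left]
  have hs : ∀ j, ∀ x y : ℋ, inner ℂ (m.s (j + 1) t x) y = inner ℂ x (m.q (j + 1) t y) :=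
    fun j x y => by
      rw [m.s_symm j t ht, ContinuousLinearMap.adjoint_inner_left]
  have hq : ∀ j, ∀ x y : ℋ, inner ℂ (m.q (j + 1) t x) y = inner ℂ x (m.s (j + 1) t y) :=
    fun j x y => by
      rw [m.s_symm j t ht, ContinuousLinearMap.adjoint_inner_right]
  simp only [DiffExpr.form, map_add, map_mul, map_sum, map_sub, inner_conj_symm, hp, hs, hq,
    map_div₀, Complex.conj_I, Complex.conj_ofNat]
  congr 1
  rw [neg_div, neg_mul, ← mul_neg, ← Finset.sum_neg_distrib]
  simp only [neg_sub]

theorem form_add_right {t : ℝ} (ht : t ∈ J.cl) (u v v' : ℕ → ℋ) :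
    m.form s t u (v + v') = m.form s t u v + m.form s t u v' := by
  rw [← m.form_conj ht, form_add_left, map_add, m.form_conj ht, m.form_conj ht]

theorem form_smul_right {t : ℝ} (ht : t ∈ J.cl) (c : ℂ) (u v : ℕ → ℋ) :
    m.form s t u (c • v) = conj c * m.form s t u v := by
  rw [← m.form_conj ht, form_smul_left, map_mul, m.form_conj ht]

theorem norm_form_le {t : ℝ} (ht : t ∈ J.cl) (u v : ℕ → ℋ) :
    ‖m.form s t u v‖ ≤ (m.form s t u u).re + (m.form s t v v).re := by
  set b := m.form s t u v with hb
  obtain ⟨c, hc, hcb⟩ : ∃ c : ℂ, ‖c‖ = 1 ∧ c * b = -(‖b‖ : ℂ) := by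
    by_cases h : b = 0
    · exact ⟨1, by simp, by simp [h]⟩
    · have hb0 : (‖b‖ : ℂ) ≠ 0 := by exact_mod_cast norm_ne_zero_iff.2 h
      refine ⟨-(conj b / ‖b‖), by simp [h], ?_⟩
      field_simp
      rw [Complex.conj_mul']
  have h0 := m.nonneg t ht (c • u + v)
  have hcc : c * conj c = 1 := by rw [Complex.mul_conj']; simp [hc]
  have e1 : m.form s t (c • u + v) (c • u + v) =
      m.form s t u u + m.form s t v v + (c * b + conj (c * b)) := by
    rw [form_add_left, m.form_add_right ht, m.form_add_right ht, form_smul_left, form_smul_left,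
      m.form_smul_right ht, m.form_smul_right ht, ← m.form_conj ht u v, ← hb, map_mul]
    linear_combination (m.form s t u u) * hcc
  rw [e1, hcb] at h0
  simp at h0
  have h1 := m.nonneg t ht u
  have h2 := m.nonneg t ht v
  linarith [norm_nonneg b]

theorem continuousOn_form {f g : ℝ → ℋ} (hf : ContDiffOn ℝ (s : ℕ) f J.cl)
    (hg : ContDiffOn ℝ (s : ℕ) g J.cl) :
    ContinuousOn (fun t => m.form s t (jet J f t) (jet J g t)) J.cl := by
  have hs := m.even
  have hj : ∀ {f : ℝ → ℋ}, ContDiffOn ℝ (s : ℕ) f J.cl → ∀ j, j ≤ s →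
      ContinuousOn (fun t => jet J f t j) J.cl := fun hf j hj =>
    hf.continuousOn_iteratedDerivWithin (by exact_mod_cast hj) J.uniqueDiffOn
  refine ContinuousOn.add (continuousOn_finsetSum _ fun j hjm => ?_)
    (continuousOn_const.mul (continuousOn_finsetSum _ fun j hjm => ?_))
  · have := Finset.mem_range.1 hjm
    exact (hj hg j (by omega)).inner
      (((m.smooth.1 j (by omega)).continuousOn).clm_apply (hj hf j (by omega)))
  · have := Finset.mem_range.1 hjm
    obtain ⟨k, hk⟩ := hs
    have h2 := m.smooth.2 j (by omega)
    exact ((hj hg j (by omega)).inner (h2.2.continuousOn.clm_apply (hj hf (j + 1) (by omega)))).sub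
      ((hj hg (j + 1) (by omega)).inner (h2.1.continuousOn.clm_apply (hj hf j (by omega))))

theorem jet_add {f g : ℝ → ℋ} (hf : ContDiffOn ℝ (s : ℕ) f J.cl)
    (hg : ContDiffOn ℝ (s : ℕ) g J.cl) {t : ℝ} (ht : t ∈ J.cl) {j : ℕ} (hj : j ≤ s) :
    jet J (f + g) t j = jet J f t j + jet J g t j :=
  iteratedDerivWithin_add ht J.uniqueDiffOn
    ((hf t ht).of_le (by exact_mod_cast hj)) ((hg t ht).of_le (by exact_mod_cast hj))

theorem jet_smul (c : ℂ) {f : ℝ → ℋ} (hf : ContDiffOn ℝ (s : ℕ) f J.cl) {t : ℝ}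
    (ht : t ∈ J.cl) {j : ℕ} (hj : j ≤ s) : jet J (c • f) t j = c • jet J f t j :=
  iteratedDerivWithin_const_smul ht J.uniqueDiffOn c ((hf t ht).of_le (by exact_mod_cast hj))

theorem form_congr (t : ℝ) {u u' v v' : ℕ → ℋ} (hu : ∀ j ≤ s, u j = u' j)
    (hv : ∀ j ≤ s, v j = v' j) : m.form s t u v = m.form s t u' v' := by
  obtain ⟨k, hk⟩ := m.even
  unfold DiffExpr.form
  congr 1
  · refine Finset.sum_congr rfl fun j hj => ?_
    have := Finset.mem_range.1 hj
    rw [hu j (by omega), hv j (by omega)]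
  · congr 1
    refine Finset.sum_congr rfl fun j hj => ?_
    have := Finset.mem_range.1 hj
    rw [hu j (by omega), hv j (by omega), hu (j + 1) (by omega), hv (j + 1) (by omega)]

theorem form_jet_add {f f' : ℝ → ℋ} (hf : ContDiffOn ℝ (s : ℕ) f J.cl)
    (hf' : ContDiffOn ℝ (s : ℕ) f' J.cl) (v : ℕ → ℋ) {t : ℝ} (ht : t ∈ J.cl) :
    m.form s t (jet J (f + f') t) v = m.form s t (jet J f t) v + m.form s t (jet J f' t) v := by
  rw [← form_add_left]
  exact m.form_congr t (fun j hj => jet_add hf hf' ht hj) fun _ _ => rfl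

theorem form_jet_smul (c : ℂ) {f : ℝ → ℋ} (hf : ContDiffOn ℝ (s : ℕ) f J.cl)
    (v : ℕ → ℋ) {t : ℝ} (ht : t ∈ J.cl) :
    m.form s t (jet J (c • f) t) v = c * m.form s t (jet J f t) v := by
  rw [← form_smul_left]
  exact m.form_congr t (fun j hj => jet_smul c hf ht hj) fun _ _ => rfl

/-- `f ∈ C^s` on the closed interval and `m[f, f] = ∫ m{f, f} dt < ∞`. -/
def MemH (f : ℝ → ℋ) : Prop :=
  ContDiffOn ℝ (s : ℕ) f J.cl ∧ IntegrableOn (fun t => m.form s t (jet J f t) (jet J f t)) J.cl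

theorem integrableOn_form {f g : ℝ → ℋ} (hf : m.MemH f) (hg : m.MemH g) :
    IntegrableOn (fun t => m.form s t (jet J f t) (jet J g t)) J.cl := by
  refine Integrable.mono' (hf.2.re.add hg.2.re)
    ((m.continuousOn_form hf.1 hg.1).aestronglyMeasurable J.measurableSet_cl) ?_
  filter_upwards [ae_restrict_mem J.measurableSet_cl] with t ht
  exact m.norm_form_le ht _ _

/-- The functions `f ∈ C^s` on the closed interval with `m[f, f] < ∞`. -/
def memH : Submodule ℂ (ℝ → ℋ) where
  carrier := {f | m.MemH f}
  zero_mem' := by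
    refine ⟨contDiffOn_const, ?_⟩
    have : (fun t => m.form s t (jet J (0 : ℝ → ℋ) t) (jet J (0 : ℝ → ℋ) t)) = fun _ => 0 := by
      funext t
      have h : jet J (0 : ℝ → ℋ) t = 0 := by
        funext j
        simp [jet]
      rw [h]
      simp [DiffExpr.form]
    rw [this]
    exact integrableOn_zero
  add_mem' := by
    intro f g hf hg
    refine ⟨hf.1.add hg.1, ?_⟩
    refine IntegrableOn.congr_fun (((m.integrableOn_form hf hf).add
      (m.integrableOn_form hf hg)).add ((m.integrableOn_form hg hf).add
      (m.integrableOn_form hg hg))) ?_ J.measurableSet_cl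
    intro t ht
    have h1 := m.form_jet_add hf.1 hg.1 (jet J (f + g) t) ht
    have h2 := m.form_jet_add hf.1 hg.1 (jet J f t) ht
    have h3 := m.form_jet_add hf.1 hg.1 (jet J g t) ht
    simp only [Pi.add_apply]
    rw [h1, ← m.form_conj ht (jet J (f + g) t), ← m.form_conj ht (jet J (f + g) t), h2, h3, map_add,
      map_add, m.form_conj ht, m.form_conj ht, m.form_conj ht, m.form_conj ht]
  smul_mem' := by
    intro c f hf
    refine ⟨hf.1.const_smul c, ?_⟩
    refine IntegrableOn.congr_fun ((m.integrableOn_form hf hf).const_mul (c * conj c)) ?_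
      J.measurableSet_cl
    intro t ht
    simp only
    rw [m.form_jet_smul c hf.1 _ ht, ← m.form_conj ht (jet J (c • f) t), m.form_jet_smul c hf.1 _ ht,
      map_mul, m.form_conj ht, mul_assoc]

/-- The space `H` of these functions (a separate type, so that it carries no topology but the one of
the scalar product below). -/
def H : Type _ := m.memH

instance instAddCommGroupH : AddCommGroup m.H := inferInstanceAs (AddCommGroup m.memH)

instance instModuleH : Module ℂ m.H := inferInstanceAs (Module ℂ m.memH)

/-- An element of `H` as a function. -/
@[coe]
def H.fn {m : WeightExpr ℋ J s} (f : m.H) : ℝ → ℋ := f.1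

instance instCoeH : CoeOut m.H (ℝ → ℋ) := ⟨H.fn⟩

/-- `m[f, g] = ∫ m{f, g} dt`. -/
def dirichlet (f g : ℝ → ℋ) : ℂ := ∫ t in J.cl, m.form s t (jet J f t) (jet J g t)

/-- The (semi-definite) scalar product `(f, g)_m = m[f, g]` of `H`. -/
@[reducible]
def core : PreInnerProductSpace.Core ℂ m.H where
  inner f g := m.dirichlet g f
  conj_inner_symm f g := by
    simp only [dirichlet]
    rw [← integral_conj]
    exact setIntegral_congr_fun J.measurableSet_cl fun t ht => m.form_conj ht _ _
  re_inner_nonneg f := by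
    simp only [dirichlet]
    have h := integral_re (𝕜 := ℂ) (m.integrableOn_form f.2 f.2)
    refine le_of_le_of_eq ?_ h
    exact setIntegral_nonneg J.measurableSet_cl fun t ht => m.nonneg t ht _
  add_left f g h := by
    simp only [dirichlet]
    refine Eq.trans ?_
      (integral_add (m.integrableOn_form h.2 f.2) (m.integrableOn_form h.2 g.2))
    refine setIntegral_congr_fun J.measurableSet_cl fun t ht => ?_
    change m.form s t (jet J h.1 t) (jet J (f.1 + g.1) t) =
      m.form s t (jet J h.1 t) (jet J f.1 t) + m.form s t (jet J h.1 t) (jet J g.1 t)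
    rw [← m.form_conj ht, m.form_jet_add f.2.1 g.2.1 _ ht, map_add, m.form_conj ht, m.form_conj ht]
  smul_left f g c := by
    simp only [dirichlet]
    rw [← integral_const_mul]
    refine setIntegral_congr_fun J.measurableSet_cl fun t ht => ?_
    change m.form s t (jet J g.1 t) (jet J (c • f.1) t) =
      conj c * m.form s t (jet J g.1 t) (jet J f.1 t)
    rw [← m.form_conj ht, m.form_jet_smul c f.2.1 _ ht, map_mul, m.form_conj ht]

instance instSeminormedH : SeminormedAddCommGroup m.H :=
  @InnerProductSpace.Core.toSeminormedAddCommGroup ℂ m.H _ _ _ m.core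

instance instInnerH : InnerProductSpace ℂ m.H := InnerProductSpace.ofCore m.core

/-- The Hilbert space `L²_m`, the completion of `H`. -/
abbrev L2 : Type _ := UniformSpace.Completion m.H

/-- The class in `L²_m` of an element of `H`. -/
def cls (f : m.H) : m.L2 := (f : UniformSpace.Completion m.H)

theorem inner_cls (f g : m.H) : inner ℂ (m.cls g) (m.cls f) = m.dirichlet f g :=
  UniformSpace.Completion.inner_coe g f

end WeightExpr

/-! ## Families depending on the spectral parameter -/

/-- The condition that `-l_λ` depends on `λ` in the Nevanlinna manner, for expressions of order
`r` with coefficients defined for `λ` in a set `ℬ` containing the nonreal numbers. -/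
structure NevanlinnaFamily (J : BaseInterval) (r : ℕ) (ℬ : Set ℂ) (L : ℂ → DiffExpr ℋ) : Prop where
  nonreal : ∀ z : ℂ, z.im ≠ 0 → z ∈ ℬ
  analytic : ∀ z₀ ∈ ℬ, ∃ U ∈ 𝓝 z₀, ∀ t ∈ J.cl,
    (∀ j, 2 * j ≤ r → AnalyticOnNhd ℂ (fun z => (L z).p j t) U) ∧
    ∀ j, 2 * j + 1 ≤ r → AnalyticOnNhd ℂ (fun z => (L z).q (j + 1) t) U ∧
      AnalyticOnNhd ℂ (fun z => (L z).s (j + 1) t) U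
  order : ∀ z ∈ ℬ, (L z).OrderLE J r
  smooth : ∀ z ∈ ℬ, (L z).Smooth J r
  lead_even : Even r → ∀ z ∈ ℬ, ∀ t ∈ J.cl, IsUnit ((L z).p (r / 2) t)
  lead_odd : ¬ Even r → ∀ z ∈ ℬ, ∀ t ∈ J.cl,
    IsUnit ((L z).q (r / 2 + 1) t + (L z).s (r / 2 + 1) t)
  p_symm : ∀ z ∈ ℬ, ∀ j, ∀ t ∈ J.cl,
    (L z).p j t = ContinuousLinearMap.adjoint ((L (conj z)).p j t)
  q_symm : ∀ z ∈ ℬ, ∀ j, ∀ t ∈ J.cl,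
    (L z).q (j + 1) t = ContinuousLinearMap.adjoint ((L (conj z)).s (j + 1) t)
  dissipative : ∀ z : ℂ, z.im ≠ 0 → ∀ t ∈ J.cl, ∀ h : ℕ → ℋ,
    ((L z).form r t h h).im / z.im ≤ 0

/-- The inequality `0 ≤ m{f, f} ≤ -(Im l_λ){f, f} / Im λ` (its first half belongs to `m`). -/
def Dominates (J : BaseInterval) (r s : ℕ) (L : ℂ → DiffExpr ℋ) (m : DiffExpr ℋ) : Prop :=
  ∀ z : ℂ, z.im ≠ 0 → ∀ t ∈ J.cl, ∀ h : ℕ → ℋ,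
    (m.form s t h h).re ≤ -(((L z).form r t h h).im / z.im)

/-- The expression `(Im l_λ) / Im λ`, which for real `λ` means `∂ l_λ / ∂ λ`. -/
def imQuot (L : ℂ → DiffExpr ℋ) (z : ℂ) : DiffExpr ℋ :=
  if z.im = 0 then
    { p := fun j t => deriv (fun w => (L w).p j t) z
      q := fun j t => deriv (fun w => (L w).q j t) z
      s := fun j t => deriv (fun w => (L w).s j t) z }
  else DiffExpr.comb ((z.im : ℂ)⁻¹) (L z).im 0 (L z)

/-- Definiteness: for some `λ₀ ∈ ℬ`, some `[α, β] ∋ 0` and some `δ > 0`,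
`-∫_α^β (Im l_{λ₀} / Im λ₀){y, y} dt ≥ δ ‖y⃗(0, l_{λ₀}, m, 0)‖²` for every solution `y` of
`l_{λ₀}[y] = 0`. -/
def Definite (J : BaseInterval) (r s : ℕ) (ℬ : Set ℂ) (L : ℂ → DiffExpr ℋ) (m : DiffExpr ℋ) :
    Prop :=
  ∃ z₀ ∈ ℬ, ∃ α ∈ J.cl, ∃ β ∈ J.cl, α ≤ 0 ∧ 0 ≤ β ∧ ∃ δ > 0, ∀ y : ℝ → ℋ,
    ContDiffOn ℝ (r : ℕ) y J.cl → (∀ t ∈ J.cl, (L z₀).apply r J y t = 0) →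
    δ * ‖(L z₀).vec r s J m y 0 0‖ ^ 2 ≤
      -∫ t in α..β, ((imQuot L z₀).form r t (jet J y t) (jet J y t)).re

/-- `l = Re l_i`. -/
def lPart (L : ℂ → DiffExpr ℋ) : DiffExpr ℋ := (L Complex.I).re

/-- `l - λ m`. -/
def linPart (L : ℂ → DiffExpr ℋ) (m : DiffExpr ℋ) (z : ℂ) : DiffExpr ℋ :=
  DiffExpr.comb 1 (lPart L) (-z) m

/-- `n_λ = l - λ m - l_λ`. -/
def nPart (L : ℂ → DiffExpr ℋ) (m : DiffExpr ℋ) (z : ℂ) : DiffExpr ℋ :=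
  DiffExpr.comb 1 (linPart L m z) (-1) (L z)

/-! ## Characteristic operators and the operators `R(λ)` -/

/-- `X_λ(t)`, for nonreal `λ`, is the operator solution of the homogeneous system
`(i/2) ((Q X)' + Q* X') - H X = 0` with `X_λ(0) = 1`. -/
def IsFundamental (J : BaseInterval) (r : ℕ) (L : ℂ → DiffExpr ℋ)
    (X : ℂ → ℝ → (HPow ℋ r →L[ℂ] HPow ℋ r)) : Prop :=
  ∀ z : ℂ, z.im ≠ 0 → X z 0 = 1 ∧ ∀ t ∈ J.cl, DifferentiableWithinAt ℝ (X z) J.cl t ∧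
    (Complex.I / 2) • (derivWithin (fun τ => (L z).Q r τ * X z τ) J.cl t
      + ContinuousLinearMap.adjoint ((L z).Q r t) * derivWithin (X z) J.cl t)
      - (L z).H r t * X z t = 0

/-- The kernel `X_λ(t) {M(λ) - (1/2) sgn(τ - t) (iG)⁻¹} X_{λ̄}*(τ)`, `G = Re Q(0, l_λ)`. -/
def greenKernel (r : ℕ) (L : ℂ → DiffExpr ℋ) (X : ℂ → ℝ → (HPow ℋ r →L[ℂ] HPow ℋ r))
    (M : ℂ → (HPow ℋ r →L[ℂ] HPow ℋ r)) (z : ℂ) (t τ : ℝ) : HPow ℋ r →L[ℂ] HPow ℋ r :=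
  X z t * (M z - ((1 / 2 * Real.sign (τ - t) : ℝ) : ℂ) •
      Ring.inverse (Complex.I • rePart ((L z).Q r 0)))
    * ContinuousLinearMap.adjoint (X (conj z) τ)

/-- `(Re Q(t, l_λ) x, x)`. -/
def energy (r : ℕ) (L : ℂ → DiffExpr ℋ) (z : ℂ) (t : ℝ) (x : HPow ℋ r) : ℝ :=
  (inner ℂ x (rePart ((L z).Q r t) x)).re

/-- The weight `W(t, l_λ, -Im l_λ / Im λ)`. -/
def weight (r : ℕ) (L : ℂ → DiffExpr ℋ) (z : ℂ) (t : ℝ) : HPow ℋ r →L[ℂ] HPow ℋ r :=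
  (L z).W r (DiffExpr.comb (-1) (imQuot L z) 0 (L z)) t

/-- `M(λ)` is a characteristic operator of the equation `l_λ[y] = -(Im l_λ)[f] / Im λ`. -/
structure IsCharacteristicOperator (J : BaseInterval) (r : ℕ) (L : ℂ → DiffExpr ℋ)
    (X : ℂ → ℝ → (HPow ℋ r →L[ℂ] HPow ℋ r)) (M : ℂ → (HPow ℋ r →L[ℂ] HPow ℋ r)) : Prop where
  analytic : AnalyticOnNhd ℂ M {z : ℂ | z.im ≠ 0}
  symm : ∀ z : ℂ, z.im ≠ 0 → M z = ContinuousLinearMap.adjoint (M (conj z))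
  boundary : ∀ z : ℂ, z.im ≠ 0 → ∀ F : ℝ → HPow ℋ r,
    AEStronglyMeasurable F (volume.restrict J.cl) →
    IntegrableOn (fun t => (inner ℂ (F t) (weight r L z t (F t))).re) J.cl →
    (∃ α ∈ J.cl, ∃ β ∈ J.cl, ∀ t ∈ J.cl, t ∉ Icc α β → F t = 0) →
    ∀ x : ℝ → HPow ℋ r,
      (∀ t, x t = ∫ τ in J.cl, greenKernel r L X M z t τ (weight r L z τ (F τ))) →
      ∃ ℓ : ℝ, ℓ ≤ 0 ∧ Tendsto
        (fun e : ℝ × ℝ => z.im * (energy r L z e.2 (x e.2) - energy r L z e.1 (x e.1)))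
        J.ends (𝓝 ℓ)

/-- `y` is, on the closed interval, the first component of the (improper, norm convergent) integral
`∫ X_λ(t) {M(λ) - (1/2) sgn(τ - t) (iG)⁻¹} X_{λ̄}*(τ) W(τ, l_{λ̄}, m) F(τ, l_{λ̄}, m) dτ`
over the interval. -/
def IsResolventValue {J : BaseInterval} (r : ℕ) [NeZero r] {s : ℕ} (L : ℂ → DiffExpr ℋ)
    (m : WeightExpr ℋ J s) (X : ℂ → ℝ → (HPow ℋ r →L[ℂ] HPow ℋ r))
    (M : ℂ → (HPow ℋ r →L[ℂ] HPow ℋ r)) (z : ℂ) (f y : ℝ → ℋ) : Prop :=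
  ∃ x : ℝ → HPow ℋ r, ∀ t ∈ J.cl,
    Tendsto (fun e : ℝ × ℝ => ∫ τ in e.1..e.2, greenKernel r L X M z t τ
        ((L (conj z)).W r m.toDiffExpr τ ((L (conj z)).bigF r s J f τ))) J.ends (𝓝 (x t)) ∧
      y t = x t 0

/-- `R(λ)` is the closure in `L²_m` of the operator `f ↦ y₁(·, λ, f)`, `f ∈ H`. -/
def IsResolvent {J : BaseInterval} (r : ℕ) [NeZero r] {s : ℕ} (L : ℂ → DiffExpr ℋ)
    (m : WeightExpr ℋ J s) (X : ℂ → ℝ → (HPow ℋ r →L[ℂ] HPow ℋ r))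
    (M : ℂ → (HPow ℋ r →L[ℂ] HPow ℋ r)) (R : ℂ → (m.L2 →L[ℂ] m.L2)) : Prop :=
  ∀ z : ℂ, z.im ≠ 0 →
    closure {u : m.L2 × m.L2 | ∃ f y : m.H, IsResolventValue r L m X M z f y ∧
      u = (m.cls f, m.cls y)} = {u | u.2 = R z u.1}

/-! ## Abstract notions in a Hilbert space -/

section Abstract

variable {K : Type*} [NormedAddCommGroup K] [InnerProductSpace ℂ K] [CompleteSpace K]

/-- A generalized spectral family: `0 ≤ E_μ ≤ E_ν ≤ 1` for `μ < ν`, `E_μ = E_{μ-0}`,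
`E_{-∞} = 0` (strong limits). -/
structure SpectralFamily (K : Type*) [NormedAddCommGroup K] [InnerProductSpace ℂ K]
    [CompleteSpace K] where
  E : ℝ → (K →L[ℂ] K)
  nonneg : ∀ μ, (E μ).IsPositive
  mono : ∀ μ ν, μ < ν → (E ν - E μ).IsPositive
  le_one : ∀ μ, (1 - E μ).IsPositive
  left_cont : ∀ μ f, Tendsto (fun ν => E ν f) (𝓝[<] μ) (𝓝 (E μ f))
  tendsto_bot : ∀ f, Tendsto (fun ν => E ν f) atBot (𝓝 0)

theorem SpectralFamily.monotone (𝓔 : SpectralFamily K) (f : K) :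
    Monotone fun μ => (inner ℂ f (𝓔.E μ f)).re := by
  intro μ ν h
  rcases h.eq_or_lt with rfl | h
  · exact le_rfl
  have := (𝓔.mono μ ν h).re_inner_nonneg_right f
  simp only [sub_apply, inner_sub_right, map_sub] at this
  simpa using this

/-- The measure `d(E_μ f, f)` on the line. -/
def SpectralFamily.measure (𝓔 : SpectralFamily K) (f : K) : Measure ℝ :=
  (𝓔.monotone f).stieltjesFunction.measure

/-- `R(λ) = ∫ dE_μ / (μ - λ)` for nonreal `λ`, i.e.
`(R(λ) f, f) = ∫ d(E_μ f, f) / (μ - λ)` for all `f`. -/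
def SpectralFamily.Represents (𝓔 : SpectralFamily K) (R : ℂ → (K →L[ℂ] K)) : Prop :=
  ∀ z : ℂ, z.im ≠ 0 → ∀ f : K, inner ℂ f (R z f) = ∫ μ, ((μ : ℂ) - z)⁻¹ ∂(𝓔.measure f)

/-- `E_∞ = T` (strong limit). -/
def SpectralFamily.HasTop (𝓔 : SpectralFamily K) (T : K →L[ℂ] K) : Prop :=
  ∀ f, Tendsto (fun μ => 𝓔.E μ f) atTop (𝓝 (T f))

/-- `R` is a generalized resolvent of the symmetric relation `S` in `K`: the compression to `K` of
the resolvent of a self-adjoint relation `A ⊇ S` in a Hilbert space `K' ⊇ K` (the inclusion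
being an isometry `V`), i.e. `R(λ) = V* (A - λ)⁻¹ V` for nonreal `λ`. -/
def IsGeneralizedResolvent.{w} (S : Set (K × K)) (R : ℂ → (K →L[ℂ] K)) : Prop :=
  ∃ (K' : Type w) (_ : NormedAddCommGroup K') (_ : InnerProductSpace ℂ K') (_ : CompleteSpace K')
    (V : K →ₗᵢ[ℂ] K') (A : Submodule ℂ (K' × K')), A.adjoint = A ∧
    (∀ u ∈ S, (V u.1, V u.2) ∈ A) ∧
    ∀ z : ℂ, z.im ≠ 0 → ∀ f : K, ∃ x : K', (x, V f + z • x) ∈ A ∧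
      R z f = ContinuousLinearMap.adjoint V.toContinuousLinearMap x

end Abstract

/-! ## The minimal relation of the pair `l, m` -/

/-- The closure in `L²_m × L²_m` of the relation of all pairs `{y, g}`, `y ∈ C^r`, `g ∈ H`,
`l[y] = m[g]`, such that `y⃗(t, l, m, g)` vanishes at the finite ends of the interval and near the
infinite ones. -/
def minimalRelation {J : BaseInterval} (r : ℕ) {s : ℕ} (l : DiffExpr ℋ) (m : WeightExpr ℋ J s) :
    Set (m.L2 × m.L2) :=
  closure {u | ∃ y g : m.H, ContDiffOn ℝ (r : ℕ) (y : ℝ → ℋ) J.cl ∧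
    (∀ t ∈ J.cl, l.apply r J y t = m.apply s J g t) ∧
    (∀ t : ℝ, J.a = (t : EReal) → l.vec r s J m.toDiffExpr y g t = 0) ∧
    (∀ t : ℝ, J.b = (t : EReal) → l.vec r s J m.toDiffExpr y g t = 0) ∧
    (J.a = ⊥ → ∃ T : ℝ, ∀ t ∈ J.cl, t < T → l.vec r s J m.toDiffExpr y g t = 0) ∧
    (J.b = ⊤ → ∃ T : ℝ, ∀ t ∈ J.cl, T < t → l.vec r s J m.toDiffExpr y g t = 0) ∧
    u = (m.cls y, m.cls g)}

end OpDiff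

end

open OpDiff

universe u w

/-!
# Equality of the limits `E_∞` and `𝓔_∞` of two generalized spectral families

Let `λ = iτ`, `f ∈ H`, `y₁ = R(λ) f` and `y = R_λ f`. The generalized spectral family of a family
`R(λ)` remembers its limit at infinity through `-iτ (R(iτ) f, f) → (E_∞ f, f)`
(`SpectralFamily.tendsto_resolvent`). Hence it is enough to show `‖y₁ - y‖ = o(1 / τ)` in `L²_m`
(`SpectralFamily.exists_common_top`), and since `τ ‖R_{iτ} f‖ ≤ ‖f‖`, that `‖y₁ - y‖ ≤ 2 ε ‖y‖` for
every `ε > 0` and all large `τ`.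

*Energy estimate.* The functions `y₁` and `y` solve `l_λ[y₁] = m[f]` and `l[y] - λ m[y] = m[f]`,
where `l_λ = l - λ m - n_λ`. Put `z = y₁ - y`. By Green's formula
(`IsQuasiSolution.hasDerivAt_sum_inner`, `energy_vec_sub`) the derivative of the energy
`(Re Q z⃗, z⃗) / τ` is `-(2 / τ) Im (l_λ{z, z} - n_λ{y, z})`. The first term is at least `2 m{z, z}`,
because `m` is dominated by `-Im l_λ / Im λ`. The boundary condition says that the total increment
of the energy is at most `0`, so `m[z, z]` is bounded by an integral of `n_λ{y, z} / τ`. If the form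
of `n_λ` is bounded by `ε τ` times that of `m`, this gives the estimate
(`norm_sub_le_of_isQuasiSolution`).

*Smallness of `n_λ`.* For a fixed jet `u` the function `λ ↦ n_λ{u, u}` is analytic in the upper half
plane with nonnegative imaginary part, and its value at `i` is purely imaginary. On the imaginary
axis its imaginary part is `o(τ) m{u, u}` by assumption. The Schwarz–Pick inequality
(`norm_deriv_le_of_im_nonneg`) bounds the derivative by the imaginary part, and integration along
the axis gives the same `o(τ) m{u, u}` for the whole value (`exists_norm_imaginary_axis_le`).
Polarization passes to `n_λ{u, v}` (`exists_norm_nPart_form_le`). All bounds are uniform in `t`.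

*The kernel solves the equation.* The function `y₁` is given only as the first component of an
improper integral against `K_λ(t, τ)`. The fundamental solution has the conserved quantity
`X_{λ̄}* (Re Q) X_λ = G`, so that `(Re Q) X_λ G⁻¹ X_{λ̄}*` is a continuous path of idempotents which is
the identity at `t = 0`, and therefore everywhere (`IsFundamental.rePart_mul_mul_star`). This is
what variation of constants needs (`IsFundamental.exists_hasDerivAt`). The rows of the resulting
first order system are the recursion for the quasi-derivatives of a solution of `l_λ[y₁] = m[f]`
(`isQuasiSolution_of_system`, `IsResolventValue.isQuasiSolution`). The function `y₁` need not have
`r` derivatives in the classical sense, and so both equations are read in the sense of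
quasi-derivatives, `IsQuasiSolution`.
-/

noncomputable section

set_option linter.unusedSectionVars false

namespace OpDiff

/-! ### Spectral families and generalized resolvents -/

section Spectral

variable {K : Type*} [NormedAddCommGroup K] [InnerProductSpace ℂ K] [CompleteSpace K]

theorem norm_sq_le_re_inner_of_isPositive {P : K →L[ℂ] K} (hP : P.IsPositive)
    (h1 : (1 - P).IsPositive) (f : K) : ‖P f‖ ^ 2 ≤ (inner ℂ f (P f)).re := by
  -- `P - P² = (1 - P) P (1 - P) + P (1 - P) P`
  have h2 := hP.re_inner_nonneg_right (f - P f)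
  have h3 := h1.re_inner_nonneg_right (P f)
  have hs : ∀ x y : K, inner ℂ (P x) y = inner ℂ x (P y) := hP.inner_left_eq_inner_right
  have e : ‖P f‖ ^ 2 = (inner ℂ f (P (P f))).re := by
    rw [← hs, ← inner_self_eq_norm_sq (𝕜 := ℂ)]; rfl
  simp only [sub_apply, map_sub, inner_sub_left, inner_sub_right, hs,
    one_apply_eq_self, RCLike.re_eq_complex_re] at h2 h3
  rw [e]
  linarith

namespace SpectralFamily

variable (𝓔 : SpectralFamily K)

theorem re_inner_le (f : K) (μ : ℝ) : (inner ℂ f (𝓔.E μ f)).re ≤ ‖f‖ ^ 2 := by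
  have h := (𝓔.le_one μ).re_inner_nonneg_right f
  simp only [sub_apply, one_apply_eq_self, inner_sub_right, map_sub] at h
  rw [inner_self_eq_norm_sq (𝕜 := ℂ)] at h
  simpa using h

theorem norm_sub_sq_le (f : K) {μ ν : ℝ} (h : μ ≤ ν) :
    ‖𝓔.E ν f - 𝓔.E μ f‖ ^ 2 ≤ (inner ℂ f (𝓔.E ν f)).re - (inner ℂ f (𝓔.E μ f)).re := by
  rcases h.eq_or_lt with rfl | h
  · simp
  have h1 : (1 - (𝓔.E ν - 𝓔.E μ)).IsPositive := by
    have := (𝓔.le_one ν).add (𝓔.nonneg μ)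
    rwa [show 1 - 𝓔.E ν + 𝓔.E μ = 1 - (𝓔.E ν - 𝓔.E μ) by abel] at this
  have := norm_sq_le_re_inner_of_isPositive (𝓔.mono μ ν h) h1 f
  simpa [inner_sub_right] using this

/-- The strong limit `E_∞` exists: a bounded monotone family of positive operators converges
strongly. -/
theorem exists_hasTop : ∃ T : K →L[ℂ] K, 𝓔.HasTop T := by
  have hlim : ∀ f : K, ∃ g, Tendsto (fun μ => 𝓔.E μ f) atTop (𝓝 g) := by
    intro f
    have hb : BddAbove (range fun μ => (inner ℂ f (𝓔.E μ f)).re) :=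
      ⟨‖f‖ ^ 2, by rintro _ ⟨μ, rfl⟩; exact 𝓔.re_inner_le f μ⟩
    have ht := tendsto_atTop_ciSup (𝓔.monotone f) hb
    refine cauchySeq_tendsto_of_complete (Metric.cauchySeq_iff'.2 fun ε hε => ?_)
    obtain ⟨N, hN⟩ := (ht.eventually (lt_mem_nhds (sub_lt_self _ (pow_pos hε 2)))).exists
    refine ⟨N, fun ν hν => ?_⟩
    rw [dist_eq_norm]
    refine lt_of_pow_lt_pow_left₀ 2 hε.le ?_
    have h1 := 𝓔.norm_sub_sq_le f hν
    have h2 := le_ciSup hb ν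
    linarith
  choose g hg using hlim
  exact ⟨continuousLinearMapOfTendsto 𝓔.E (tendsto_pi_nhds.2 hg), hg⟩

variable {𝓔}

theorem tendsto_measure_fn_atTop {T : K →L[ℂ] K} (hT : 𝓔.HasTop T) (f : K) :
    Tendsto (fun μ => (inner ℂ f (𝓔.E μ f)).re) atTop (𝓝 (inner ℂ f (T f)).re) :=
  (Complex.continuous_re.tendsto _).comp (tendsto_const_nhds.inner (hT f))

theorem HasTop.measure_univ {T : K →L[ℂ] K} (hT : 𝓔.HasTop T) (f : K) :
    𝓔.measure f univ = ENNReal.ofReal (inner ℂ f (T f)).re := by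
  have h0 : Tendsto (fun μ => (inner ℂ f (𝓔.E μ f)).re) atBot (𝓝 0) := by
    have := (Complex.continuous_re.tendsto _).comp
      ((tendsto_const_nhds (x := f)).inner (𝕜 := ℂ) (𝓔.tendsto_bot f))
    simpa [Function.comp_def] using this
  have := StieltjesFunction.measure_univ (𝓔.monotone f).stieltjesFunction
    (tendsto_rightLim_atBot_of_tendsto h0)
    (tendsto_rightLim_atTop_of_tendsto (tendsto_measure_fn_atTop hT f))
  rw [sub_zero] at this
  exact this

theorem HasTop.inner_eq {T : K →L[ℂ] K} (hT : 𝓔.HasTop T) (f : K) :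
    inner ℂ f (T f) = ((inner ℂ f (T f)).re : ℂ) ∧ 0 ≤ (inner ℂ f (T f)).re := by
  have h1 : ∀ μ, inner ℂ f (𝓔.E μ f) = ((inner ℂ f (𝓔.E μ f)).re : ℂ) := fun μ => by
    have := (𝓔.nonneg μ).inner_nonneg_right f
    rw [Complex.nonneg_iff] at this
    exact Complex.ext (by simp) (by simpa using this.2.symm)
  have h2 : Tendsto (fun μ => inner ℂ f (𝓔.E μ f)) atTop (𝓝 (inner ℂ f (T f))) :=
    tendsto_const_nhds.inner (hT f)
  refine ⟨tendsto_nhds_unique h2 ?_, ge_of_tendsto' (tendsto_measure_fn_atTop hT f) fun μ =>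
    (𝓔.nonneg μ).re_inner_nonneg_right f⟩
  refine Tendsto.congr (fun μ => (h1 μ).symm) ?_
  exact (Complex.continuous_ofReal.tendsto _).comp (tendsto_measure_fn_atTop hT f)

theorem norm_ofReal_sub_I_mul_ge (μ τ : ℝ) : |τ| ≤ ‖(μ : ℂ) - Complex.I * τ‖ := by
  have := Complex.abs_im_le_norm ((μ : ℂ) - Complex.I * τ)
  simpa using this

/-- `-λ (R(λ) f, f) → (E_∞ f, f)` as `λ = iτ`, `τ → +∞`. -/
theorem tendsto_resolvent {R : ℂ → (K →L[ℂ] K)} (hR : 𝓔.Represents R) {T : K →L[ℂ] K}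
    (hT : 𝓔.HasTop T) (f : K) :
    Tendsto (fun τ : ℝ => -(Complex.I * τ) * inner ℂ f (R (Complex.I * τ) f)) atTop
      (𝓝 (inner ℂ f (T f))) := by
  have hfin : IsFiniteMeasure (𝓔.measure f) := ⟨by
    rw [hT.measure_univ f]; exact ENNReal.ofReal_lt_top⟩
  have hint : Tendsto (fun τ : ℝ => ∫ μ, -(Complex.I * τ) * ((μ : ℂ) - Complex.I * τ)⁻¹ ∂(𝓔.measure f))
      atTop (𝓝 (∫ _, (1 : ℂ) ∂(𝓔.measure f))) := by
    refine tendsto_integral_filter_of_dominated_convergence (fun _ => (1 : ℝ)) ?_ ?_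
      (integrable_const _) ?_
    · refine Eventually.of_forall fun τ => ?_
      have : Measurable fun μ : ℝ => -(Complex.I * τ) * ((μ : ℂ) - Complex.I * τ)⁻¹ := by
        fun_prop
      exact this.aestronglyMeasurable
    · refine Eventually.of_forall fun τ => Eventually.of_forall fun μ => ?_
      rw [norm_mul, norm_inv, norm_neg, norm_mul, Complex.norm_I, one_mul, Complex.norm_real,
        Real.norm_eq_abs, ← div_eq_mul_inv]
      exact div_le_one_of_le₀ (norm_ofReal_sub_I_mul_ge μ τ) (norm_nonneg _)
    · refine Eventually.of_forall fun μ => ?_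
      rw [tendsto_iff_norm_sub_tendsto_zero]
      have h0 : Tendsto (fun τ : ℝ => |μ| / τ) atTop (𝓝 0) := tendsto_const_nhds.div_atTop tendsto_id
      refine squeeze_zero' (Eventually.of_forall fun _ => norm_nonneg _) ?_ h0
      filter_upwards [eventually_gt_atTop 0] with τ hτ
      have hge := norm_ofReal_sub_I_mul_ge μ τ
      rw [abs_of_pos hτ] at hge
      have hne : (μ : ℂ) - Complex.I * τ ≠ 0 := norm_pos_iff.1 (hτ.trans_le hge)
      have : -(Complex.I * τ) * ((μ : ℂ) - Complex.I * τ)⁻¹ - 1 =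
          -μ / ((μ : ℂ) - Complex.I * τ) := by
        field_simp
        ring
      rw [this, norm_div, norm_neg, Complex.norm_real, Real.norm_eq_abs]
      exact div_le_div_of_nonneg_left (abs_nonneg _) hτ hge
  have hone : ∫ _, (1 : ℂ) ∂(𝓔.measure f) = inner ℂ f (T f) := by
    rw [integral_const, measureReal_def, hT.measure_univ f,
      ENNReal.toReal_ofReal (hT.inner_eq f).2, (hT.inner_eq f).1]
    simp
  rw [hone] at hint
  refine hint.congr' ?_
  filter_upwards [eventually_gt_atTop 0] with τ hτ
  rw [integral_const_mul, hR (Complex.I * τ) (by simpa using hτ.ne') f]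

/-- Two spectral families have the same limit at `+∞` as soon as the corresponding
(generalized) resolvents differ by `o(1 / τ)` at `iτ`. -/
theorem exists_common_top {𝓔 𝓔' : SpectralFamily K} {R R' : ℂ → (K →L[ℂ] K)}
    (hR : 𝓔.Represents R) (hR' : 𝓔'.Represents R')
    (h : ∀ f, Tendsto (fun τ : ℝ => τ * ‖R (Complex.I * τ) f - R' (Complex.I * τ) f‖) atTop (𝓝 0)) :
    ∃ T : K →L[ℂ] K, 𝓔.HasTop T ∧ 𝓔'.HasTop T := by
  obtain ⟨T, hT⟩ := 𝓔.exists_hasTop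
  obtain ⟨T', hT'⟩ := 𝓔'.exists_hasTop
  suffices T = T' from ⟨T, hT, this ▸ hT'⟩
  refine ContinuousLinearMap.coe_injective ((ext_inner_map _ _).1 fun f => ?_)
  rw [← inner_conj_symm, ← inner_conj_symm ((T' : K →ₗ[ℂ] K) f)]
  congr 1
  have h1 := (tendsto_resolvent hR hT f).sub (tendsto_resolvent hR' hT' f)
  have h2 : Tendsto (fun τ : ℝ => -(Complex.I * τ) * inner ℂ f (R (Complex.I * τ) f)
      - -(Complex.I * τ) * inner ℂ f (R' (Complex.I * τ) f)) atTop (𝓝 0) := by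
    have h3 : Tendsto (fun τ : ℝ => ‖f‖ * (τ * ‖R (Complex.I * τ) f - R' (Complex.I * τ) f‖))
        atTop (𝓝 0) := by simpa using (h f).const_mul ‖f‖
    refine squeeze_zero_norm' ?_ h3
    filter_upwards [eventually_gt_atTop 0] with τ hτ
    rw [← mul_sub, ← inner_sub_right, norm_mul, norm_neg, norm_mul, Complex.norm_I, one_mul,
      Complex.norm_real, Real.norm_eq_abs, abs_of_pos hτ, mul_left_comm]
    gcongr
    exact norm_inner_le_norm _ _
  exact sub_eq_zero.1 (tendsto_nhds_unique h1 h2)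

end SpectralFamily

/-- A generalized resolvent compresses the resolvent of a self-adjoint relation, whose norm is at
most `1 / |Im z|`. -/
theorem IsGeneralizedResolvent.norm_apply_le {S : Set (K × K)} {R : ℂ → (K →L[ℂ] K)}
    (h : IsGeneralizedResolvent S R) {z : ℂ} (hz : z.im ≠ 0) (f : K) :
    |z.im| * ‖R z f‖ ≤ ‖f‖ := by
  obtain ⟨K', _, _, _, V, A, hA, -, hAz⟩ := h
  obtain ⟨x, hx, hRx⟩ := hAz z hz f
  have h1 : ‖R z f‖ ≤ ‖x‖ := by
    rw [hRx]
    refine (ContinuousLinearMap.le_opNorm _ _).trans (mul_le_of_le_one_left (norm_nonneg _) ?_)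
    rw [LinearIsometryEquiv.norm_map]
    exact V.norm_toContinuousLinearMap_le
  have h2 := hx
  rw [← hA, Submodule.mem_adjoint_iff] at h2
  have h3 := congrArg Complex.im (h2 _ _ hx)
  simp only [inner_add_left, inner_add_right, inner_smul_left, inner_smul_right, Complex.sub_im,
    Complex.add_im, Complex.mul_im, Complex.conj_re, Complex.conj_im, Complex.zero_im] at h3
  have h4 : (inner ℂ x x).re = ‖x‖ ^ 2 := inner_self_eq_norm_sq (𝕜 := ℂ) x
  have h5 : (inner ℂ x x).im = 0 := inner_self_im (𝕜 := ℂ) x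
  have h6 : (inner ℂ x (V f)).im = -(inner ℂ (V f) x).im := by
    rw [← inner_conj_symm, Complex.conj_im]
  have h7 : |(inner ℂ (V f) x).im| ≤ ‖f‖ * ‖x‖ := by
    refine (Complex.abs_im_le_norm _).trans ((norm_inner_le_norm _ _).trans ?_)
    rw [V.norm_map]
  rw [h4, h5, h6] at h3
  have h8 : z.im * ‖x‖ ^ 2 = (inner ℂ (V f) x).im := by linarith
  have h9 : |z.im| * ‖x‖ * ‖x‖ ≤ ‖f‖ * ‖x‖ := by
    rw [← h8, abs_mul, abs_of_nonneg (sq_nonneg ‖x‖)] at h7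
    nlinarith
  refine (mul_le_mul_of_nonneg_left h1 (abs_nonneg _)).trans ?_
  rcases (norm_nonneg x).eq_or_lt with h0 | h0
  · rw [← h0]; simp
  · exact le_of_mul_le_mul_right h9 h0

end Spectral

/-! ### Growth of scalar Nevanlinna functions along the imaginary axis -/

section Nevanlinna

open Complex Metric

/-- The Schwarz lemma for a function with nonnegative imaginary part on a half plane, applied on
the largest disc about `w` after a Cayley transformation. -/
theorem norm_deriv_le_of_im_nonneg {h : ℂ → ℂ} (hd : DifferentiableOn ℂ h {z | 0 < z.im})
    (h0 : ∀ z : ℂ, 0 < z.im → 0 ≤ (h z).im) {w : ℂ} (hw : 0 < w.im) :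
    ‖deriv h w‖ ≤ 2 * (h w).im / w.im := by
  have hopen : IsOpen {z : ℂ | 0 < z.im} := isOpen_lt continuous_const continuous_im
  have hball : ball w w.im ⊆ {z : ℂ | 0 < z.im} := by
    intro z hz
    have h1 := abs_im_le_norm (z - w)
    rw [mem_ball, dist_eq_norm] at hz
    rw [sub_im] at h1
    have := (abs_lt.1 (h1.trans_lt hz)).1
    simp only [mem_ofPred_eq]
    linarith
  have hdw : DifferentiableAt ℂ h w := hd.differentiableAt (hopen.mem_nhds hw)
  -- the Cayley transformation needs `Im h(w) + ε > 0`
  have key : ∀ ε : ℝ, 0 < ε → ‖deriv h w‖ ≤ 2 * ((h w).im + ε) / w.im := by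
    intro ε hε
    set b : ℂ := conj (h w) - 2 * ε * I with hb
    have hbim : b.im = -(h w).im - 2 * ε := by simp [hb]
    have hbre : b.re = (h w).re := by simp [hb]
    have hne : ∀ z : ℂ, 0 < z.im → h z - b ≠ 0 := by
      intro z hz he
      have := congrArg Complex.im he
      rw [sub_im, hbim, zero_im] at this
      have h1 := h0 z hz
      have h2 := h0 w hw
      linarith
    set g : ℂ → ℂ := fun z => (h z - h w) / (h z - b) with hg
    have hgd : DifferentiableOn ℂ g (ball w w.im) :=
      ((hd.mono hball).sub_const _).div ((hd.mono hball).sub_const _) fun z hz => hne z (hball hz)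
    have hgw : g w = 0 := by simp [hg]
    have hmaps : MapsTo g (ball w w.im) (closedBall (g w) 1) := by
      intro z hz
      rw [hgw, mem_closedBall_zero_iff, hg]
      simp only
      rw [norm_div]
      refine div_le_one_of_le₀ ?_ (norm_nonneg _)
      rw [← sq_le_sq₀ (norm_nonneg _) (norm_nonneg _), ← normSq_eq_norm_sq, ← normSq_eq_norm_sq,
        normSq_apply, normSq_apply, sub_re, sub_im, sub_re, sub_im, hbim, hbre]
      have h1 := h0 z (hball hz)
      have h2 := h0 w hw
      nlinarith [mul_nonneg h1 h2, mul_nonneg h1 hε.le, mul_nonneg h2 hε.le]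
    have h3 := norm_deriv_le_div_of_mapsTo_ball hgd hmaps hw
    have h4 : HasDerivAt g (deriv h w / (h w - b)) w := by
      refine ((hdw.hasDerivAt.sub_const (h w)).div
        (hdw.hasDerivAt.sub_const b) (hne w hw)).congr_deriv ?_
      have := hne w hw
      rw [sub_self, zero_mul, sub_zero, pow_two, mul_div_mul_right _ _ this]
    rw [h4.deriv, norm_div, div_le_iff₀ (norm_pos_iff.2 (hne w hw))] at h3
    have h5 : ‖h w - b‖ = 2 * ((h w).im + ε) := by
      have : h w - b = ((2 * ((h w).im + ε) : ℝ) : ℂ) * I := by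
        apply Complex.ext
        · simp [hbre]
        · simp [hbim]; ring
      have h2 := h0 w hw
      rw [this, norm_mul, norm_I, mul_one, norm_real, Real.norm_of_nonneg (by linarith)]
    rw [h5] at h3
    calc _ ≤ _ := h3
      _ = _ := by ring
  have hlim : Tendsto (fun ε : ℝ => 2 * ((h w).im + ε) / w.im) (𝓝[>] 0)
      (𝓝 (2 * ((h w).im + 0) / w.im)) := by
    refine Tendsto.mono_left (Continuous.tendsto ?_ 0) nhdsWithin_le_nhds
    fun_prop
  rw [add_zero] at hlim
  exact ge_of_tendsto hlim (eventually_mem_nhdsWithin.mono fun ε hε => key ε hε)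

theorem hasDerivAt_imaginary_axis {h : ℂ → ℂ} (hd : DifferentiableOn ℂ h {z | 0 < z.im})
    {τ : ℝ} (hτ : 0 < τ) :
    HasDerivAt (fun σ : ℝ => h (I * σ)) (deriv h (I * τ) * I) τ := by
  have hopen : IsOpen {z : ℂ | 0 < z.im} := isOpen_lt continuous_const continuous_im
  have h1 : HasDerivAt h (deriv h (I * τ)) (I * τ) :=
    (hd.differentiableAt (hopen.mem_nhds (by simpa using hτ))).hasDerivAt
  have h2 : HasDerivAt (fun σ : ℝ => I * (σ : ℂ)) I τ := by
    simpa using (hasDerivAt_id (τ : ℂ)).comp_ofReal.const_mul I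
  exact h1.comp τ h2

theorem norm_deriv_imaginary_axis_le {h : ℂ → ℂ} (hd : DifferentiableOn ℂ h {z | 0 < z.im})
    (h0 : ∀ z : ℂ, 0 < z.im → 0 ≤ (h z).im) {τ : ℝ} (hτ : 0 < τ) :
    ‖deriv h (I * τ) * I‖ ≤ 2 * (h (I * τ)).im / τ := by
  simpa using norm_deriv_le_of_im_nonneg hd h0 (w := I * τ) (by simpa using hτ)

/-- A Harnack inequality along the imaginary axis: `τ² Im h(iτ)` does not decrease. -/
theorem monotoneOn_sq_mul_im {h : ℂ → ℂ} (hd : DifferentiableOn ℂ h {z | 0 < z.im})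
    (h0 : ∀ z : ℂ, 0 < z.im → 0 ≤ (h z).im) :
    MonotoneOn (fun τ : ℝ => τ ^ 2 * (h (I * τ)).im) (Ioi 0) := by
  have hder : ∀ τ : ℝ, 0 < τ → HasDerivAt (fun τ : ℝ => τ ^ 2 * (h (I * τ)).im)
      (2 * τ * (h (I * τ)).im + τ ^ 2 * (deriv h (I * τ) * I).im) τ := by
    intro τ hτ
    have h1 := (hasDerivAt_pow 2 τ).mul
      (imCLM.hasFDerivAt.comp_hasDerivAt τ (hasDerivAt_imaginary_axis hd hτ))
    refine HasDerivAt.congr_deriv h1 ?_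
    simp
  refine monotoneOn_of_deriv_nonneg (convex_Ioi 0)
    (fun τ hτ => (hder τ hτ).continuousAt.continuousWithinAt)
    (fun τ hτ => (hder τ (interior_subset hτ)).differentiableAt.differentiableWithinAt) ?_
  intro τ hτ
  have hτ : 0 < τ := interior_subset hτ
  rw [(hder τ hτ).deriv]
  have h1 := (abs_le.1 ((abs_im_le_norm _).trans (norm_deriv_imaginary_axis_le hd h0 hτ))).1
  have h2 : τ ^ 2 * -(2 * (h (I * τ)).im / τ) ≤ τ ^ 2 * (deriv h (I * τ) * I).im :=
    mul_le_mul_of_nonneg_left h1 (sq_nonneg τ)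
  have h3 : τ ^ 2 * -(2 * (h (I * τ)).im / τ) = -(2 * τ * (h (I * τ)).im) := by
    field_simp
  linarith

theorem norm_sub_imaginary_axis_le {h : ℂ → ℂ} (hd : DifferentiableOn ℂ h {z | 0 < z.im})
    (h0 : ∀ z : ℂ, 0 < z.im → 0 ≤ (h z).im) {σ τ C : ℝ} (hσ : 0 < σ) (hστ : σ ≤ τ)
    (hC : ∀ x ∈ Icc σ τ, 2 * (h (I * x)).im / x ≤ C) :
    ‖h (I * τ) - h (I * σ)‖ ≤ C * (τ - σ) := by
  have := Convex.norm_image_sub_le_of_norm_hasDerivWithin_le (f := fun x : ℝ => h (I * x))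
    (f' := fun x : ℝ => deriv h (I * x) * I) (s := Icc σ τ) (C := C)
    (fun x hx => (hasDerivAt_imaginary_axis hd (hσ.trans_le hx.1)).hasDerivWithinAt)
    (fun x hx => (norm_deriv_imaginary_axis_le hd h0 (hσ.trans_le hx.1)).trans (hC x hx))
    (convex_Icc σ τ) (left_mem_Icc.2 hστ) (right_mem_Icc.2 hστ)
  rwa [Real.norm_of_nonneg (sub_nonneg.2 hστ)] at this

/-- If `Im h(iτ)` is `o(τ)` and `Re h(i) = 0`, then `h(iτ)` is `o(τ)`; the bound depends only on
the bound of `Im h` for large `τ`. -/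
theorem exists_norm_imaginary_axis_le {γ : ℝ → ℝ} (hγ : γ =o[atTop] fun τ : ℝ => τ) (τ₀ : ℝ)
    {ε : ℝ} (hε : 0 < ε) :
    ∃ T : ℝ, ∀ τ, T ≤ τ → ∀ h : ℂ → ℂ, DifferentiableOn ℂ h {z | 0 < z.im} →
      (∀ z : ℂ, 0 < z.im → 0 ≤ (h z).im) → (h I).re = 0 → ∀ B : ℝ, 0 ≤ B →
      (∀ σ : ℝ, τ₀ ≤ σ → (h (I * σ)).im ≤ γ σ * B) → ‖h (I * τ)‖ ≤ ε * τ * B := by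
  set δ := ε / 8 with hδ
  have hδ0 : 0 < δ := by positivity
  obtain ⟨τ', hτ'⟩ := eventually_atTop.1 (hγ.bound hδ0)
  set τ₁ := max (max τ₀ 1) τ' with hτ₁
  have h1 : 1 ≤ τ₁ := (le_max_right _ _).trans (le_max_left _ _)
  have h2 : τ₀ ≤ τ₁ := (le_max_left _ _).trans (le_max_left _ _)
  have h3 : ∀ σ, τ₁ ≤ σ → γ σ ≤ δ * σ := by
    intro σ hσ
    have := hτ' σ ((le_max_right _ _).trans hσ)
    rw [Real.norm_eq_abs, Real.norm_of_nonneg (by linarith)] at this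
    exact (le_abs_self _).trans this
  refine ⟨τ₁ ^ 4, fun τ hτ h hd h0 hI B hB hB' => ?_⟩
  have hτ4 : τ₁ ≤ τ := (le_self_pow₀ h1 (by norm_num)).trans hτ
  have h4 : ∀ σ, τ₁ ≤ σ → (h (I * σ)).im ≤ δ * σ * B := fun σ hσ =>
    (hB' σ (h2.trans hσ)).trans (mul_le_mul_of_nonneg_right (h3 σ hσ) hB)
  have h5 : ‖h (I * τ₁) - h (I * (1 : ℝ))‖ ≤ (2 * (τ₁ ^ 2 * (δ * τ₁ * B))) * (τ₁ - 1) := by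
    refine norm_sub_imaginary_axis_le hd h0 one_pos h1 fun x hx => ?_
    have hx0 : 0 < x := one_pos.trans_le hx.1
    have him := h0 (I * x) (by simpa using hx0)
    have hm := monotoneOn_sq_mul_im hd h0 (a := x) (b := τ₁) hx0 (hx0.trans_le hx.2) hx.2
    simp only at hm
    have h6 := mul_le_mul_of_nonneg_left (h4 τ₁ le_rfl) (sq_nonneg τ₁)
    rw [div_le_iff₀ hx0]
    have h7 : 1 ≤ x ^ 2 := one_le_pow₀ hx.1
    have h8 : (h (I * x)).im ≤ x ^ 2 * (h (I * x)).im := le_mul_of_one_le_left him h7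
    have h9 : 0 ≤ τ₁ ^ 2 * (δ * τ₁ * B) := by positivity
    nlinarith [mul_nonneg h9 (sub_nonneg.2 hx.1)]
  have h6 : ‖h (I * τ) - h (I * τ₁)‖ ≤ 2 * δ * B * (τ - τ₁) := by
    refine norm_sub_imaginary_axis_le hd h0 (one_pos.trans_le h1) hτ4 fun x hx => ?_
    rw [div_le_iff₀ (by linarith [hx.1])]
    linarith [h4 x hx.1]
  have h7 : |(h (I * τ)).re| ≤ ‖h (I * τ) - h (I * τ₁)‖ + ‖h (I * τ₁) - h (I * (1 : ℝ))‖ := by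
    have e : (h (I * τ)).re = ((h (I * τ) - h (I * τ₁)) + (h (I * τ₁) - h (I * (1 : ℝ)))).re := by
      simp [hI]
    rw [e]
    exact (abs_re_le_norm _).trans (norm_add_le _ _)
  have h8 : |(h (I * τ)).im| ≤ δ * τ * B := by
    rw [abs_of_nonneg (h0 _ (by simpa using (by linarith : 0 < τ)))]
    exact h4 τ hτ4
  have h9 := norm_le_abs_re_add_abs_im (h (I * τ))
  have hδB : 0 ≤ δ * B := by positivity
  have h10 : (2 * (τ₁ ^ 2 * (δ * τ₁ * B))) * (τ₁ - 1) ≤ 2 * (δ * B) * τ := by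
    have : τ₁ ^ 3 * (τ₁ - 1) ≤ τ := by
      have : 0 ≤ τ₁ ^ 3 := by positivity
      nlinarith
    calc _ = 2 * (δ * B) * (τ₁ ^ 3 * (τ₁ - 1)) := by ring
      _ ≤ _ := by gcongr
  have h11 : ε = 8 * δ := by rw [hδ]; ring
  have h12 : 0 ≤ δ * B * τ := mul_nonneg hδB (by linarith)
  have h13 : 0 ≤ δ * B * τ₁ := mul_nonneg hδB (by linarith)
  rw [h11]
  nlinarith

end Nevanlinna

/-! ### Forms of differential expressions -/

section Forms

variable {ℋ : Type*} [NormedAddCommGroup ℋ] [InnerProductSpace ℂ ℋ] [CompleteSpace ℋ]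

theorem opMatrix_apply (k l : ℕ) (A : ℕ → ℕ → (ℋ →L[ℂ] ℋ)) (v : HPow ℋ l) (i : Fin k) :
    opMatrix k l A v i = ∑ j : Fin l, A i j (v j) := by
  simp [opMatrix]

theorem sum_fin_ite_eq {E : Type*} [AddCommMonoid E] (k i : ℕ) (a : ℕ → E) :
    ∑ j : Fin k, (if (j : ℕ) = i then a j else 0) = if i < k then a i else 0 := by
  rw [Fin.sum_univ_eq_sum_range (fun j => if j = i then a j else 0) k, Finset.sum_ite_eq']
  simp

theorem sum_fin_ite_succ_eq {E : Type*} [AddCommMonoid E] (k i : ℕ) (a : ℕ → E) :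
    ∑ j : Fin k, (if (j : ℕ) + 1 = i then a j else 0) = if 0 < i ∧ i ≤ k then a (i - 1) else 0 := by
  cases i with
  | zero => simp
  | succ i => simpa [Nat.succ_le_iff] using sum_fin_ite_eq k i a

namespace DiffExpr

theorem OrderLE.mono {L : DiffExpr ℋ} {J : BaseInterval} {r R : ℕ} (h : L.OrderLE J r)
    (hR : r ≤ R) : L.OrderLE J R := fun t ht =>
  ⟨fun j hj => (h t ht).1 j (by omega), fun j hj => (h t ht).2 j (by omega)⟩

/-- The `j`-th row `p_j u_j + (i/2) [s_{j+1} u_{j+1} - q_j u_{j-1}]` of the form of an expression,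
for a sequence `u` in place of the derivatives of a function. -/
def term (L : DiffExpr ℋ) (t : ℝ) (u : ℕ → ℋ) (j : ℕ) : ℋ :=
  L.p j t (u j) + (Complex.I / 2) •
    (L.s (j + 1) t (u (j + 1)) - if j = 0 then 0 else L.q j t (u (j - 1)))

theorem quasiTerm_eq_term (J : BaseInterval) (L : DiffExpr ℋ) (y : ℝ → ℋ) (j : ℕ) (t : ℝ) :
    L.quasiTerm J y j t = L.term t (jet J y t) j := rfl

theorem form_eq_sum_term {L : DiffExpr ℋ} {J : BaseInterval} {r N : ℕ} (h : L.OrderLE J r)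
    (hN : (r + 1) / 2 ≤ N) {t : ℝ} (ht : t ∈ J.cl) (u v : ℕ → ℋ) :
    L.form r t u v = ∑ j ∈ Finset.range (N + 1), inner ℂ (v j) (L.term t u j) := by
  have e1 : ∑ j ∈ Finset.range (r / 2 + 1), inner ℂ (v j) (L.p j t (u j)) =
      ∑ j ∈ Finset.range (N + 1), inner ℂ (v j) (L.p j t (u j)) := by
    refine Finset.sum_subset (Finset.range_mono (by omega)) fun j _ hj => ?_
    rw [Finset.mem_range, not_lt] at hj
    rw [(h t ht).1 j (by omega)]
    simp
  have e2 : ∑ j ∈ Finset.range ((r + 1) / 2), inner ℂ (v j) (L.s (j + 1) t (u (j + 1))) =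
      ∑ j ∈ Finset.range (N + 1), inner ℂ (v j) (L.s (j + 1) t (u (j + 1))) := by
    refine Finset.sum_subset (Finset.range_mono (by omega)) fun j _ hj => ?_
    rw [Finset.mem_range, not_lt] at hj
    rw [((h t ht).2 j (by omega)).2]
    simp
  have e3 : ∑ j ∈ Finset.range ((r + 1) / 2), inner ℂ (v (j + 1)) (L.q (j + 1) t (u j)) =
      ∑ j ∈ Finset.range (N + 1), inner ℂ (v j) (if j = 0 then 0 else L.q j t (u (j - 1))) := by
    rw [Finset.sum_range_succ']
    simp only [Nat.add_eq_zero_iff, one_ne_zero, and_false, if_false, Nat.add_sub_cancel, if_true,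
      inner_zero_right, add_zero]
    refine Finset.sum_subset (Finset.range_mono (by omega)) fun j _ hj => ?_
    rw [Finset.mem_range, not_lt] at hj
    rw [((h t ht).2 j (by omega)).1]
    simp
  simp only [form, term, Finset.sum_sub_distrib, inner_add_right, inner_smul_right,
    inner_sub_right, Finset.sum_add_distrib, ← Finset.mul_sum, e1, e2, e3]

theorem form_eq_of_orderLE {L : DiffExpr ℋ} {J : BaseInterval} {r R : ℕ} (h : L.OrderLE J r)
    (hR : r ≤ R) {t : ℝ} (ht : t ∈ J.cl) (u v : ℕ → ℋ) : L.form R t u v = L.form r t u v := by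
  rw [form_eq_sum_term h (N := (R + 1) / 2) (by omega) ht,
    form_eq_sum_term (h.mono hR) (N := (R + 1) / 2) le_rfl ht]

theorem form_comb (R : ℕ) (x y : ℂ) (L L' : DiffExpr ℋ) (t : ℝ) (u v : ℕ → ℋ) :
    (comb x L y L').form R t u v = x * L.form R t u v + y * L'.form R t u v := by
  simp only [form, comb, add_apply, smul_apply, inner_add_right, inner_smul_right,
    Finset.sum_add_distrib, Finset.sum_sub_distrib, ← Finset.mul_sum]
  ring

theorem form_adj (R : ℕ) (L : DiffExpr ℋ) (t : ℝ) (u v : ℕ → ℋ) :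
    L.adj.form R t u v = conj (L.form R t v u) := by
  simp only [form, adj, ContinuousLinearMap.adjoint_inner_right, map_add, map_mul, map_sum,
    map_sub, inner_conj_symm, map_div₀, Complex.conj_I, Complex.conj_ofNat]
  congr 1
  rw [neg_div, neg_mul, ← mul_neg, ← Finset.sum_neg_distrib]
  simp only [neg_sub]

theorem form_re_self (R : ℕ) (L : DiffExpr ℋ) (t : ℝ) (u : ℕ → ℋ) :
    L.re.form R t u u = ((L.form R t u u).re : ℂ) := by
  rw [re, form_comb, form_adj, ← mul_add, Complex.add_conj]
  push_cast
  ring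

theorem form_add_left (R : ℕ) (L : DiffExpr ℋ) (t : ℝ) (u u' v : ℕ → ℋ) :
    L.form R t (u + u') v = L.form R t u v + L.form R t u' v := by
  simp only [form, Pi.add_apply, map_add, inner_add_right, Finset.sum_add_distrib,
    Finset.sum_sub_distrib]
  ring

theorem form_add_right (R : ℕ) (L : DiffExpr ℋ) (t : ℝ) (u v v' : ℕ → ℋ) :
    L.form R t u (v + v') = L.form R t u v + L.form R t u v' := by
  simp only [form, Pi.add_apply, inner_add_left, Finset.sum_add_distrib,
    Finset.sum_sub_distrib]
  ring

theorem form_smul_left (R : ℕ) (L : DiffExpr ℋ) (t : ℝ) (c : ℂ) (u v : ℕ → ℋ) :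
    L.form R t (c • u) v = c * L.form R t u v := by
  simp only [form, Pi.smul_apply, map_smul, inner_smul_right, ← Finset.mul_sum, ← mul_sub]
  ring

theorem form_smul_right (R : ℕ) (L : DiffExpr ℋ) (t : ℝ) (c : ℂ) (u v : ℕ → ℋ) :
    L.form R t u (c • v) = conj c * L.form R t u v := by
  simp only [form, Pi.smul_apply, inner_smul_left, ← Finset.mul_sum, ← mul_sub]
  ring

theorem form_polarization (R : ℕ) (L : DiffExpr ℋ) (t : ℝ) (u v : ℕ → ℋ) :
    4 * L.form R t u v = L.form R t (u + v) (u + v) - L.form R t (u + (-1 : ℂ) • v) (u + (-1 : ℂ) • v)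
      + Complex.I * L.form R t (u + Complex.I • v) (u + Complex.I • v)
      - Complex.I * L.form R t (u + (-Complex.I) • v) (u + (-Complex.I) • v) := by
  simp only [form_add_left, form_add_right, form_smul_left, form_smul_right, map_neg, map_one,
    Complex.conj_I]
  linear_combination (2 * L.form R t u v - 2 * L.form R t v u) * Complex.I_sq

/-- The row of the operator matrix of the form. -/
theorem formMatrix_apply (n : ℕ) (L : DiffExpr ℋ) (t : ℝ) (u : ℕ → ℋ) (i : Fin (n + 1)) :
    L.formMatrix n t (WithLp.toLp 2 fun j : Fin (n + 1) => u j) i =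
      L.p i t (u i) + (Complex.I / 2) • ((if (i : ℕ) < n then L.s (i + 1) t (u (i + 1)) else 0)
        - if (i : ℕ) = 0 then 0 else L.q i t (u (i - 1))) := by
  obtain ⟨i, hi⟩ := i
  have e : ∀ j : ℕ, (if i = j then L.p i t
    else if i = j + 1 then -(Complex.I / 2) • L.q i t
    else if j = i + 1 then (Complex.I / 2) • L.s j t
    else 0 : ℋ →L[ℂ] ℋ) (u j) = (if j = i then L.p j t (u j) else 0)
      + (if j + 1 = i then -(Complex.I / 2) • L.q (j + 1) t (u j) else 0)
      + (if j = i + 1 then (Complex.I / 2) • L.s j t (u j) else 0) := by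
    intro j
    split_ifs <;> first | omega | skip
    all_goals subst_vars
    all_goals simp
  rw [formMatrix, opMatrix_apply]
  simp only [e, Finset.sum_add_distrib]
  rw [sum_fin_ite_eq _ _ fun j => L.p j t (u j),
    sum_fin_ite_succ_eq _ _ fun j => -(Complex.I / 2) • L.q (j + 1) t (u j),
    sum_fin_ite_eq _ _ fun j => (Complex.I / 2) • L.s j t (u j)]
  rcases Nat.eq_zero_or_pos i with rfl | h0
  · by_cases hn : 0 < n <;> simp [hn]
  · have h1 : i - 1 + 1 = i := by omega
    have h2 : i ≤ n + 1 := by omega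
    by_cases hn : i < n
    · simp only [hi, if_true, h0, h2, and_self, h1, hn, Nat.succ_lt_succ_iff, h0.ne', if_false]
      module
    · simp only [hi, if_true, h0, h2, and_self, h1, hn, Nat.succ_lt_succ_iff, h0.ne', if_false]
      module

theorem inner_formMatrix (n : ℕ) (L : DiffExpr ℋ) (t : ℝ) (u : ℕ → ℋ) :
    inner ℂ (WithLp.toLp 2 fun j : Fin (n + 1) => u j : HPow ℋ (n + 1))
      (L.formMatrix n t (WithLp.toLp 2 fun j : Fin (n + 1) => u j)) = L.form (2 * n) t u u := by
  rw [PiLp.inner_apply]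
  simp only [formMatrix_apply]
  rw [Fin.sum_univ_eq_sum_range (fun i => inner ℂ (u i) (L.p i t (u i) + (Complex.I / 2) •
    ((if i < n then L.s (i + 1) t (u (i + 1)) else 0) - if i = 0 then 0 else L.q i t (u (i - 1)))))
    (n + 1)]
  simp only [inner_add_right, inner_smul_right, inner_sub_right, Finset.sum_add_distrib,
    ← Finset.mul_sum, Finset.sum_sub_distrib, form]
  have h1 : 2 * n / 2 = n := by omega
  have h2 : (2 * n + 1) / 2 = n := by omega
  rw [h1, h2, Finset.sum_range_succ (fun i => inner ℂ (u i)
    (if i < n then L.s (i + 1) t (u (i + 1)) else 0)), Finset.sum_range_succ' (fun i => inner ℂ (u i)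
    (if i = 0 then 0 else L.q i t (u (i - 1))))]
  simp only [lt_irrefl, if_false, if_true, inner_zero_right, add_zero, Nat.add_eq_zero_iff,
    one_ne_zero, and_false, Nat.add_sub_cancel]
  congr 3
  refine Finset.sum_congr rfl fun j hj => ?_
  rw [if_pos (Finset.mem_range.1 hj)]

theorem form_odd_eq (n : ℕ) (L : DiffExpr ℋ) (t : ℝ) (u v : ℕ → ℋ) :
    L.form (2 * n + 1) t u v = L.form (2 * n) t u v + Complex.I / 2 *
      (inner ℂ (v n) (L.s (n + 1) t (u (n + 1))) - inner ℂ (v (n + 1)) (L.q (n + 1) t (u n))) := by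
  have h1 : 2 * n / 2 = n := by omega
  have h2 : (2 * n + 1) / 2 = n := by omega
  have h3 : (2 * n + 1 + 1) / 2 = n + 1 := by omega
  simp only [form, h1, h2, h3]
  rw [Finset.sum_range_succ (fun j => inner ℂ (v j) (L.s (j + 1) t (u (j + 1))) - _)]
  ring

theorem form_odd_im (n : ℕ) {L : DiffExpr ℋ} {t : ℝ}
    (h : L.s (n + 1) t = ContinuousLinearMap.adjoint (L.q (n + 1) t)) (u : ℕ → ℋ) :
    (L.form (2 * n + 1) t u u).im = (L.form (2 * n) t u u).im := by
  rw [form_odd_eq, h, ContinuousLinearMap.adjoint_inner_right, ← inner_conj_symm (u (n + 1)),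
    Complex.sub_conj, Complex.add_im]
  have : Complex.I / 2 * (((2 * (inner ℂ (L.q (n + 1) t (u n)) (u (n + 1))).im : ℝ) : ℂ) * Complex.I)
      = ((-(inner ℂ (L.q (n + 1) t (u n)) (u (n + 1))).im : ℝ) : ℂ) := by
    push_cast
    linear_combination ((inner ℂ (L.q (n + 1) t (u n)) (u (n + 1))).im : ℂ) * Complex.I_sq
  rw [this, Complex.ofReal_im, add_zero]

theorem form_congr_le (R : ℕ) (L : DiffExpr ℋ) (t : ℝ) {u u' v v' : ℕ → ℋ}
    (hu : ∀ j ≤ (R + 1) / 2, u j = u' j) (hv : ∀ j ≤ (R + 1) / 2, v j = v' j) :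
    L.form R t u v = L.form R t u' v' := by
  unfold form
  congr 1
  · refine Finset.sum_congr rfl fun j hj => ?_
    have := Finset.mem_range.1 hj
    rw [hu j (by omega), hv j (by omega)]
  · congr 1
    refine Finset.sum_congr rfl fun j hj => ?_
    have := Finset.mem_range.1 hj
    rw [hu j (by omega), hv j (by omega), hu (j + 1) (by omega), hv (j + 1) (by omega)]

/-- The form of order `2n` does not contain the derivatives of order `n + 1`. -/
theorem form_even_single_right (n : ℕ) (L : DiffExpr ℋ) (t : ℝ) (u : ℕ → ℋ) (b : ℋ) :
    L.form (2 * n) t u (Pi.single (n + 1) b) = 0 := by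
  rw [form_congr_le (2 * n) L t (u' := u) (v' := 0) (fun _ _ => rfl) fun j hj => ?_]
  · simp [form]
  · rw [Pi.single_eq_of_ne (by omega)]; rfl

theorem form_even_single_left (n : ℕ) (L : DiffExpr ℋ) (t : ℝ) (v : ℕ → ℋ) (b : ℋ) :
    L.form (2 * n) t (Pi.single (n + 1) b) v = 0 := by
  rw [form_congr_le (2 * n) L t (u' := 0) (v' := v) (fun j hj => ?_) fun _ _ => rfl]
  · simp [form]
  · rw [Pi.single_eq_of_ne (by omega)]; rfl

end DiffExpr

end Forms

/-! ### Bounds for the form of `n_λ` -/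

section Families

variable {ℋ : Type*} [NormedAddCommGroup ℋ] [InnerProductSpace ℂ ℋ] [CompleteSpace ℋ]
variable {J : BaseInterval} {r s : ℕ} {ℬ : Set ℂ} {L : ℂ → DiffExpr ℋ} {m : WeightExpr ℋ J s}

open DiffExpr

theorem eq_zero_of_forall_add_mul_nonpos {A B : ℝ} (h : ∀ κ : ℝ, A + κ * B ≤ 0) : B = 0 := by
  by_contra hB
  have := h ((1 - A) / B)
  rw [div_mul_cancel₀ _ hB] at this
  linarith

/-- For odd order the dissipativity makes the leading coefficients adjoint to each other: the form
contains the derivative of order `n + 1` only linearly. -/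
theorem NevanlinnaFamily.lead_adjoint (hL : NevanlinnaFamily J r ℬ L) {n : ℕ} (hr : r = 2 * n + 1)
    {z : ℂ} (hz : z.im ≠ 0) {t : ℝ} (ht : t ∈ J.cl) :
    (L z).s (n + 1) t = ContinuousLinearMap.adjoint ((L z).q (n + 1) t) := by
  have key : ∀ a b : ℋ, (inner ℂ a ((L z).s (n + 1) t b)).re
      - (inner ℂ b ((L z).q (n + 1) t a)).re = 0 := by
    intro a b
    set u : ℕ → ℋ := Pi.single n a with hu
    set w : ℕ → ℋ := Pi.single (n + 1) b with hw
    have e : ∀ κ : ℝ, ((L z).form r t (u + (κ : ℂ) • w) (u + (κ : ℂ) • w)).im / z.im =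
        ((L z).form r t u u).im / z.im + κ * (((1 / 2) * ((inner ℂ a ((L z).s (n + 1) t b)).re
          - (inner ℂ b ((L z).q (n + 1) t a)).re)) / z.im) := by
      intro κ
      have h1 : (L z).form r t w u = Complex.I / 2 * inner ℂ a ((L z).s (n + 1) t b) := by
        rw [hr, form_odd_eq, form_even_single_left, hw, Pi.single_eq_same,
          Pi.single_eq_of_ne (by omega), hu, Pi.single_eq_same]
        simp
      have h2 : (L z).form r t u w = -(Complex.I / 2 * inner ℂ b ((L z).q (n + 1) t a)) := by
        rw [hr, form_odd_eq, form_even_single_right, hw, Pi.single_eq_same,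
          Pi.single_eq_of_ne (by omega), hu, Pi.single_eq_same]
        simp
      have h3 : (L z).form r t w w = 0 := by
        rw [hr, form_odd_eq, form_even_single_right, hw, Pi.single_eq_of_ne (by omega)]
        simp
      rw [form_add_left, form_add_right, form_add_right, form_smul_left, form_smul_left,
        form_smul_right, form_smul_right, h1, h2, h3, Complex.conj_ofReal]
      simp only [mul_zero, add_zero, Complex.add_im, Complex.neg_im,
        Complex.mul_im, Complex.div_re, Complex.div_im, Complex.I_re, Complex.I_im]
      simp
      ring
    have h4 := eq_zero_of_forall_add_mul_nonpos fun κ =>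
      (e κ).symm.trans_le (hL.dissipative z hz t ht (u + (κ : ℂ) • w))
    rw [div_eq_zero_iff, or_iff_left hz] at h4
    linarith
  refine ContinuousLinearMap.ext fun b => ext_inner_left ℂ fun a => ?_
  rw [ContinuousLinearMap.adjoint_inner_right, ← inner_conj_symm ((L z).q (n + 1) t a)]
  apply Complex.ext
  · rw [Complex.conj_re]
    linarith [key a b]
  · have := key a (Complex.I • b)
    rw [map_smul, inner_smul_right, inner_smul_left] at this
    simp at this
    rw [Complex.conj_im]
    linarith

theorem NevanlinnaFamily.q_conj (hL : NevanlinnaFamily J r ℬ L) {n : ℕ} (hr : r = 2 * n + 1)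
    {z : ℂ} (hz : z.im ≠ 0) {t : ℝ} (ht : t ∈ J.cl) :
    (L (conj z)).q (n + 1) t = (L z).q (n + 1) t := by
  have hz' : (conj z).im ≠ 0 := by simpa using hz
  rw [hL.q_symm _ (hL.nonreal _ hz') n t ht, Complex.conj_conj, hL.lead_adjoint hr hz ht,
    ContinuousLinearMap.adjoint_adjoint]

theorem NevanlinnaFamily.differentiableAt_form (hL : NevanlinnaFamily J r ℬ L) {z : ℂ}
    (hz : z.im ≠ 0) {t : ℝ} (ht : t ∈ J.cl) (u v : ℕ → ℋ) :
    DifferentiableAt ℂ (fun z => (L z).form r t u v) z := by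
  obtain ⟨U, hU, h⟩ := hL.analytic z (hL.nonreal z hz)
  have hz' := mem_of_mem_nhds hU
  have key : ∀ {A : ℂ → (ℋ →L[ℂ] ℋ)} (a b : ℋ), AnalyticOnNhd ℂ A U →
      DifferentiableAt ℂ (fun z => inner ℂ a (A z b)) z := fun a b hA =>
    ((innerSL ℂ a).differentiableAt).comp z
      ((hA z hz').differentiableAt.clm_apply (differentiableAt_const b))
  refine (DifferentiableAt.fun_sum fun j hj => ?_).add
    ((DifferentiableAt.fun_sum fun j hj => ?_).const_mul _)
  · rw [Finset.mem_range] at hj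
    exact key _ _ ((h t ht).1 j (by omega))
  · rw [Finset.mem_range] at hj
    have := (h t ht).2 j (by omega)
    exact (key _ _ this.2).sub (key _ _ this.1)

theorem WeightExpr.form_self (m : WeightExpr ℋ J s) {t : ℝ} (ht : t ∈ J.cl) (u : ℕ → ℋ) :
    m.form s t u u = ((m.form s t u u).re : ℂ) :=
  (Complex.conj_eq_iff_re.1 (m.form_conj ht u u)).symm

theorem form_nPart_self (hsr : s ≤ r) (z : ℂ) {t : ℝ} (ht : t ∈ J.cl) (u : ℕ → ℋ) :
    (nPart L m.toDiffExpr z).form r t u u = (((L Complex.I).form r t u u).re : ℂ)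
      - z * ((m.form s t u u).re : ℂ) - (L z).form r t u u := by
  rw [nPart, linPart, lPart, form_comb, form_comb, form_re_self, form_eq_of_orderLE m.order hsr ht,
    ← m.form_self ht]
  ring

theorem im_form_nPart (hsr : s ≤ r) (z : ℂ) {t : ℝ} (ht : t ∈ J.cl) (u : ℕ → ℋ) :
    ((nPart L m.toDiffExpr z).form r t u u).im = -(z.im * (m.form s t u u).re)
      - ((L z).form r t u u).im := by
  rw [form_nPart_self hsr z ht, Complex.sub_im, Complex.sub_im, Complex.im_mul_ofReal,
    Complex.ofReal_im, zero_sub]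

theorem lead_adjoint_nPart (hL : NevanlinnaFamily J r ℬ L) (hsr : s ≤ r) {n : ℕ}
    (hr : r = 2 * n + 1) {z : ℂ} (hz : z.im ≠ 0) {t : ℝ} (ht : t ∈ J.cl) :
    (nPart L m.toDiffExpr z).s (n + 1) t =
      ContinuousLinearMap.adjoint ((nPart L m.toDiffExpr z).q (n + 1) t) := by
  obtain ⟨k, hk⟩ := m.even
  have hm := (m.order t ht).2 n (by omega)
  have h1 := hL.lead_adjoint hr hz ht
  have h2 := hL.lead_adjoint hr (z := Complex.I) (by simp) ht
  simp [nPart, linPart, lPart, re, comb, adj, hm.1, hm.2, h1, h2, map_smulₛₗ, Complex.conj_ofNat]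

/-- The imaginary part of the matrix of the form as an inequality for forms. -/
theorem im_form_le_of_isPositive {N M : DiffExpr ℋ} {n : ℕ} {c t : ℝ}
    (h : ((c : ℂ) • M.formMatrix n t - imPart (N.formMatrix n t)).IsPositive) (u : ℕ → ℋ) :
    (N.form (2 * n) t u u).im ≤ c * (M.form (2 * n) t u u).re := by
  have h1 := h.re_inner_nonneg_right (WithLp.toLp 2 fun j : Fin (n + 1) => u j)
  rw [sub_apply, inner_sub_right, smul_apply, inner_smul_right,
    inner_formMatrix, imPart, smul_apply, inner_smul_right,
    sub_apply, inner_sub_right, ContinuousLinearMap.adjoint_inner_right,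
    ← inner_conj_symm (N.formMatrix n t _), inner_formMatrix, Complex.sub_conj] at h1
  have e : (1 / (2 * Complex.I)) * (((2 * (N.form (2 * n) t u u).im : ℝ) : ℂ) * Complex.I) =
      ((N.form (2 * n) t u u).im : ℂ) := by
    field_simp
    push_cast
    ring
  rw [e] at h1
  simpa using h1

/-- The form of `n_{iτ}` is small against `τ` times the form of the weight. On the diagonal it is a
Nevanlinna function of the spectral parameter whose real part vanishes at `i`. -/
theorem exists_norm_nPart_form_le (hsr : s ≤ r) (hL : NevanlinnaFamily J r ℬ L)
    (hLm : Dominates J r s L m.toDiffExpr) (c : ℝ → ℝ → ℝ)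
    (hn : ∀ᶠ τ : ℝ in atTop, ∀ t ∈ J.cl,
      ((c t τ : ℂ) • m.formMatrix (r / 2) t
        - imPart ((nPart L m.toDiffExpr (Complex.I * τ)).formMatrix (r / 2) t)).IsPositive)
    (hc_bdd : ∀ᶠ τ : ℝ in atTop, BddAbove ((fun t => c t τ) '' J.cl))
    (hc : (fun τ : ℝ => sSup ((fun t => c t τ) '' J.cl)) =o[atTop] (fun τ : ℝ => τ))
    {ε : ℝ} (hε : 0 < ε) :
    ∀ᶠ τ : ℝ in atTop, ∀ t ∈ J.cl, ∀ u v : ℕ → ℋ,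
      ‖(nPart L m.toDiffExpr (Complex.I * τ)).form r t u v‖ ≤
        ε * τ * ((m.form s t u u).re + (m.form s t v v).re) := by
  obtain ⟨τ₀, hτ₀⟩ := eventually_atTop.1 ((hn.and hc_bdd).and (eventually_gt_atTop (0 : ℝ)))
  obtain ⟨T, hT⟩ := exists_norm_imaginary_axis_le hc τ₀ hε
  obtain ⟨k, hk⟩ := m.even
  filter_upwards [eventually_ge_atTop T] with τ hτ t ht
  have diag : ∀ u : ℕ → ℋ, ‖(nPart L m.toDiffExpr (Complex.I * τ)).form r t u u‖ ≤
      ε * τ * (m.form s t u u).re := by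
    intro u
    refine hT τ hτ (fun z => (nPart L m.toDiffExpr z).form r t u u) ?_ ?_ ?_ _ (m.nonneg t ht u) ?_
    · intro z hz
      refine DifferentiableAt.differentiableWithinAt ?_
      simp only [form_nPart_self hsr _ ht]
      exact ((differentiableAt_const _).sub (differentiableAt_id.mul_const _)).sub
        (hL.differentiableAt_form (ne_of_gt hz) ht u u)
    · intro z hz
      rw [im_form_nPart hsr z ht]
      have h1 := hLm z hz.ne' t ht u
      rw [← neg_div, le_div_iff₀ hz] at h1
      linarith
    · simp only [form_nPart_self hsr _ ht]
      simp
    · intro σ hσ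
      obtain ⟨⟨h1, h2⟩, h3⟩ := hτ₀ σ hσ
      have h4 : ((nPart L m.toDiffExpr (Complex.I * σ)).form r t u u).im =
          ((nPart L m.toDiffExpr (Complex.I * σ)).form (2 * (r / 2)) t u u).im := by
        rcases Nat.even_or_odd' r with ⟨n, hr | hr⟩
        · rw [show 2 * (r / 2) = r by omega]
        · have hz : (Complex.I * σ : ℂ).im ≠ 0 := by simpa using h3.ne'
          have := form_odd_im n (lead_adjoint_nPart (m := m) hL hsr hr hz ht) u
          rw [show 2 * (r / 2) = 2 * n by omega]
          rwa [← hr] at this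
      rw [h4]
      refine (im_form_le_of_isPositive (h1 t ht) u).trans ?_
      rw [form_eq_of_orderLE m.order (by omega) ht]
      exact mul_le_mul_of_nonneg_right (le_csSup h2 ⟨t, ht, rfl⟩) (m.nonneg t ht u)
  intro u v
  set N := nPart L m.toDiffExpr (Complex.I * τ)
  have hpol := form_polarization r N t u v
  have hsum : (m.form s t (u + v) (u + v)).re + (m.form s t (u + (-1 : ℂ) • v) (u + (-1 : ℂ) • v)).re
      + (m.form s t (u + Complex.I • v) (u + Complex.I • v)).re
      + (m.form s t (u + (-Complex.I) • v) (u + (-Complex.I) • v)).re =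
      4 * ((m.form s t u u).re + (m.form s t v v).re) := by
    simp only [DiffExpr.form_add_left, DiffExpr.form_add_right, DiffExpr.form_smul_left,
      DiffExpr.form_smul_right, map_neg, map_one, Complex.conj_I]
    simp
    ring
  have h4 : ‖4 * N.form r t u v‖ = 4 * ‖N.form r t u v‖ := by rw [norm_mul]; simp
  have h5 : ∀ a b c d : ℂ, ‖a - b + Complex.I * c - Complex.I * d‖ ≤ ‖a‖ + ‖b‖ + ‖c‖ + ‖d‖ := by
    intro a b c d
    have h1 := norm_sub_le (a - b + Complex.I * c) (Complex.I * d)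
    have h2 := norm_add_le (a - b) (Complex.I * c)
    have h3 := norm_sub_le a b
    rw [norm_mul, Complex.norm_I, one_mul] at h1 h2
    linarith
  have h6 := h5 (N.form r t (u + v) (u + v)) (N.form r t (u + (-1 : ℂ) • v) (u + (-1 : ℂ) • v))
    (N.form r t (u + Complex.I • v) (u + Complex.I • v))
    (N.form r t (u + (-Complex.I) • v) (u + (-Complex.I) • v))
  rw [← hpol, h4] at h6
  have d1 := diag (u + v)
  have d2 := diag (u + (-1 : ℂ) • v)
  have d3 := diag (u + Complex.I • v)
  have d4 := diag (u + (-Complex.I) • v)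
  have : 4 * ‖N.form r t u v‖ ≤ ε * τ * (4 * ((m.form s t u u).re + (m.form s t v v).re)) := by
    rw [← hsum]
    linarith
  linarith

/-- A bound for a sesquilinear form through the diagonal of the weight can be distributed unevenly
between the two arguments. -/
theorem norm_form_le_of_forall {N : DiffExpr ℋ} {t τ ε : ℝ} (hε : 0 < ε)
    (h : ∀ u v : ℕ → ℋ, ‖N.form r t u v‖ ≤
      ε * τ * ((m.form s t u u).re + (m.form s t v v).re)) (u v : ℕ → ℋ) :
    ‖N.form r t u v‖ ≤ τ * (2 * ε ^ 2 * (m.form s t u u).re + 1 / 2 * (m.form s t v v).re) := by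
  set κ : ℝ := √(2 * ε) with hκ
  have hκ0 : 0 < κ := Real.sqrt_pos.2 (by linarith)
  have hκ2 : κ * κ = 2 * ε := Real.mul_self_sqrt (by linarith)
  have h1 := h ((κ : ℂ) • u) (((κ⁻¹ : ℝ) : ℂ) • v)
  simp only [DiffExpr.form_smul_left, DiffExpr.form_smul_right, Complex.conj_ofReal] at h1
  have e1 : ((κ⁻¹ : ℝ) : ℂ) * ((κ : ℂ) * N.form r t u v) = N.form r t u v := by
    rw [← mul_assoc, ← Complex.ofReal_mul, inv_mul_cancel₀ hκ0.ne']
    simp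
  rw [e1, ← mul_assoc, ← mul_assoc, ← Complex.ofReal_mul, ← Complex.ofReal_mul,
    Complex.re_ofReal_mul, Complex.re_ofReal_mul, ← mul_inv, hκ2] at h1
  refine h1.trans_eq ?_
  field_simp

/-- In odd order the leading coefficients of `n_λ` vanish at a point where its form is bounded by
that of `m`: the form is affine in the derivative of order `n + 1`, on which the form of `m` does
not depend. -/
theorem lead_nPart_eq_zero {n : ℕ} (hr : r = 2 * n + 1) (hsr : s ≤ r) {N : DiffExpr ℋ} {t C : ℝ}
    (ht : t ∈ J.cl)
    (h : ∀ u v : ℕ → ℋ, ‖N.form r t u v‖ ≤ C * ((m.form s t u u).re + (m.form s t v v).re)) :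
    N.q (n + 1) t = 0 := by
  obtain ⟨k, hk⟩ := m.even
  refine ContinuousLinearMap.ext fun a => ext_inner_left ℂ fun b => ?_
  rw [zero_apply, inner_zero_right]
  set d : ℂ := inner ℂ b (N.q (n + 1) t a) with hd
  -- the left-hand side is homogeneous in `b`, the right-hand side does not depend on it
  have h1 : ∀ κ : ℝ, -(C * (m.form s t (Pi.single n a) (Pi.single n a)).re)
      + κ * (‖d‖ / 2) ≤ 0 := by
    intro κ
    have h2 := h (Pi.single n a) ((κ : ℂ) • Pi.single (n + 1) b)
    have h3 : m.form s t ((κ : ℂ) • Pi.single (n + 1) b) ((κ : ℂ) • Pi.single (n + 1) b) = 0 := by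
      rw [DiffExpr.form_smul_left, ← form_eq_of_orderLE m.order (R := 2 * n) (by omega) ht,
        form_even_single_left, mul_zero]
    have h4 : N.form r t (Pi.single n a) ((κ : ℂ) • Pi.single (n + 1) b) =
        -(κ * (Complex.I / 2 * d)) := by
      rw [DiffExpr.form_smul_right, hr, form_odd_eq, form_even_single_right, Pi.single_eq_same,
        Pi.single_eq_same, Pi.single_eq_of_ne (by omega), Complex.conj_ofReal]
      simp [hd]
    rw [h3, h4, norm_neg, norm_mul, norm_mul, norm_div, Complex.norm_I, Complex.norm_real,
      Real.norm_eq_abs] at h2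
    simp only [Complex.zero_re, add_zero, Complex.norm_ofNat] at h2
    have h5 : κ * (‖d‖ / 2) ≤ |κ| * (1 / 2 * ‖d‖) := by
      rw [one_div_mul_eq_div]
      exact mul_le_mul_of_nonneg_right (le_abs_self κ) (by positivity)
    linarith
  have h2 := eq_zero_of_forall_add_mul_nonpos h1
  exact norm_eq_zero.1 (by linarith)

end Families

/-! ### Quasi-derivatives -/

section Quasi

/-- The open interval `(a, b)`. -/
def BaseInterval.io (J : BaseInterval) : Set ℝ := {t : ℝ | J.a < (t : EReal) ∧ (t : EReal) < J.b}

theorem BaseInterval.io_subset_cl (J : BaseInterval) : J.io ⊆ J.cl := fun _ h => ⟨h.1.le, h.2.le⟩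

theorem BaseInterval.isOpen_io (J : BaseInterval) : IsOpen J.io :=
  (isOpen_lt continuous_const continuous_coe_real_ereal).inter
    (isOpen_lt continuous_coe_real_ereal continuous_const)

theorem BaseInterval.cl_mem_nhds (J : BaseInterval) {t : ℝ} (ht : t ∈ J.io) : J.cl ∈ 𝓝 t :=
  mem_of_superset (J.isOpen_io.mem_nhds ht) J.io_subset_cl

variable {ℋ : Type*} [NormedAddCommGroup ℋ] [InnerProductSpace ℂ ℋ] [CompleteSpace ℋ]
variable {J : BaseInterval}

theorem contDiffOn_clm_apply {S : Set ℝ} {n : ℕ} {A : ℝ → (ℋ →L[ℂ] ℋ)} {v : ℝ → ℋ}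
    (hA : ContDiffOn ℝ n A S) (hv : ContDiffOn ℝ n v S) :
    ContDiffOn ℝ n (fun t => A t (v t)) S :=
  ((ContinuousLinearMap.restrictScalarsL ℂ ℋ ℋ ℝ ℝ).contDiff.comp_contDiffOn hA).clm_apply hv

theorem jet_succ (f : ℝ → ℋ) (t : ℝ) (j : ℕ) :
    jet J f t (j + 1) = derivWithin (fun τ => jet J f τ j) J.cl t := by
  simp only [jet, iteratedDerivWithin_succ]

theorem jet_zero (f : ℝ → ℋ) (t : ℝ) : jet J f t 0 = f t := by
  simp [jet]

theorem jet_congr {f g : ℝ → ℋ} (h : EqOn f g J.cl) {t : ℝ} (ht : t ∈ J.cl) (j : ℕ) :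
    jet J f t j = jet J g t j :=
  iteratedDerivWithin_congr h ht

theorem jet_add_of_contDiff {f g : ℝ → ℋ} {t : ℝ} (ht : t ∈ J.cl) {j : ℕ}
    (hf : ContDiffWithinAt ℝ j f J.cl t) (hg : ContDiffWithinAt ℝ j g J.cl t) :
    jet J (f + g) t j = jet J f t j + jet J g t j :=
  iteratedDerivWithin_add ht J.uniqueDiffOn hf hg

theorem jet_sub_of_contDiff {f g : ℝ → ℋ} {t : ℝ} (ht : t ∈ J.cl) {j : ℕ}
    (hf : ContDiffWithinAt ℝ j f J.cl t) (hg : ContDiffWithinAt ℝ j g J.cl t) :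
    jet J (f - g) t j = jet J f t j - jet J g t j :=
  iteratedDerivWithin_sub ht J.uniqueDiffOn hf hg

theorem jet_smul_of_contDiff {f : ℝ → ℋ} {t : ℝ} (ht : t ∈ J.cl) {j : ℕ} (c : ℂ)
    (hf : ContDiffWithinAt ℝ j f J.cl t) : jet J (c • f) t j = c • jet J f t j :=
  iteratedDerivWithin_const_smul ht J.uniqueDiffOn c hf

theorem contDiffOn_jet {k : ℕ} {f : ℝ → ℋ} (hf : ContDiffOn ℝ k f J.cl) {i j : ℕ}
    (h : j + i ≤ k) : ContDiffOn ℝ i (fun t => jet J f t j) J.cl := by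
  induction j generalizing i with
  | zero =>
    simp only [jet_zero]
    exact hf.of_le (by exact_mod_cast (by omega : i ≤ k))
  | succ j ih =>
    have := (ih (i := i + 1) (by omega)).derivWithin J.uniqueDiffOn (m := i) (by norm_cast)
    exact this.congr fun t _ => jet_succ f t j

theorem hasDerivAt_of_differentiableAt {f : ℝ → ℋ} {t : ℝ} (ht : t ∈ J.io)
    (h : DifferentiableAt ℝ f t) : HasDerivAt f (derivWithin f J.cl t) t := by
  rw [derivWithin_of_mem_nhds (J.cl_mem_nhds ht)]
  exact h.hasDerivAt

namespace DiffExpr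

variable {L : DiffExpr ℋ} {k : ℕ} {y : ℝ → ℋ}

theorem contDiffOn_p (ho : L.OrderLE J k) (hs : L.Smooth J k) (hy : ContDiffOn ℝ k y J.cl) (j : ℕ) :
    ContDiffOn ℝ j (fun τ => L.p j τ (jet J y τ j)) J.cl := by
  by_cases h : 2 * j ≤ k
  · exact contDiffOn_clm_apply (hs.1 j h) (contDiffOn_jet hy (by omega))
  · refine (contDiffOn_const (c := (0 : ℋ))).congr fun t ht => ?_
    rw [(ho t ht).1 j (by omega), zero_apply]

theorem contDiffOn_s (ho : L.OrderLE J k) (hs : L.Smooth J k) (hy : ContDiffOn ℝ k y J.cl) (j : ℕ) :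
    ContDiffOn ℝ j (fun τ => L.s (j + 1) τ (jet J y τ (j + 1))) J.cl := by
  by_cases h : 2 * j + 1 ≤ k
  · exact contDiffOn_clm_apply ((hs.2 j h).2.of_le (by norm_cast; omega))
      (contDiffOn_jet hy (by omega))
  · refine (contDiffOn_const (c := (0 : ℋ))).congr fun t ht => ?_
    rw [((ho t ht).2 j (by omega)).2, zero_apply]

theorem contDiffOn_q (ho : L.OrderLE J k) (hs : L.Smooth J k) (hy : ContDiffOn ℝ k y J.cl) (j : ℕ) :
    ContDiffOn ℝ (j + 1 : ℕ) (fun τ => L.q (j + 1) τ (jet J y τ j)) J.cl := by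
  by_cases h : 2 * j + 1 ≤ k
  · exact contDiffOn_clm_apply (hs.2 j h).1 (contDiffOn_jet hy (by omega))
  · refine (contDiffOn_const (c := (0 : ℋ))).congr fun t ht => ?_
    rw [((ho t ht).2 j (by omega)).1, zero_apply]

theorem contDiffOn_q' (ho : L.OrderLE J k) (hs : L.Smooth J k) (hy : ContDiffOn ℝ k y J.cl) (j : ℕ) :
    ContDiffOn ℝ j (fun τ => if j = 0 then 0 else L.q j τ (jet J y τ (j - 1))) J.cl := by
  cases j with
  | zero => exact contDiffOn_const
  | succ j => simpa using contDiffOn_q ho hs hy j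

theorem contDiffOn_quasiTerm (ho : L.OrderLE J k) (hs : L.Smooth J k) (hy : ContDiffOn ℝ k y J.cl)
    (j : ℕ) : ContDiffOn ℝ j (L.quasiTerm J y j) J.cl :=
  (contDiffOn_p ho hs hy j).add
    (((contDiffOn_s ho hs hy j).sub (contDiffOn_q' ho hs hy j)).const_smul (Complex.I / 2))

theorem contDiffOn_quasiAux (ho : L.OrderLE J k) (hs : L.Smooth J k) (hy : ContDiffOn ℝ k y J.cl)
    (i j : ℕ) : ContDiffOn ℝ j (L.quasiAux J y i j) J.cl := by
  induction i generalizing j with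
  | zero => exact contDiffOn_quasiTerm ho hs hy j
  | succ i ih =>
    exact ((ih (j + 1)).derivWithin J.uniqueDiffOn (m := j) (by norm_cast)).neg.add
      (contDiffOn_quasiTerm ho hs hy j)

theorem contDiffOn_quasi (ho : L.OrderLE J k) (hs : L.Smooth J k) (hy : ContDiffOn ℝ k y J.cl)
    (j : ℕ) : ContDiffOn ℝ j (L.quasi k J y j) J.cl := contDiffOn_quasiAux ho hs hy _ j

theorem quasi_eq_quasiTerm {j : ℕ} (hj : (k + 1) / 2 ≤ j) (t : ℝ) :
    L.quasi k J y j t = L.quasiTerm J y j t := by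
  rw [quasi, Nat.sub_eq_zero_of_le hj, quasiAux]

theorem quasiTerm_eq_zero (ho : L.OrderLE J k) {j : ℕ} (hj : (k + 1) / 2 < j) {t : ℝ}
    (ht : t ∈ J.cl) : L.quasiTerm J y j t = 0 := by
  obtain ⟨i, rfl⟩ : ∃ i, j = i + 1 := ⟨j - 1, by omega⟩
  simp [quasiTerm, (ho t ht).1 (i + 1) (by omega), ((ho t ht).2 i (by omega)).1,
    ((ho t ht).2 (i + 1) (by omega)).2]

theorem quasi_eq_zero (ho : L.OrderLE J k) {j : ℕ} (hj : (k + 1) / 2 < j) {t : ℝ}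
    (ht : t ∈ J.cl) : L.quasi k J y j t = 0 := by
  rw [quasi_eq_quasiTerm hj.le, quasiTerm_eq_zero ho hj ht]

theorem quasi_rec (ho : L.OrderLE J k) (j : ℕ) {t : ℝ} (ht : t ∈ J.cl) :
    L.quasi k J y j t = -derivWithin (L.quasi k J y (j + 1)) J.cl t + L.quasiTerm J y j t := by
  by_cases hj : j < (k + 1) / 2
  · have : (k + 1) / 2 - j = (k + 1) / 2 - (j + 1) + 1 := by omega
    conv_lhs => rw [quasi, this, quasiAux]
    rfl
  · rw [quasi_eq_quasiTerm (by omega)]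
    have h0 : EqOn (L.quasi k J y (j + 1)) (fun _ => 0) J.cl := fun τ hτ =>
      quasi_eq_zero ho (by omega) hτ
    rw [derivWithin_congr h0 (h0 ht)]
    simp

theorem quasiAux_eq_sum (ho : L.OrderLE J k) (hs : L.Smooth J k) (hy : ContDiffOn ℝ k y J.cl)
    (i j : ℕ) {t : ℝ} (ht : t ∈ J.cl) :
    L.quasiAux J y i j t =
      ∑ l ∈ Finset.range (i + 1), (-1 : ℂ) ^ l • jet J (L.quasiTerm J y (j + l)) t l := by
  induction i generalizing j t with
  | zero => simp [quasiAux, jet_zero]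
  | succ i ih =>
    have hE : EqOn (L.quasiAux J y i (j + 1)) (fun τ => ∑ l ∈ Finset.range (i + 1),
        (-1 : ℂ) ^ l • jet J (L.quasiTerm J y (j + 1 + l)) τ l) J.cl := fun τ hτ => ih (j + 1) hτ
    change -derivWithin (L.quasiAux J y i (j + 1)) J.cl t + L.quasiTerm J y j t = _
    rw [derivWithin_congr hE (hE ht), derivWithin_fun_sum, Finset.sum_range_succ' _ (i + 1),
      ← Finset.sum_neg_distrib]
    · simp only [pow_zero, one_smul, add_zero, jet_zero]
      congr 1
      refine Finset.sum_congr rfl fun l _ => ?_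
      have hd : DifferentiableWithinAt ℝ (fun τ => jet J (L.quasiTerm J y (j + 1 + l)) τ l) J.cl t :=
        (contDiffOn_jet (contDiffOn_quasiTerm ho hs hy (j + 1 + l)) (i := 1) (j := l)
          (by omega)).differentiableOn (by norm_num) t ht
      rw [derivWithin_fun_const_smul _ hd, jet_succ, pow_succ, mul_neg_one, neg_smul,
        show j + (l + 1) = j + 1 + l by omega]
    · intro l _
      exact ((contDiffOn_jet (contDiffOn_quasiTerm ho hs hy (j + 1 + l)) (i := 1) (j := l)
          (by omega)).differentiableOn (by norm_num) t ht).const_smul _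

/-- The quasi-derivative of order `k` is the expression itself. -/
theorem quasi_zero_eq_apply (ho : L.OrderLE J k) (hs : L.Smooth J k) (hy : ContDiffOn ℝ k y J.cl)
    {t : ℝ} (ht : t ∈ J.cl) : L.quasi k J y 0 t = L.apply k J y t := by
  have hu := J.uniqueDiffOn
  set P : ℕ → ℝ → ℋ := fun j τ => L.p j τ (jet J y τ j) with hP
  set S : ℕ → ℝ → ℋ := fun j τ => L.s (j + 1) τ (jet J y τ (j + 1)) with hS
  set Z : ℕ → ℝ → ℋ := fun j τ => L.q (j + 1) τ (jet J y τ j) with hZ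
  have hterm : ∀ j, jet J (L.quasiTerm J y j) t j = jet J (P j) t j + (Complex.I / 2) •
      (jet J (S j) t j - if j = 0 then 0 else jet J (Z (j - 1)) t j) := by
    intro j
    set Y : ℝ → ℋ := fun τ => if j = 0 then 0 else L.q j τ (jet J y τ (j - 1)) with hY
    have e : L.quasiTerm J y j = P j + (Complex.I / 2) • (S j - Y) := rfl
    have h0 : ContDiffWithinAt ℝ j (P j) J.cl t := contDiffOn_p ho hs hy j t ht
    have h1 : ContDiffWithinAt ℝ j (S j) J.cl t := contDiffOn_s ho hs hy j t ht
    have h2 : ContDiffWithinAt ℝ j Y J.cl t := contDiffOn_q' ho hs hy j t ht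
    have h3 : ContDiffWithinAt ℝ j (S j - Y) J.cl t := h1.sub h2
    have h4 : ContDiffWithinAt ℝ j ((Complex.I / 2) • (S j - Y)) J.cl t := h3.const_smul _
    rw [e, jet_add_of_contDiff ht h0 h4, jet_smul_of_contDiff ht _ h3,
      jet_sub_of_contDiff ht h1 h2]
    congr 3
    rcases Nat.eq_zero_or_pos j with rfl | hj
    · simp [hY, jet]
    · simp only [hY, hj.ne', if_false, hZ]
      rw [show j - 1 + 1 = j by omega]
  have hP0 : ∀ j, k / 2 < j → jet J (P j) t j = 0 := by
    intro j hj
    rw [jet_congr (g := fun _ => 0) (fun τ hτ => ?_) ht]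
    · simp [jet]
    · simp [hP, (ho τ hτ).1 j (by omega)]
  have hS0 : ∀ j, (k + 1) / 2 ≤ j → jet J (S j) t j = 0 := by
    intro j hj
    rw [jet_congr (g := fun _ => 0) (fun τ hτ => ?_) ht]
    · simp [jet]
    · simp [hS, ((ho τ hτ).2 j (by omega)).2]
  rw [quasi, quasiAux_eq_sum ho hs hy _ _ ht, Nat.sub_zero]
  simp only [zero_add, hterm, smul_add, smul_sub, Finset.sum_add_distrib, Finset.sum_sub_distrib]
  have e1 : ∑ j ∈ Finset.range ((k + 1) / 2 + 1), (-1 : ℂ) ^ j • jet J (P j) t j =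
      ∑ j ∈ Finset.range (k / 2 + 1), (-1 : ℂ) ^ j • jet J (P j) t j := by
    symm
    refine Finset.sum_subset (Finset.range_mono (by omega)) fun j _ hj => ?_
    rw [Finset.mem_range, not_lt] at hj
    rw [hP0 j (by omega), smul_zero]
  rw [e1, Finset.sum_range_succ (fun j => (-1 : ℂ) ^ j • (Complex.I / 2) • jet J (S j) t j),
    hS0 _ le_rfl, Finset.sum_range_succ' (fun j => (-1 : ℂ) ^ j • (Complex.I / 2) •
      if j = 0 then (0 : ℋ) else jet J (Z (j - 1)) t j)]
  simp only [smul_zero, add_zero, if_true, Nat.add_eq_zero_iff, one_ne_zero, and_false, if_false,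
    Nat.add_sub_cancel]
  rw [apply, ← Finset.sum_sub_distrib]
  congr 1
  · refine Finset.sum_congr rfl fun j _ => ?_
    rw [pow_mul, Complex.I_sq]
  · refine Finset.sum_congr rfl fun j _ => ?_
    have h1 : ContDiffWithinAt ℝ j (derivWithin (Z j) J.cl) J.cl t :=
      (contDiffOn_q ho hs hy j).derivWithin hu (m := j) (by norm_cast) t ht
    have h3 : jet J (fun τ => derivWithin (Z j) J.cl τ + S j τ) t j =
        jet J (Z j) t (j + 1) + jet J (S j) t j := by
      unfold jet
      rw [iteratedDerivWithin_fun_add ht hu h1 (contDiffOn_s ho hs hy j t ht),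
        iteratedDerivWithin_succ']
    have h4 : Complex.I ^ (2 * j + 1) = (-1) ^ j * Complex.I := by
      rw [pow_succ, pow_mul, Complex.I_sq]
    change _ = Complex.I ^ (2 * j + 1) • (1 / 2 : ℂ) •
      jet J (fun τ => derivWithin (Z j) J.cl τ + S j τ) t j
    rw [h3, h4]
    module

end DiffExpr

end Quasi

/-! ### Green's formula -/

section Green

variable {ℋ : Type*} [NormedAddCommGroup ℋ] [InnerProductSpace ℂ ℋ] [CompleteSpace ℋ]
variable {J : BaseInterval} {r s : ℕ}

open DiffExpr

/-- `y` solves `L[y] = m[f]` on the open interval in the sense of quasi-derivatives: the derivatives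
of `y` of order below `(r + 1) / 2` and the quasi-derivatives `y^{[r-j]}`, `j ≥ 1`, are
differentiable, and `y^{[r]}(t | L) = f^{[s]}(t | m)`. -/
structure IsQuasiSolution (r : ℕ) (L : DiffExpr ℋ) (m : WeightExpr ℋ J s) (y f : ℝ → ℋ) :
    Prop where
  differentiableAt_jet : ∀ j < (r + 1) / 2, ∀ t ∈ J.io, DifferentiableAt ℝ (fun τ => jet J y τ j) t
  differentiableAt_quasi : ∀ j < (r + 1) / 2, ∀ t ∈ J.io, DifferentiableAt ℝ (L.quasi r J y (j + 1)) t
  quasi_eq : ∀ t ∈ J.io, L.quasi r J y 0 t = m.quasi s J f 0 t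

/-- For smooth `y` and `f` the quasi-derivative of order zero is the differential expression itself
(`quasi_zero_eq_apply`), so that a classical solution is a quasi-solution. -/
theorem isQuasiSolution_of_contDiffOn {L : DiffExpr ℋ} {m : WeightExpr ℋ J s} {y f : ℝ → ℋ}
    (ho : L.OrderLE J r) (hs : L.Smooth J r) (hy : ContDiffOn ℝ r y J.cl)
    (hf : ContDiffOn ℝ s f J.cl) (h : ∀ t ∈ J.cl, L.apply r J y t = m.apply s J f t) :
    IsQuasiSolution r L m y f where
  differentiableAt_jet j hj t ht :=
    ((contDiffOn_jet hy (i := 1) (j := j) (by omega)).differentiableOn (by norm_num)).differentiableAt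
      (J.cl_mem_nhds ht)
  differentiableAt_quasi j hj t ht :=
    ((contDiffOn_quasi ho hs hy (j + 1)).differentiableOn (by norm_num)).differentiableAt
      (J.cl_mem_nhds ht)
  quasi_eq t ht := by
    have ht' := J.io_subset_cl ht
    rw [quasi_zero_eq_apply ho hs hy ht', h t ht',
      quasi_zero_eq_apply m.order m.smooth hf ht']

/-- Green's formula for two solutions of equations with the same right-hand side. -/
theorem IsQuasiSolution.hasDerivAt_sum_inner {L₁ L₂ : DiffExpr ℋ} {m : WeightExpr ℋ J s}
    {y₁ y₂ f : ℝ → ℋ} (h₁ : IsQuasiSolution r L₁ m y₁ f) (h₂ : IsQuasiSolution r L₂ m y₂ f)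
    (ho₁ : L₁.OrderLE J r) (ho₂ : L₂.OrderLE J r) {t : ℝ} (ht : t ∈ J.io) :
    HasDerivAt (fun τ => ∑ j ∈ Finset.range ((r + 1) / 2),
        inner ℂ (jet J y₁ τ j - jet J y₂ τ j)
          (L₁.quasi r J y₁ (j + 1) τ - L₂.quasi r J y₂ (j + 1) τ))
      (L₁.form r t (jet J y₁ t) (jet J y₁ t - jet J y₂ t)
        - L₂.form r t (jet J y₂ t) (jet J y₁ t - jet J y₂ t)) t := by
  have ht' := J.io_subset_cl ht
  set N := (r + 1) / 2 with hN
  set z : ℕ → ℋ := jet J y₁ t - jet J y₂ t with hz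
  set D : ℕ → ℋ := fun j => L₁.quasi r J y₁ j t - L₂.quasi r J y₂ j t with hD
  set T : ℕ → ℋ := fun j => L₁.quasiTerm J y₁ j t - L₂.quasiTerm J y₂ j t with hT
  have hzj : ∀ j < N, HasDerivAt (fun τ => jet J y₁ τ j - jet J y₂ τ j) (z (j + 1)) t := by
    intro j hj
    have e1 := hasDerivAt_of_differentiableAt ht (h₁.differentiableAt_jet j hj t ht)
    have e2 := hasDerivAt_of_differentiableAt ht (h₂.differentiableAt_jet j hj t ht)
    rw [← jet_succ] at e1 e2
    exact e1.sub e2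
  have hDj : ∀ j < N, HasDerivAt (fun τ => L₁.quasi r J y₁ (j + 1) τ - L₂.quasi r J y₂ (j + 1) τ)
      (T j - D j) t := by
    intro j hj
    have e1 := hasDerivAt_of_differentiableAt ht (h₁.differentiableAt_quasi j hj t ht)
    have e2 := hasDerivAt_of_differentiableAt ht (h₂.differentiableAt_quasi j hj t ht)
    refine (e1.sub e2).congr_deriv ?_
    simp only [hT, hD]
    rw [quasi_rec ho₁ j ht', quasi_rec ho₂ j ht']
    abel
  have hD0 : D 0 = 0 := by simp only [hD]; rw [h₁.quasi_eq t ht, h₂.quasi_eq t ht, sub_self]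
  have hDN : D N = T N := by
    simp only [hD, hT]
    rw [quasi_eq_quasiTerm le_rfl, quasi_eq_quasiTerm le_rfl]
  refine (HasDerivAt.fun_sum fun j hj =>
    (hzj j (Finset.mem_range.1 hj)).inner ℂ (hDj j (Finset.mem_range.1 hj))).congr_deriv ?_
  have e : ∀ j, inner ℂ (jet J y₁ t j - jet J y₂ t j) (T j - D j) + inner ℂ (z (j + 1)) (D (j + 1)) =
      inner ℂ (z j) (T j) + (inner ℂ (z (j + 1)) (D (j + 1)) - inner ℂ (z j) (D j)) := by
    intro j
    rw [inner_sub_right]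
    simp only [hz, Pi.sub_apply]
    ring
  rw [form_eq_sum_term ho₁ le_rfl ht', form_eq_sum_term ho₂ le_rfl ht', ← Finset.sum_sub_distrib]
  simp only [← quasiTerm_eq_term, ← inner_sub_right]
  rw [Finset.sum_range_succ]
  refine (Finset.sum_congr rfl fun j _ => e j).trans ?_
  rw [Finset.sum_add_distrib, Finset.sum_range_sub (fun j => inner ℂ (z j) (D j)), hD0, hDN,
    inner_zero_right, sub_zero]

end Green

/-! ### The energy of the difference of two solutions -/

section Energy

variable {ℋ : Type*} [NormedAddCommGroup ℋ] [InnerProductSpace ℂ ℋ] [CompleteSpace ℋ]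
variable {J : BaseInterval} {r s : ℕ}

open DiffExpr

theorem DiffExpr.Q_apply (L : DiffExpr ℋ) (t : ℝ) (v : ℕ → ℋ) (i : Fin r) :
    L.Q r t (WithLp.toLp 2 fun j : Fin r => v j) i =
      if (i : ℕ) < r / 2 then Complex.I • v (i + r / 2)
      else if (i : ℕ) < 2 * (r / 2) then -Complex.I • v (i - r / 2)
      else L.q (r / 2 + 1) t (v i) := by
  obtain ⟨i, hi⟩ := i
  rw [Q, opMatrix_apply]
  simp only
  set n := r / 2 with hn
  split_ifs with h1 h2
  · rw [← if_pos (c := i + n < r) (t := Complex.I • v (i + n)) (e := 0) (by omega),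
      ← sum_fin_ite_eq r (i + n) fun j => Complex.I • v j]
    refine Finset.sum_congr rfl fun j _ => ?_
    by_cases hj : (j : ℕ) = i + n
    · simp [hj, h1]
    · have h3 : ¬ (i = 2 * n ∧ (j : ℕ) = 2 * n) := by omega
      have h4 : ¬ ((j : ℕ) < n ∧ i = j + n) := by omega
      simp [hj, h3, h4]
  · rw [← if_pos (c := i - n < r) (t := -Complex.I • v (i - n)) (e := 0) (by omega),
      ← sum_fin_ite_eq r (i - n) fun j => -Complex.I • v j]
    refine Finset.sum_congr rfl fun j _ => ?_
    have h0 : ¬ (i < n ∧ (j : ℕ) = i + n) := by omega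
    by_cases hj : (j : ℕ) = i - n
    · have h3 : ((j : ℕ) < n ∧ i = j + n) := by omega
      simp only [if_neg h0, if_pos h3, if_pos hj]
      simp
    · have h3 : ¬ (i = 2 * n ∧ (j : ℕ) = 2 * n) := by omega
      have h4 : ¬ ((j : ℕ) < n ∧ i = j + n) := by omega
      simp only [if_neg h0, if_neg h3, if_neg hj, if_neg h4, zero_apply]
  · have hi' : i = 2 * n := by omega
    rw [← if_pos (c := i < r) (t := L.q (n + 1) t (v i)) (e := 0) (by omega),
      ← sum_fin_ite_eq r i fun j => L.q (n + 1) t (v j)]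
    refine Finset.sum_congr rfl fun j _ => ?_
    have h0 : ¬ (i < n ∧ (j : ℕ) = i + n) := by omega
    have h3 : ¬ ((j : ℕ) < n ∧ i = j + n) := by omega
    by_cases hj : (j : ℕ) = i
    · rw [if_neg h0, if_neg h3, if_pos (by omega), if_pos hj]
    · rw [if_neg h0, if_neg h3, if_neg (by omega), if_neg hj, zero_apply]

theorem inner_rePart_re {E : Type*} [NormedAddCommGroup E] [InnerProductSpace ℂ E] [CompleteSpace E]
    (A : E →L[ℂ] E) (v : E) : (inner ℂ v (rePart A v)).re = (inner ℂ v (A v)).re := by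
  rw [rePart, smul_apply, add_apply, inner_smul_right, inner_add_right,
    ContinuousLinearMap.adjoint_inner_right, ← inner_conj_symm (A v) v, Complex.add_conj]
  simp

/-- The quadratic form of `Re Q`, in the even and in the odd case. -/
theorem energy_toLp (L : ℂ → DiffExpr ℋ) (z : ℂ) (t : ℝ) (v : ℕ → ℋ) :
    energy r L z t (WithLp.toLp 2 fun j : Fin r => v j) =
      -2 * (∑ j ∈ Finset.range (r / 2), inner ℂ (v j) (v (r / 2 + j))).im +
        if Even r then 0 else (inner ℂ (v (r - 1)) ((L z).q (r / 2 + 1) t (v (r - 1)))).re := by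
  rw [energy, inner_rePart_re, PiLp.inner_apply]
  simp only [Q_apply]
  rw [Fin.sum_univ_eq_sum_range (fun i => inner ℂ (v i) (if i < r / 2 then Complex.I • v (i + r / 2)
      else if i < 2 * (r / 2) then -Complex.I • v (i - r / 2)
      else (L z).q (r / 2 + 1) t (v i))) r]
  set n := r / 2 with hn
  set g : ℕ → ℂ := fun i => inner ℂ (v i) (if i < n then Complex.I • v (i + n)
      else if i < 2 * n then -Complex.I • v (i - n)
      else (L z).q (n + 1) t (v i)) with hg
  have h2n : (∑ i ∈ Finset.range (n + n), g i).re =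
      -2 * (∑ j ∈ Finset.range n, inner ℂ (v j) (v (n + j))).im := by
    rw [Finset.sum_range_add, ← Finset.sum_add_distrib, Complex.re_sum, Complex.im_sum,
      Finset.mul_sum]
    refine Finset.sum_congr rfl fun j hj => ?_
    rw [Finset.mem_range] at hj
    simp only [hg]
    rw [if_pos hj, if_neg (by omega), if_pos (by omega), Nat.add_sub_cancel_left, inner_smul_right,
      inner_smul_right, add_comm j n]
    have hi : (inner ℂ (v (n + j)) (v j)).im = -(inner ℂ (v j) (v (n + j))).im := by
      rw [← inner_conj_symm, Complex.conj_im]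
    simp [hi]
    ring
  split_ifs with h
  · have : r = n + n := by obtain ⟨k, hk⟩ := h; omega
    rw [← h2n, ← this, add_zero]
  · have : r = n + n + 1 := by
      rw [Nat.not_even_iff_odd] at h; obtain ⟨k, hk⟩ := h; omega
    have h1 : r - 1 = n + n := by omega
    rw [← h2n, h1, ← Complex.add_re]
    conv_lhs => rw [this, Finset.sum_range_succ]
    simp only [hg]
    rw [if_neg (by omega : ¬ n + n < n), if_neg (by omega : ¬ n + n < 2 * n)]

/-- The difference of the columns `y⃗` of two functions with the same `f`; it does not contain `f`.-/
theorem energy_vec_sub {L : ℂ → DiffExpr ℋ} {z : ℂ} {L₂ m : DiffExpr ℋ} {y₁ y₂ f : ℝ → ℋ} {t : ℝ}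
    (ht : t ∈ J.cl) (ho₁ : (L z).OrderLE J r) (ho₂ : L₂.OrderLE J r)
    (hlead : ∀ n, r = 2 * n + 1 → L₂.q (n + 1) t = (L z).q (n + 1) t) :
    energy r L z t ((L z).vec r s J m y₁ f t - L₂.vec r s J m y₂ f t) =
      -2 * (∑ j ∈ Finset.range ((r + 1) / 2), inner ℂ (jet J y₁ t j - jet J y₂ t j)
          ((L z).quasi r J y₁ (j + 1) t - L₂.quasi r J y₂ (j + 1) t)).im := by
  set n := r / 2 with hn
  set w : ℕ → ℋ := fun j => jet J y₁ t j - jet J y₂ t j with hw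
  set D : ℕ → ℋ := fun j => (L z).quasi r J y₁ j t - L₂.quasi r J y₂ j t with hD
  set v : ℕ → ℋ := fun i => if i < n then w i else if i < 2 * n then D (i - n + 1)
    else if r = 1 then w 0 else -Complex.I • w n with hv
  have hvec : (L z).vec r s J m y₁ f t - L₂.vec r s J m y₂ f t =
      WithLp.toLp 2 fun j : Fin r => v j := by
    ext i
    simp only [vec, PiLp.sub_apply, hv, hw, hD, ← hn]
    split_ifs
    · rfl
    · abel
    · simp [jet_zero]
    · module
  rw [hvec, energy_toLp, ← hn]
  have e1 : ∑ j ∈ Finset.range n, inner ℂ (v j) (v (n + j)) =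
      ∑ j ∈ Finset.range n, inner ℂ (w j) (D (j + 1)) := by
    refine Finset.sum_congr rfl fun j hj => ?_
    rw [Finset.mem_range] at hj
    simp only [hv]
    rw [if_pos hj, if_neg (by omega), if_pos (by omega), Nat.add_sub_cancel_left]
  rw [e1]
  split_ifs with h
  · have : (r + 1) / 2 = n := by obtain ⟨k, hk⟩ := h; omega
    rw [this, add_zero]
  · have hr : r = 2 * n + 1 := by
      rw [Nat.not_even_iff_odd] at h; obtain ⟨k, hk⟩ := h; omega
    have h1 : (r + 1) / 2 = n + 1 := by omega
    have h2 : r - 1 = 2 * n := by omega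
    have hDn : D (n + 1) = -(Complex.I / 2) • (L z).q (n + 1) t (w n) := by
      simp only [hD, hw]
      rw [quasi_eq_quasiTerm h1.le, quasi_eq_quasiTerm h1.le]
      simp only [quasiTerm, (ho₁ t ht).1 (n + 1) (by omega), (ho₂ t ht).1 (n + 1) (by omega),
        ((ho₁ t ht).2 (n + 1) (by omega)).2, ((ho₂ t ht).2 (n + 1) (by omega)).2, hlead n hr,
        zero_apply, Nat.add_eq_zero_iff, one_ne_zero, and_false, if_false, Nat.add_sub_cancel,
        map_sub]
      module
    have hvn : inner ℂ (v (2 * n)) ((L z).q (n + 1) t (v (2 * n))) =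
        inner ℂ (w n) ((L z).q (n + 1) t (w n)) := by
      simp only [hv]
      rw [if_neg (by omega), if_neg (by omega)]
      split_ifs with h3
      · rw [show n = 0 by omega]
      · rw [map_smul, inner_smul_left, inner_smul_right, ← mul_assoc]
        simp
    rw [h1, h2, hvn]
    change _ = -2 * (∑ j ∈ Finset.range (n + 1), inner ℂ (w j) (D (j + 1))).im
    rw [Finset.sum_range_succ, hDn, Complex.add_im, inner_smul_right]
    simp
    ring

end Energy

/-! ### Comparison of two solutions with the same right-hand side -/

section Comparison

theorem BaseInterval.exists_mem_io (J : BaseInterval) : ∃ c : ℝ, c ∈ J.io := by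
  obtain ⟨x, h1, h2⟩ := EReal.lt_iff_exists_real_btwn.1 J.lt
  exact ⟨x, h1, h2⟩

theorem BaseInterval.Icc_subset_io (J : BaseInterval) {α β : ℝ} (hα : α ∈ J.io) (hβ : β ∈ J.io) :
    Icc α β ⊆ J.io := fun _ h =>
  ⟨hα.1.trans_le (EReal.coe_le_coe_iff.2 h.1), (EReal.coe_le_coe_iff.2 h.2).trans_lt hβ.2⟩

theorem BaseInterval.eventually_atLeft (J : BaseInterval) {x : ℝ} (hx : x ∈ J.io) :
    ∀ᶠ α in J.atLeft, α ∈ J.io ∧ α < x := by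
  have h : Ioo J.a (x : EReal) ∈ 𝓝[>] J.a := Ioo_mem_nhdsGT hx.1
  filter_upwards [preimage_mem_comap h] with α hα
  exact ⟨⟨hα.1, hα.2.trans hx.2⟩, EReal.coe_lt_coe_iff.1 hα.2⟩

theorem BaseInterval.eventually_atRight (J : BaseInterval) {x : ℝ} (hx : x ∈ J.io) :
    ∀ᶠ β in J.atRight, β ∈ J.io ∧ x < β := by
  have h : Ioo (x : EReal) J.b ∈ 𝓝[<] J.b := Ioo_mem_nhdsLT hx.2
  filter_upwards [preimage_mem_comap h] with β hβ
  exact ⟨⟨hx.1.trans hβ.1, hβ.2⟩, EReal.coe_lt_coe_iff.1 hβ.1⟩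

theorem BaseInterval.eventually_ends (J : BaseInterval) {x : ℝ} (hx : x ∈ J.io) :
    ∀ᶠ e in J.ends, e.1 ∈ J.io ∧ e.2 ∈ J.io ∧ e.1 < x ∧ x < e.2 := by
  filter_upwards [(J.eventually_atLeft hx).prod_mk (J.eventually_atRight hx)] with e he
  exact ⟨he.1.1, he.2.1, he.1.2, he.2.2⟩

instance BaseInterval.neBot_ends (J : BaseInterval) : J.ends.NeBot := by
  have h1 : J.atLeft.NeBot := by
    refine comap_neBot_iff.2 fun S hS => ?_
    obtain ⟨u, hu, hS⟩ := (mem_nhdsGT_iff_exists_Ioo_subset' J.lt).1 hS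
    obtain ⟨x, h1, h2⟩ := EReal.lt_iff_exists_real_btwn.1 hu
    exact ⟨x, hS ⟨h1, h2⟩⟩
  have h2 : J.atRight.NeBot := by
    refine comap_neBot_iff.2 fun S hS => ?_
    obtain ⟨u, hu, hS⟩ := (mem_nhdsLT_iff_exists_Ioo_subset' J.lt).1 hS
    obtain ⟨x, h1, h2⟩ := EReal.lt_iff_exists_real_btwn.1 hu
    exact ⟨x, hS ⟨h1, h2⟩⟩
  exact h1.prod h2

instance BaseInterval.isCountablyGenerated_ends (J : BaseInterval) :
    J.ends.IsCountablyGenerated := by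
  have h1 : J.atLeft.IsCountablyGenerated := by unfold BaseInterval.atLeft; infer_instance
  have h2 : J.atRight.IsCountablyGenerated := by unfold BaseInterval.atRight; infer_instance
  unfold BaseInterval.ends
  infer_instance

theorem BaseInterval.ae_mem_io (J : BaseInterval) : ∀ᵐ x ∂(volume.restrict J.cl), x ∈ J.io := by
  have hnull : ∀ c : EReal, volume {x : ℝ | (x : EReal) = c} = 0 := fun c =>
    Set.Subsingleton.measure_zero (fun x hx y hy => EReal.coe_eq_coe_iff.1 (hx.trans hy.symm)) _
  have ha : ∀ᵐ x : ℝ, (x : EReal) ≠ J.a := ae_iff.2 (by simpa using hnull J.a)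
  have hb : ∀ᵐ x : ℝ, (x : EReal) ≠ J.b := ae_iff.2 (by simpa using hnull J.b)
  filter_upwards [ae_restrict_mem J.measurableSet_cl, ae_restrict_of_ae ha, ae_restrict_of_ae hb]
    with x hx h1 h2
  exact ⟨lt_of_le_of_ne hx.1 h1.symm, lt_of_le_of_ne hx.2 h2⟩

theorem BaseInterval.tendsto_integral_ends (J : BaseInterval) {g : ℝ → ℝ}
    (hg : IntegrableOn g J.cl) :
    Tendsto (fun e : ℝ × ℝ => ∫ t in e.1..e.2, g t) J.ends (𝓝 (∫ t in J.cl, g t)) := by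
  have hcov : AECover (volume.restrict J.cl) J.ends (fun e : ℝ × ℝ => Ioc e.1 e.2) := by
    refine ⟨?_, fun e => measurableSet_Ioc⟩
    filter_upwards [J.ae_mem_io] with x hx
    filter_upwards [J.eventually_ends hx] with e he
    exact ⟨he.2.2.1, he.2.2.2.le⟩
  refine (hcov.integral_tendsto_of_countably_generated hg).congr' ?_
  obtain ⟨c, hc⟩ := J.exists_mem_io
  filter_upwards [J.eventually_ends hc] with e he
  rw [intervalIntegral.integral_of_le (he.2.2.1.trans he.2.2.2).le,
    Measure.restrict_restrict measurableSet_Ioc, inter_eq_left.2]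
  exact Ioc_subset_Icc_self.trans ((J.Icc_subset_io he.1 he.2.1).trans J.io_subset_cl)

variable {ℋ : Type*} [NormedAddCommGroup ℋ] [InnerProductSpace ℂ ℋ] [CompleteSpace ℋ]
variable {J : BaseInterval} {r s : ℕ}

open DiffExpr

theorem WeightExpr.norm_cls_sq (m : WeightExpr ℋ J s) (f : m.H) :
    ‖m.cls f‖ ^ 2 = ∫ t in J.cl, (m.form s t (jet J f t) (jet J f t)).re := by
  have h1 : ‖m.cls f‖ ^ 2 = (inner ℂ (m.cls f) (m.cls f)).re :=
    (inner_self_eq_norm_sq (𝕜 := ℂ) _).symm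
  rw [h1, m.inner_cls, WeightExpr.dirichlet]
  exact (integral_re (𝕜 := ℂ) (m.integrableOn_form f.2 f.2)).symm

theorem WeightExpr.form_jet_sub (m : WeightExpr ℋ J s) (f g : m.H) {t : ℝ} (ht : t ∈ J.cl) :
    m.form s t (jet J ((f - g : m.H) : ℝ → ℋ) t) (jet J ((f - g : m.H) : ℝ → ℋ) t) =
      m.form s t (jet J f.fn t - jet J g.fn t) (jet J f.fn t - jet J g.fn t) := by
  have h : ∀ j ≤ s, jet J ((f - g : m.H) : ℝ → ℋ) t j = (jet J f.fn t - jet J g.fn t) j := fun j hj =>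
    jet_sub_of_contDiff ht ((f.2.1 t ht).of_le (by exact_mod_cast hj))
      ((g.2.1 t ht).of_le (by exact_mod_cast hj))
  exact m.form_congr t h h

theorem OrderLE.comb {L L' : DiffExpr ℋ} {k : ℕ} (h : L.OrderLE J k) (h' : L'.OrderLE J k)
    (x y : ℂ) : (DiffExpr.comb x L y L').OrderLE J k := fun t ht =>
  ⟨fun j hj => by simp [DiffExpr.comb, (h t ht).1 j hj, (h' t ht).1 j hj],
    fun j hj => by simp [DiffExpr.comb, (h t ht).2 j hj, (h' t ht).2 j hj]⟩

theorem OrderLE.adj {L : DiffExpr ℋ} {k : ℕ} (h : L.OrderLE J k) : L.adj.OrderLE J k := fun t ht =>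
  ⟨fun j hj => by simp [DiffExpr.adj, (h t ht).1 j hj],
    fun j hj => by simp [DiffExpr.adj, (h t ht).2 j hj]⟩

theorem orderLE_linPart {ℬ : Set ℂ} {L : ℂ → DiffExpr ℋ} {m : WeightExpr ℋ J s}
    (hsr : s ≤ r) (hL : NevanlinnaFamily J r ℬ L) (z : ℂ) :
    (linPart L m.toDiffExpr z).OrderLE J r := by
  have h := hL.order Complex.I (hL.nonreal _ (by simp))
  exact OrderLE.comb (OrderLE.comb h (OrderLE.adj h) _ _) (m.order.mono hsr) _ _

/-- Two solutions of `l_λ[y₁] = m[f]` and `l[y] - λ m[y] = m[f]`, `λ = iτ`, are close to each other in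
`L²_m`, relatively to `y`, if the form of `n_λ` is small against `τ m` and the energy of the
difference has nonpositive increment. -/
theorem norm_sub_le_of_isQuasiSolution {ℬ : Set ℂ} {L : ℂ → DiffExpr ℋ} {m : WeightExpr ℋ J s}
    (hsr : s ≤ r) (hL : NevanlinnaFamily J r ℬ L) (hLm : Dominates J r s L m.toDiffExpr)
    {τ ε : ℝ} (hτ : 0 < τ) (hε : 0 < ε) {z : ℂ} (hz : z = Complex.I * τ)
    (hN : ∀ t ∈ J.cl, ∀ u v : ℕ → ℋ, ‖(nPart L m.toDiffExpr z).form r t u v‖ ≤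
        ε * τ * ((m.form s t u u).re + (m.form s t v v).re))
    {f y₁ y : m.H} (h₁ : IsQuasiSolution r (L z) m y₁ f)
    (h₂ : IsQuasiSolution r (linPart L m.toDiffExpr z) m y f)
    {ℓ : ℝ} (hℓ : ℓ ≤ 0) (hlim : Tendsto (fun e : ℝ × ℝ =>
          (energy r L z e.2 ((L z).vec r s J m.toDiffExpr y₁ f e.2
              - (linPart L m.toDiffExpr z).vec r s J m.toDiffExpr y f e.2)
            - energy r L z e.1 ((L z).vec r s J m.toDiffExpr y₁ f e.1
              - (linPart L m.toDiffExpr z).vec r s J m.toDiffExpr y f e.1)) / z.im)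
          J.ends (𝓝 ℓ)) :
    ‖m.cls y₁ - m.cls y‖ ≤ 2 * ε * ‖m.cls y‖ := by
  have hzim : z.im = τ := by simp [hz]
  have hz0 : z.im ≠ 0 := by rw [hzim]; exact hτ.ne'
  have ho₁ := hL.order z (hL.nonreal z hz0)
  have ho₂ := orderLE_linPart (m := m) hsr hL z
  set L₂ := linPart L m.toDiffExpr z with hL₂
  set S : ℝ → ℂ := fun t => ∑ j ∈ Finset.range ((r + 1) / 2), inner ℂ (jet J y₁ t j - jet J y t j)
          ((L z).quasi r J y₁ (j + 1) t - L₂.quasi r J y (j + 1) t) with hS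
  have henergy : ∀ t ∈ J.io, energy r L z t ((L z).vec r s J m.toDiffExpr y₁ f t
      - L₂.vec r s J m.toDiffExpr y f t) = -2 * (S t).im := by
    intro t ht
    have ht' := J.io_subset_cl ht
    refine energy_vec_sub ht' ho₁ ho₂ fun n hn => ?_
    have := lead_nPart_eq_zero hn hsr ht' (hN t ht')
    simpa [nPart, comb, ← sub_eq_add_neg, sub_eq_zero] using this
  set w : m.H := y₁ - y with hw
  set g : ℝ → ℝ := fun t => (m.form s t (jet J w t) (jet J w t)).re
    - 4 * ε ^ 2 * (m.form s t (jet J y t) (jet J y t)).re with hg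
  have hwint : IntegrableOn (fun t => (m.form s t (jet J w t) (jet J w t)).re) J.cl :=
    (m.integrableOn_form w.2 w.2).re
  have hyint : IntegrableOn (fun t => 4 * ε ^ 2 * (m.form s t (jet J y t) (jet J y t)).re) J.cl :=
    (m.integrableOn_form y.2 y.2).re.const_mul _
  have hgint : IntegrableOn g J.cl := hwint.sub hyint
  -- the derivative of the energy bounds `g` from above
  have hder : ∀ t ∈ J.io, ∃ d, HasDerivAt (fun t => -2 * (S t).im / τ) d t ∧ g t ≤ d := by
    intro t ht
    have ht' := J.io_subset_cl ht
    have h := h₁.hasDerivAt_sum_inner h₂ ho₁ ho₂ ht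
    set d := (L z).form r t (jet J y₁.fn t) (jet J y₁.fn t - jet J y.fn t)
      - L₂.form r t (jet J y.fn t) (jet J y₁.fn t - jet J y.fn t) with hd
    refine ⟨-2 * d.im / τ, ((Complex.imCLM.hasFDerivAt.comp_hasDerivAt t h).const_mul
      (-2)).div_const τ, ?_⟩
    set u := jet J y₁.fn t - jet J y.fn t with hu
    have e1 : d = (L z).form r t u u - (nPart L m.toDiffExpr z).form r t (jet J y.fn t) u := by
      have e2 : jet J y₁.fn t = u + jet J y.fn t := by rw [hu, sub_add_cancel]
      rw [hd, nPart, form_comb, ← hL₂]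
      conv_lhs => rw [e2]
      rw [DiffExpr.form_add_left]
      ring
    have e3 := norm_form_le_of_forall hε (hN t ht') (jet J y.fn t) u
    have e4 := hLm z hz0 t ht' u
    rw [hzim, ← neg_div, le_div_iff₀ hτ] at e4
    have e5 := (abs_le.1 ((Complex.abs_im_le_norm _).trans e3)).1
    rw [hg]
    simp only
    rw [m.form_jet_sub y₁ y ht', e1, Complex.sub_im, le_div_iff₀ hτ]
    nlinarith
  have hmono : ∀ᶠ e : ℝ × ℝ in J.ends, ∫ t in e.1..e.2, g t ≤
      (energy r L z e.2 ((L z).vec r s J m.toDiffExpr y₁ f e.2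
              - L₂.vec r s J m.toDiffExpr y f e.2)
            - energy r L z e.1 ((L z).vec r s J m.toDiffExpr y₁ f e.1
              - L₂.vec r s J m.toDiffExpr y f e.1)) / z.im := by
    obtain ⟨c, hc⟩ := J.exists_mem_io
    filter_upwards [J.eventually_ends hc] with e he
    have hsub := J.Icc_subset_io he.1 he.2.1
    choose! d hd hgd using hder
    rw [henergy _ he.1, henergy _ he.2.1, hzim, sub_div]
    exact intervalIntegral.integral_le_sub_of_hasDeriv_right_of_le
      (he.2.2.1.trans he.2.2.2).le
      (fun t ht => (hd t (hsub ht)).continuousAt.continuousWithinAt)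
      (fun t ht => (hd t (hsub (Ioo_subset_Icc_self ht))).hasDerivWithinAt)
      (hgint.mono_set (hsub.trans J.io_subset_cl))
      (fun t ht => hgd t (hsub (Ioo_subset_Icc_self ht)))
  have h0 : ∫ t in J.cl, g t ≤ 0 :=
    (le_of_tendsto_of_tendsto (J.tendsto_integral_ends hgint) hlim hmono).trans hℓ
  rw [integral_sub hwint hyint, integral_const_mul] at h0
  have h1 := m.norm_cls_sq w
  have h2 := m.norm_cls_sq y
  have h3 : m.cls w = m.cls y₁ - m.cls y := UniformSpace.Completion.coe_sub y₁ y
  rw [← h3]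
  refine le_of_sq_le_sq ?_ (by positivity)
  rw [mul_pow, h1, h2]
  linarith

end Comparison

/-! ### The matrices of the first order system -/

section Matrices

variable {ℋ : Type*} [NormedAddCommGroup ℋ] [InnerProductSpace ℂ ℋ] [CompleteSpace ℋ]
variable {J : BaseInterval} {r s : ℕ} {ℬ : Set ℂ} {L : ℂ → DiffExpr ℋ} {m : WeightExpr ℋ J s}

open DiffExpr

theorem adjoint_opMatrix (k l : ℕ) (A : ℕ → ℕ → (ℋ →L[ℂ] ℋ)) :
    ContinuousLinearMap.adjoint (opMatrix k l A) =
      opMatrix l k fun i j => ContinuousLinearMap.adjoint (A j i) := by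
  symm
  rw [ContinuousLinearMap.eq_adjoint_iff]
  intro x y
  simp only [PiLp.inner_apply, opMatrix_apply, sum_inner, inner_sum,
    ContinuousLinearMap.adjoint_inner_left]
  exact Finset.sum_comm

theorem opMatrix_congr (k l : ℕ) {A B : ℕ → ℕ → (ℋ →L[ℂ] ℋ)} (h : ∀ i < k, ∀ j < l, A i j = B i j) :
    opMatrix k l A = opMatrix k l B := by
  ext v i
  rw [opMatrix_apply, opMatrix_apply]
  exact Finset.sum_congr rfl fun j _ => by rw [h i i.2 j j.2]

/-- The `i`-th coordinate of a vector of `ℋ ^ k`, extended by `0`. -/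
def coord {k : ℕ} (v : HPow ℋ k) (i : ℕ) : ℋ := if h : i < k then v ⟨i, h⟩ else 0

theorem coord_fin {k : ℕ} (v : HPow ℋ k) (i : Fin k) : coord v i = v i := by
  simp [coord]

theorem toLp_coord {k : ℕ} (v : HPow ℋ k) : (WithLp.toLp 2 fun j : Fin k => coord v j) = v := by
  ext i
  simp [coord]

theorem coord_toLp {k : ℕ} (u : ℕ → ℋ) {i : ℕ} (h : i < k) :
    coord (WithLp.toLp 2 fun j : Fin k => u j : HPow ℋ k) i = u i := by
  simp [coord, h]

theorem coord_opMatrix (k l : ℕ) (A : ℕ → ℕ → (ℋ →L[ℂ] ℋ)) (v : HPow ℋ l) {i : ℕ} (hi : i < k) :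
    coord (opMatrix k l A v) i = ∑ j : Fin l, A i j (coord v j) := by
  rw [coord, dif_pos hi, opMatrix_apply]
  simp only [coord_fin]

/-- `Q(t, L)` with the last diagonal block `a`. -/
def qMatrix (r : ℕ) (a : ℋ →L[ℂ] ℋ) : HPow ℋ r →L[ℂ] HPow ℋ r :=
  DiffExpr.Q r ⟨fun _ _ => 0, fun _ _ => a, fun _ _ => 0⟩ 0

theorem Q_eq_qMatrix (L : DiffExpr ℋ) (t : ℝ) : L.Q r t = qMatrix r (L.q (r / 2 + 1) t) := rfl

theorem coord_qMatrix (a : ℋ →L[ℂ] ℋ) (v : HPow ℋ r) {i : ℕ} (hi : i < r) :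
    coord (qMatrix r a v) i =
      if i < r / 2 then Complex.I • coord v (i + r / 2)
      else if i < 2 * (r / 2) then -Complex.I • coord v (i - r / 2)
      else a (coord v i) := by
  rw [coord, dif_pos hi]
  conv_lhs => rw [← toLp_coord v]
  exact Q_apply _ _ _ _

theorem HPow_ext_coord {k : ℕ} {v w : HPow ℋ k} (h : ∀ i < k, coord v i = coord w i) : v = w := by
  ext i
  rw [← coord_fin, ← coord_fin, h i i.2]

theorem coord_add {k : ℕ} (v w : HPow ℋ k) (i : ℕ) : coord (v + w) i = coord v i + coord w i := by
  unfold coord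
  split_ifs <;> simp

theorem coord_zero {k : ℕ} (i : ℕ) : coord (0 : HPow ℋ k) i = 0 := by
  unfold coord
  split_ifs
  · simp
  · rfl

theorem coord_smul {k : ℕ} (c : ℂ) (v : HPow ℋ k) (i : ℕ) : coord (c • v) i = c • coord v i := by
  unfold coord
  split_ifs <;> simp

theorem adjoint_qMatrix (a : ℋ →L[ℂ] ℋ) :
    ContinuousLinearMap.adjoint (qMatrix r a) = qMatrix r (ContinuousLinearMap.adjoint a) := by
  unfold qMatrix DiffExpr.Q
  rw [adjoint_opMatrix]
  refine opMatrix_congr _ _ fun i hi j hj => ?_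
  simp only
  split_ifs <;> first
    | omega
    | simp [map_smulₛₗ, ← ContinuousLinearMap.star_eq_adjoint]

theorem rePart_qMatrix (a : ℋ →L[ℂ] ℋ) : rePart (qMatrix r a) = qMatrix r (rePart a) := by
  refine ContinuousLinearMap.ext fun v => HPow_ext_coord fun i hi => ?_
  rw [rePart, adjoint_qMatrix, smul_apply, add_apply,
    coord_smul, coord_add, coord_qMatrix _ _ hi, coord_qMatrix _ _ hi, coord_qMatrix _ _ hi]
  split_ifs
  · module
  · module
  · simp [rePart]

theorem isUnit_qMatrix {a : ℋ →L[ℂ] ℋ} (ha : ¬ Even r → IsUnit a) : IsUnit (qMatrix r a) := by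
  rw [ContinuousLinearMap.isUnit_iff_bijective]
  set n := r / 2 with hn
  constructor
  · rw [injective_iff_map_eq_zero]
    intro v hv
    have h : ∀ i < r, coord (qMatrix r a v) i = 0 := fun i hi => by
      rw [hv, coord_zero]
    refine HPow_ext_coord fun i hi => ?_
    rw [coord_zero]
    rcases lt_or_ge i n with h1 | h1
    · have := h (i + n) (by omega)
      rw [coord_qMatrix _ _ (by omega), if_neg (by omega), if_pos (by omega), ← hn,
        Nat.add_sub_cancel] at this
      simpa using this
    · rcases lt_or_ge i (2 * n) with h2 | h2
      · have := h (i - n) (by omega)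
        rw [coord_qMatrix _ _ (by omega), if_pos (by omega), ← hn, Nat.sub_add_cancel h1] at this
        simpa using this
      · have := h i hi
        rw [coord_qMatrix _ _ hi, if_neg (by omega), if_neg (by omega)] at this
        have hr : ¬ Even r := by rw [Nat.not_even_iff]; omega
        have hb := (ContinuousLinearMap.isUnit_iff_bijective.1 (ha hr)).1
        exact hb (by rw [this, map_zero])
  · intro w
    set u : ℕ → ℋ := fun i => if i < n then Complex.I • coord w (i + n)
      else if i < 2 * n then -Complex.I • coord w (i - n) else Ring.inverse a (coord w i) with hu
    refine ⟨WithLp.toLp 2 fun j : Fin r => u j, HPow_ext_coord fun i hi => ?_⟩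
    rw [coord_qMatrix _ _ hi]
    split_ifs with h1 h2
    · rw [coord_toLp _ (by omega), hu]
      simp only
      rw [if_neg (by omega), if_pos (by omega), ← hn, Nat.add_sub_cancel, smul_smul]
      simp
    · rw [coord_toLp _ (by omega), hu]
      simp only
      rw [if_pos (by omega), ← hn, Nat.sub_add_cancel (by omega), smul_smul]
      simp
    · rw [coord_toLp _ (by omega), hu]
      simp only
      rw [if_neg (by omega), if_neg (by omega), ← mul_apply_eq_comp]
      have hr : ¬ Even r := by rw [Nat.not_even_iff]; omega
      rw [Ring.mul_inverse_cancel _ (ha hr)]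
      rfl

/-- `Q(t, l_λ)` is real in `λ`: its only nonconstant block is the leading coefficient. -/
theorem NevanlinnaFamily.Q_conj (hL : NevanlinnaFamily J r ℬ L) {z : ℂ} (hz : z.im ≠ 0) {t : ℝ}
    (ht : t ∈ J.cl) : (L (conj z)).Q r t = (L z).Q r t := by
  rw [Q_eq_qMatrix, Q_eq_qMatrix]
  rcases Nat.even_or_odd' r with ⟨n, hr | hr⟩
  · refine ContinuousLinearMap.ext fun v => HPow_ext_coord fun i hi => ?_
    rw [coord_qMatrix _ _ hi, coord_qMatrix _ _ hi]
    split_ifs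
    · rfl
    · rfl
    · omega
  · have : r / 2 = n := by omega
    rw [this, hL.q_conj hr hz ht]

/-- In odd order the last block of `Re Q` is half of `q_{n+1} + s_{n+1}`, which is invertible by
assumption; the rest of `Q` is a constant symplectic block. -/
theorem NevanlinnaFamily.isUnit_rePart_Q (hL : NevanlinnaFamily J r ℬ L) {z : ℂ} (hz : z.im ≠ 0)
    {t : ℝ} (ht : t ∈ J.cl) : IsUnit (rePart ((L z).Q r t)) := by
  rw [Q_eq_qMatrix, rePart_qMatrix]
  refine isUnit_qMatrix fun hr => ?_
  obtain ⟨n, hn⟩ := Nat.not_even_iff_odd.1 hr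
  have hrn : r / 2 = n := by omega
  have h1 := hL.lead_odd hr z (hL.nonreal z hz) t ht
  rw [hrn, hL.lead_adjoint hn hz ht] at h1
  rw [rePart, hrn]
  exact h1.smul (Units.mk0 (1 / 2 : ℂ) (by norm_num))

end Matrices

/-! ### The matrix `H(t, L)` -/

section Hamiltonian

variable {ℋ : Type*} [NormedAddCommGroup ℋ] [InnerProductSpace ℂ ℋ] [CompleteSpace ℋ]
variable {J : BaseInterval} {r s : ℕ} {ℬ : Set ℂ} {L : ℂ → DiffExpr ℋ} {m : WeightExpr ℋ J s}

open DiffExpr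

theorem adjoint_ringInverse (A : ℋ →L[ℂ] ℋ) :
    ContinuousLinearMap.adjoint (Ring.inverse A) = Ring.inverse (ContinuousLinearMap.adjoint A) := by
  rw [← ContinuousLinearMap.star_eq_adjoint, ← ContinuousLinearMap.star_eq_adjoint,
    Ring.inverse_star]

/-- The symmetry `p_j(λ) = p_j(λ̄)*`, `q_j(λ) = s_j(λ̄)*` of the coefficients at `λ̄`. -/
structure IsAdjointAt (L L' : DiffExpr ℋ) (t : ℝ) : Prop where
  p : ∀ j, ContinuousLinearMap.adjoint (L'.p j t) = L.p j t
  q : ∀ j, ContinuousLinearMap.adjoint (L'.q (j + 1) t) = L.s (j + 1) t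
  s : ∀ j, ContinuousLinearMap.adjoint (L'.s (j + 1) t) = L.q (j + 1) t

theorem NevanlinnaFamily.isAdjointAt (hL : NevanlinnaFamily J r ℬ L) {z : ℂ} (hz : z.im ≠ 0) {t : ℝ}
    (ht : t ∈ J.cl) : IsAdjointAt (L z) (L (conj z)) t where
  p j := (hL.p_symm z (hL.nonreal z hz) j t ht).symm
  q j := by
    rw [hL.q_symm _ (hL.nonreal _ (by simpa using hz)) j t ht, Complex.conj_conj,
      ContinuousLinearMap.adjoint_adjoint]
  s j := (hL.q_symm z (hL.nonreal z hz) j t ht).symm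

namespace IsAdjointAt

variable {L L' : DiffExpr ℋ} {t : ℝ}

theorem q_pos (h : IsAdjointAt L L' t) {j : ℕ} (hj : j ≠ 0) :
    ContinuousLinearMap.adjoint (L'.q j t) = L.s j t := by
  obtain ⟨i, rfl⟩ := Nat.exists_eq_succ_of_ne_zero hj
  exact h.q i

theorem s_pos (h : IsAdjointAt L L' t) {j : ℕ} (hj : j ≠ 0) :
    ContinuousLinearMap.adjoint (L'.s j t) = L.q j t := by
  obtain ⟨i, rfl⟩ := Nat.exists_eq_succ_of_ne_zero hj
  exact h.s i

theorem pInv (h : IsAdjointAt L L' t) :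
    ContinuousLinearMap.adjoint (L'.pInv r t) = L.pInv r t := by
  rw [DiffExpr.pInv, DiffExpr.pInv, adjoint_ringInverse, h.p]

theorem adjoint_mul (A B : ℋ →L[ℂ] ℋ) : ContinuousLinearMap.adjoint (A * B) =
    ContinuousLinearMap.adjoint B * ContinuousLinearMap.adjoint A :=
  ContinuousLinearMap.adjoint_comp A B

theorem adjoint_one : ContinuousLinearMap.adjoint (1 : ℋ →L[ℂ] ℋ) = 1 := by
  rw [← ContinuousLinearMap.star_eq_adjoint, star_one]

theorem HEven (h : IsAdjointAt L L' t) (i j : ℕ) :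
    ContinuousLinearMap.adjoint (L'.HEven r t j i) = L.HEven r t i j := by
  unfold DiffExpr.HEven
  simp only
  split_ifs <;> first
    | omega
    | (subst_vars
       simp [map_smulₛₗ, adjoint_mul, adjoint_one, h.p, h.pInv, mul_assoc, Complex.conj_ofNat]; done)
    | (rw [map_sub, map_smulₛₗ, adjoint_mul, adjoint_mul, h.q_pos (by omega), h.s_pos (by omega),
        h.pInv, h.p]
       subst_vars
       simp [mul_assoc, Complex.conj_ofNat])
    | (rw [map_smulₛₗ, h.q_pos (by omega)]; simp [Complex.conj_ofNat, neg_div])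
    | (rw [map_smulₛₗ, h.s_pos (by omega)]; simp [Complex.conj_ofNat, neg_div])
    | (rw [map_smulₛₗ, adjoint_mul, h.q_pos (by omega), h.pInv]; simp [Complex.conj_ofNat, neg_div])
    | (rw [map_smulₛₗ, adjoint_mul, h.s_pos (by omega), h.pInv]; simp [Complex.conj_ofNat, neg_div])

theorem HOdd (h : IsAdjointAt L L' t) (i j : ℕ) :
    ContinuousLinearMap.adjoint (L'.HOdd r t j i) = L.HOdd r t i j := by
  unfold DiffExpr.HOdd
  simp only
  split_ifs <;> first
    | omega
    | (subst_vars; simp [map_smulₛₗ, adjoint_one, h.p]; done)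
    | (rw [map_smulₛₗ, h.q_pos (by omega)]; simp [Complex.conj_ofNat, neg_div])
    | (rw [map_smulₛₗ, h.s_pos (by omega)]; simp [Complex.conj_ofNat, neg_div])

theorem H (h : IsAdjointAt L L' t) :
    ContinuousLinearMap.adjoint (L'.H r t) = L.H r t := by
  unfold DiffExpr.H
  rw [adjoint_opMatrix]
  congr 1
  funext i j
  split_ifs
  · exact h.HEven i j
  · exact h.HOdd i j

end IsAdjointAt

/-- The rows of `H(t, L)` with numbers below `n`, for `r = 2n`. -/
theorem DiffExpr.coord_H_even_lt (L : DiffExpr ℋ) (t : ℝ) (v : HPow ℋ r) {n i : ℕ} (hr : r = 2 * n)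
    (hi : i < n) :
    coord (L.H r t v) i = -L.p i t (coord v i)
      + (if 0 < i then (Complex.I / 2) • L.q i t (coord v (i - 1)) + coord v (n + i - 1) else 0)
      + (if i + 1 = n then (1 / 4 : ℂ) • L.s n t (L.pInv r t (L.q n t (coord v i)))
          - (Complex.I / 2) • L.s n t (L.pInv r t (coord v (2 * n - 1)))
        else -(Complex.I / 2) • L.s (i + 1) t (coord v (i + 1))) := by
  have hn : r / 2 = n := by omega
  have he : Even r := ⟨n, by omega⟩
  rw [DiffExpr.H, if_pos he, coord_opMatrix _ _ _ _ (by omega)]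
  set x := coord v with hx
  have e : ∀ j : Fin r, L.HEven r t i j (x j) = (if (j : ℕ) = i then -L.p i t (x j) else 0)
      + (if (j : ℕ) + 1 = i then (Complex.I / 2) • L.q i t (x j) else 0)
      + (if (j : ℕ) = i + 1 then (if i + 1 = n then 0 else -(Complex.I / 2) • L.s (i + 1) t (x j))
          else 0)
      + (if (j : ℕ) + 1 = n + i then (if 0 < i then x j else 0) else 0)
      + (if (j : ℕ) + 1 = n then
          (if i + 1 = n then (1 / 4 : ℂ) • L.s n t (L.pInv r t (L.q n t (x j))) else 0) else 0)
      + (if (j : ℕ) + 1 = 2 * n then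
          (if i + 1 = n then -(Complex.I / 2) • L.s n t (L.pInv r t (x j)) else 0) else 0) := by
    rintro ⟨j, hj⟩
    unfold DiffExpr.HEven
    simp only [hn, if_pos hi]
    by_cases h1 : j < n
    · have h2 : j + 1 ≠ 2 * n := by omega
      simp only [h1, if_true, h2, if_false, add_zero]
      split_ifs <;> first | omega | (subst_vars; simp [sub_eq_add_neg, add_comm])
    · have h2 : j ≠ i := by omega
      have h3 : j + 1 ≠ i := by omega
      have h4 : j + 1 ≠ n := by omega
      simp only [h1, h2, h3, h4, if_false, zero_add]
      split_ifs <;> first | omega | (subst_vars; simp)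
  simp only [e, Finset.sum_add_distrib]
  rw [sum_fin_ite_eq r i fun j => -L.p i t (x j),
    sum_fin_ite_succ_eq r i fun j => (Complex.I / 2) • L.q i t (x j),
    sum_fin_ite_eq r (i + 1) fun j => (if i + 1 = n then 0 else -(Complex.I / 2) • L.s (i + 1) t (x j)),
    sum_fin_ite_succ_eq r (n + i) fun j => (if 0 < i then x j else 0),
    sum_fin_ite_succ_eq r n fun j =>
      (if i + 1 = n then (1 / 4 : ℂ) • L.s n t (L.pInv r t (L.q n t (x j))) else 0),
    sum_fin_ite_succ_eq r (2 * n) fun j =>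
      (if i + 1 = n then -(Complex.I / 2) • L.s n t (L.pInv r t (x j)) else 0),
    if_pos (by omega : i < r), if_pos (by omega : i + 1 < r), if_pos (by omega : 0 < n + i ∧ n + i ≤ r),
    if_pos (by omega : 0 < n ∧ n ≤ r), if_pos (by omega : 0 < 2 * n ∧ 2 * n ≤ r)]
  by_cases h0 : 0 < i
  · rw [if_pos (by omega : 0 < i ∧ i ≤ r), if_pos h0, if_pos h0]
    by_cases h1 : i + 1 = n
    · simp only [if_pos h1]
      rw [show n - 1 = i by omega]
      module
    · simp only [if_neg h1]
      module
  · rw [if_neg (by omega : ¬ (0 < i ∧ i ≤ r)), if_neg h0, if_neg h0]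
    by_cases h1 : i + 1 = n
    · simp only [if_pos h1]
      rw [show n - 1 = i by omega]
      module
    · simp only [if_neg h1]
      module

/-- The rows of `H(t, L)` with numbers from `n` on, for `r = 2n`. -/
theorem DiffExpr.coord_H_even_ge (L : DiffExpr ℋ) (t : ℝ) (v : HPow ℋ r) {n i : ℕ} (hr : r = 2 * n)
    (hi : i < n) :
    coord (L.H r t v) (n + i) = if i + 1 = n then
        (Complex.I / 2) • L.pInv r t (L.q n t (coord v i)) + L.pInv r t (coord v (2 * n - 1))
      else coord v (i + 1) := by
  have hn : r / 2 = n := by omega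
  have he : Even r := ⟨n, by omega⟩
  rw [DiffExpr.H, if_pos he, coord_opMatrix _ _ _ _ (by omega)]
  set x := coord v with hx
  have e : ∀ j : Fin r, L.HEven r t (n + i) j (x j) =
      (if (j : ℕ) = i + 1 then (if i + 1 = n then 0 else x j) else 0)
      + (if (j : ℕ) + 1 = n then
          (if i + 1 = n then (Complex.I / 2) • L.pInv r t (L.q n t (x j)) else 0) else 0)
      + (if (j : ℕ) + 1 = 2 * n then (if i + 1 = n then L.pInv r t (x j) else 0) else 0) := by
    rintro ⟨j, hj⟩
    unfold DiffExpr.HEven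
    simp only [hn, if_neg (by omega : ¬ n + i < n), Nat.add_sub_cancel_left]
    split_ifs <;> first | omega | (subst_vars; simp)
  simp only [e, Finset.sum_add_distrib]
  rw [sum_fin_ite_eq r (i + 1) fun j => (if i + 1 = n then 0 else x j),
    sum_fin_ite_succ_eq r n fun j =>
      (if i + 1 = n then (Complex.I / 2) • L.pInv r t (L.q n t (x j)) else 0),
    sum_fin_ite_succ_eq r (2 * n) fun j => (if i + 1 = n then L.pInv r t (x j) else 0),
    if_pos (by omega : i + 1 < r),
    if_pos (by omega : 0 < n ∧ n ≤ r), if_pos (by omega : 0 < 2 * n ∧ 2 * n ≤ r)]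
  by_cases h1 : i + 1 = n
  · simp only [if_pos h1]
    rw [show n - 1 = i by omega, zero_add]
  · simp only [if_neg h1, add_zero]

/-- The rows of `H(t, L)` with numbers below `n`, for `r = 2n + 1`. -/
theorem DiffExpr.coord_H_odd_lt (L : DiffExpr ℋ) (t : ℝ) (v : HPow ℋ r) {n i : ℕ}
    (hr : r = 2 * n + 1) (hi : i < n) :
    coord (L.H r t v) i = -L.p i t (coord v i)
      + (if 0 < i then (Complex.I / 2) • L.q i t (coord v (i - 1)) + coord v (n + i - 1) else 0)
      + (if i + 1 = n then (1 / 2 : ℂ) • L.s n t (coord v (2 * n))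
        else -(Complex.I / 2) • L.s (i + 1) t (coord v (i + 1))) := by
  have hn : r / 2 = n := by omega
  have he : ¬ Even r := by rw [Nat.not_even_iff]; omega
  rw [DiffExpr.H, if_neg he, coord_opMatrix _ _ _ _ (by omega)]
  set x := coord v with hx
  have e : ∀ j : Fin r, L.HOdd r t i j (x j) = (if (j : ℕ) = i then -L.p i t (x j) else 0)
      + (if (j : ℕ) + 1 = i then (Complex.I / 2) • L.q i t (x j) else 0)
      + (if (j : ℕ) = i + 1 then (if i + 1 = n then 0 else -(Complex.I / 2) • L.s (i + 1) t (x j))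
          else 0)
      + (if (j : ℕ) + 1 = n + i then (if 0 < i then x j else 0) else 0)
      + (if (j : ℕ) = 2 * n then
          (if i + 1 = n then (1 / 2 : ℂ) • L.s n t (x j) else 0) else 0) := by
    rintro ⟨j, hj⟩
    unfold DiffExpr.HOdd
    simp only [hn, if_pos hi]
    by_cases h1 : j < n
    · have h2 : j ≠ 2 * n := by omega
      simp only [h1, if_true, h2, if_false, add_zero]
      split_ifs <;> first | omega | (subst_vars; simp)
    · have h2 : j ≠ i := by omega
      have h3 : j + 1 ≠ i := by omega
      simp only [h1, h2, h3, if_false, zero_add]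
      split_ifs <;> first | omega | (subst_vars; simp)
  simp only [e, Finset.sum_add_distrib]
  rw [sum_fin_ite_eq r i fun j => -L.p i t (x j),
    sum_fin_ite_succ_eq r i fun j => (Complex.I / 2) • L.q i t (x j),
    sum_fin_ite_eq r (i + 1) fun j => (if i + 1 = n then 0 else -(Complex.I / 2) • L.s (i + 1) t (x j)),
    sum_fin_ite_succ_eq r (n + i) fun j => (if 0 < i then x j else 0),
    sum_fin_ite_eq r (2 * n) fun j =>
      (if i + 1 = n then (1 / 2 : ℂ) • L.s n t (x j) else 0),
    if_pos (by omega : i < r), if_pos (by omega : i + 1 < r), if_pos (by omega : 0 < n + i ∧ n + i ≤ r),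
    if_pos (by omega : 2 * n < r)]
  by_cases h0 : 0 < i
  · rw [if_pos (by omega : 0 < i ∧ i ≤ r), if_pos h0, if_pos h0]
    by_cases h1 : i + 1 = n
    · simp only [if_pos h1]
      module
    · simp only [if_neg h1]
      module
  · rw [if_neg (by omega : ¬ (0 < i ∧ i ≤ r)), if_neg h0, if_neg h0]
    by_cases h1 : i + 1 = n
    · simp only [if_pos h1]
      module
    · simp only [if_neg h1]
      module

/-- The rows of `H(t, L)` with numbers `n, …, 2n - 1`, for `r = 2n + 1`. -/
theorem DiffExpr.coord_H_odd_ge (L : DiffExpr ℋ) (t : ℝ) (v : HPow ℋ r) {n i : ℕ}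
    (hr : r = 2 * n + 1) (hi : i < n) :
    coord (L.H r t v) (n + i) =
      if i + 1 = n then Complex.I • coord v (2 * n) else coord v (i + 1) := by
  have hn : r / 2 = n := by omega
  have he : ¬ Even r := by rw [Nat.not_even_iff]; omega
  rw [DiffExpr.H, if_neg he, coord_opMatrix _ _ _ _ (by omega)]
  set x := coord v with hx
  have e : ∀ j : Fin r, L.HOdd r t (n + i) j (x j) =
      (if (j : ℕ) = i + 1 then (if i + 1 = n then 0 else x j) else 0)
      + (if (j : ℕ) = 2 * n then (if i + 1 = n then Complex.I • x j else 0) else 0) := by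
    rintro ⟨j, hj⟩
    unfold DiffExpr.HOdd
    simp only [hn, if_neg (by omega : ¬ n + i < n), Nat.add_sub_cancel_left]
    split_ifs <;> first | omega | (subst_vars; simp)
  simp only [e, Finset.sum_add_distrib]
  rw [sum_fin_ite_eq r (i + 1) fun j => (if i + 1 = n then 0 else x j),
    sum_fin_ite_eq r (2 * n) fun j => (if i + 1 = n then Complex.I • x j else 0),
    if_pos (by omega : i + 1 < r), if_pos (by omega : 2 * n < r)]
  by_cases h1 : i + 1 = n
  · simp only [if_pos h1]
    rw [zero_add]
  · simp only [if_neg h1, add_zero]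

/-- The last row of `H(t, L)`, for `r = 2n + 1`. -/
theorem DiffExpr.coord_H_odd_last (L : DiffExpr ℋ) (t : ℝ) (v : HPow ℋ r) {n : ℕ}
    (hr : r = 2 * n + 1) :
    coord (L.H r t v) (2 * n) = -L.p n t (coord v (2 * n)) + if 0 < n then
        (1 / 2 : ℂ) • L.q n t (coord v (n - 1)) - Complex.I • coord v (2 * n - 1) else 0 := by
  have hn : r / 2 = n := by omega
  have he : ¬ Even r := by rw [Nat.not_even_iff]; omega
  rw [DiffExpr.H, if_neg he, coord_opMatrix _ _ _ _ (by omega)]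
  set x := coord v with hx
  have e : ∀ j : Fin r, L.HOdd r t (2 * n) j (x j) =
      (if (j : ℕ) = 2 * n then -L.p n t (x j) else 0)
      + (if (j : ℕ) + 1 = n then (1 / 2 : ℂ) • L.q n t (x j) else 0)
      + (if (j : ℕ) + 1 = 2 * n then -Complex.I • x j else 0) := by
    rintro ⟨j, hj⟩
    unfold DiffExpr.HOdd
    simp only [hn, if_neg (by omega : ¬ 2 * n < n), show 2 * n - n = n by omega, true_and, and_true]
    split_ifs <;> first | omega | (subst_vars; simp)
  simp only [e, Finset.sum_add_distrib]
  rw [sum_fin_ite_eq r (2 * n) fun j => -L.p n t (x j),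
    sum_fin_ite_succ_eq r n fun j => (1 / 2 : ℂ) • L.q n t (x j),
    sum_fin_ite_succ_eq r (2 * n) fun j => -Complex.I • x j, if_pos (by omega : 2 * n < r)]
  by_cases h0 : 0 < n
  · rw [if_pos (by omega : 0 < n ∧ n ≤ r), if_pos (by omega : 0 < 2 * n ∧ 2 * n ≤ r), if_pos h0]
    module
  · rw [if_neg (by omega : ¬ (0 < n ∧ n ≤ r)), if_neg (by omega : ¬ (0 < 2 * n ∧ 2 * n ≤ r)),
      if_neg h0]
    module

end Hamiltonian

/-! ### Continuity of operator matrices; a conserved quantity of the fundamental system -/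

section Fundamental

variable {ℋ : Type*} [NormedAddCommGroup ℋ] [InnerProductSpace ℂ ℋ] [CompleteSpace ℋ]
variable {J : BaseInterval} {r s : ℕ} {ℬ : Set ℂ} {L : ℂ → DiffExpr ℋ} {m : WeightExpr ℋ J s}

open DiffExpr

/-- The embedding of the `i`-th summand of `ℋ ^ k`. -/
def coordEmb (k : ℕ) (i : Fin k) : ℋ →L[ℂ] HPow ℋ k :=
  (PiLp.continuousLinearEquiv 2 ℂ (fun _ : Fin k => ℋ)).symm.toContinuousLinearMap ∘L
    ContinuousLinearMap.single ℂ (fun _ : Fin k => ℋ) i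

theorem opMatrix_eq_sum (k l : ℕ) (A : ℕ → ℕ → (ℋ →L[ℂ] ℋ)) :
    opMatrix k l A = ∑ i : Fin k, ∑ j : Fin l,
      coordEmb k i ∘L A i j ∘L (PiLp.proj 2 (𝕜 := ℂ) (fun _ : Fin l => ℋ) j) := by
  ext v i
  rw [opMatrix_apply]
  simp only [sum_apply, coordEmb, ContinuousLinearMap.comp_apply]
  simp [Pi.single_apply, Finset.sum_apply]

theorem contDiffOn_opMatrix (k l : ℕ) {N : ℕ} {S : Set ℝ} {A : ℝ → ℕ → ℕ → (ℋ →L[ℂ] ℋ)}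
    (h : ∀ i < k, ∀ j < l, ContDiffOn ℝ N (fun t => A t i j) S) :
    ContDiffOn ℝ N (fun t => opMatrix k l (A t)) S := by
  simp only [opMatrix_eq_sum]
  refine ContDiffOn.sum fun i _ => ContDiffOn.sum fun j _ => ?_
  have h1 := h i i.2 j j.2
  have h2 : ContDiffOn ℝ N
      (fun t => A t i j ∘L (PiLp.proj 2 (𝕜 := ℂ) (fun _ : Fin l => ℋ) j)) S :=
    ((isBoundedBilinearMap_comp (𝕜 := ℂ) (E := HPow ℋ l) (F := ℋ) (G := ℋ)).contDiff.restrict_scalars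
      ℝ).comp_contDiffOn (h1.prodMk contDiffOn_const)
  exact ((isBoundedBilinearMap_comp (𝕜 := ℂ) (E := HPow ℋ l) (F := ℋ)
    (G := HPow ℋ k)).contDiff.restrict_scalars ℝ).comp_contDiffOn (contDiffOn_const.prodMk h2)

/-- A continuous family of idempotents on a connected set that is the identity at one point is
the identity everywhere: an idempotent closer to `1` than `1` is `1`. -/
theorem eq_one_of_isIdempotent {𝔸 : Type*} [NormedRing 𝔸] [HasSummableGeomSeries 𝔸]
    {S : Set ℝ} (hS : IsPreconnected S) {P : ℝ → 𝔸} (hP : ContinuousOn P S)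
    (hi : ∀ t ∈ S, P t * P t = P t) {t₀ : ℝ} (ht₀ : t₀ ∈ S) (h₀ : P t₀ = 1) :
    ∀ t ∈ S, P t = 1 := by
  have key : ∀ t ∈ S, ‖1 - P t‖ < 1 → P t = 1 := fun t ht h => by
    have hu : IsUnit (P t) := by
      have := isUnit_one_sub_of_norm_lt_one h
      simpa using this
    exact hu.mul_left_cancel (by rw [hi t ht, mul_one])
  have hc : ContinuousOn (fun t => ‖1 - P t‖) S := (continuousOn_const.sub hP).norm
  intro t ht
  refine hS.induction₂ (fun x y => P x = 1 ↔ P y = 1) (fun x hx => ?_)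
    (fun x y z _ _ _ h h' => h.trans h') (fun x y _ _ h => h.symm) ht₀ ht |>.1 h₀
  by_cases hx1 : P x = 1
  · have h1 : ∀ᶠ y in 𝓝[S] x, ‖1 - P y‖ < 1 :=
      (hc x hx).eventually_lt_const (by simp [hx1])
    filter_upwards [h1, self_mem_nhdsWithin] with y hy hyS
    exact ⟨fun _ => key y hyS hy, fun _ => hx1⟩
  · have h1 : ∀ᶠ y in 𝓝[S] x, 0 < ‖1 - P y‖ :=
      (hc x hx).eventually_const_lt (by
        rw [norm_pos_iff, sub_ne_zero]
        exact fun h => hx1 h.symm)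
    filter_upwards [h1] with y hy
    refine ⟨fun h => absurd h hx1, fun h => ?_⟩
    rw [h] at hy
    simp at hy

theorem BaseInterval.zero_mem_cl (J : BaseInterval) : (0 : ℝ) ∈ J.cl :=
  ⟨by simpa using J.zero_left, by simpa using J.zero_right⟩

theorem NevanlinnaFamily.differentiableOn_Q (hL : NevanlinnaFamily J r ℬ L) {z : ℂ} (hz : z.im ≠ 0) :
    DifferentiableOn ℝ ((L z).Q r) J.cl := by
  have h : ContDiffOn ℝ (1 : ℕ) ((L z).Q r) J.cl := by
    refine contDiffOn_opMatrix r r fun i hi j hj => ?_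
    simp only
    split_ifs with h1 h2 h3
    · exact contDiffOn_const
    · exact contDiffOn_const
    · exact (((hL.smooth z (hL.nonreal z hz)).2 (r / 2) (by omega)).1).of_le
        (by exact_mod_cast (by omega : 1 ≤ r / 2 + 1))
    · exact contDiffOn_const
  exact h.differentiableOn (by norm_num)

variable {X : ℂ → ℝ → (HPow ℋ r →L[ℂ] HPow ℋ r)}

theorem IsFundamental.hasDerivWithinAt (hX : IsFundamental J r L X) {z : ℂ} (hz : z.im ≠ 0) {t : ℝ}
    (ht : t ∈ J.cl) : HasDerivWithinAt (X z) (derivWithin (X z) J.cl t) J.cl t :=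
  ((hX z hz).2 t ht).1.hasDerivWithinAt

/-- The first order system, with the derivative of `Q X` isolated. -/
theorem IsFundamental.hasDerivWithinAt_Q_mul (hL : NevanlinnaFamily J r ℬ L)
    (hX : IsFundamental J r L X) {z : ℂ} (hz : z.im ≠ 0) {t : ℝ} (ht : t ∈ J.cl) :
    HasDerivWithinAt (fun τ => (L z).Q r τ * X z τ)
      ((-2 * Complex.I) • ((L z).H r t * X z t) -
        star ((L z).Q r t) * derivWithin (X z) J.cl t) J.cl t := by
  have hd : DifferentiableWithinAt ℝ (fun τ => (L z).Q r τ * X z τ) J.cl t :=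
    (hL.differentiableOn_Q hz t ht).mul ((hX z hz).2 t ht).1
  have h := ((hX z hz).2 t ht).2
  refine hd.hasDerivWithinAt.congr_deriv ?_
  rw [ContinuousLinearMap.star_eq_adjoint]
  rw [sub_eq_zero] at h
  rw [← h, smul_smul]
  have : (-2 * Complex.I) * (Complex.I / 2) = 1 := by linear_combination -Complex.I_mul_I
  rw [this, one_smul, add_sub_cancel_right]

theorem rePart_eq_star {E : Type*} [NormedAddCommGroup E] [InnerProductSpace ℂ E] [CompleteSpace E]
    (A : E →L[ℂ] E) : rePart A = (1 / 2 : ℂ) • (A + star A) := rfl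

/-- The conserved quantity `X_{λ̄}* (Re Q) X_λ = G`. -/
theorem IsFundamental.star_mul_rePart_mul (hL : NevanlinnaFamily J r ℬ L)
    (hX : IsFundamental J r L X) {z : ℂ} (hz : z.im ≠ 0) {t : ℝ} (ht : t ∈ J.cl) :
    star (X (conj z) t) * rePart ((L z).Q r t) * X z t = rePart ((L z).Q r 0) := by
  have hz' : (conj z).im ≠ 0 := by simpa using hz
  have e : ∀ τ, star (X (conj z) τ) * rePart ((L z).Q r τ) * X z τ = (1 / 2 : ℂ) •
      (star (X (conj z) τ) * ((L z).Q r τ * X z τ) + star ((L z).Q r τ * X (conj z) τ) * X z τ) := by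
    intro τ
    rw [rePart_eq_star, star_mul, mul_smul_comm, smul_mul_assoc]
    congr 1
    noncomm_ring
  have hd : ∀ τ ∈ J.cl, HasDerivWithinAt (fun τ => (1 / 2 : ℂ) •
      (star (X (conj z) τ) * ((L z).Q r τ * X z τ) + star ((L z).Q r τ * X (conj z) τ) * X z τ))
      0 J.cl τ := by
    intro τ hτ
    have hA := hX.hasDerivWithinAt hz' hτ
    have hB := hX.hasDerivWithinAt hz hτ
    have hQA : HasDerivWithinAt (fun σ => (L z).Q r σ * X (conj z) σ)
        ((-2 * Complex.I) • ((L (conj z)).H r τ * X (conj z) τ) -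
        star ((L z).Q r τ) * derivWithin (X (conj z)) J.cl τ) J.cl τ := by
      rw [← hL.Q_conj hz hτ]
      exact (hX.hasDerivWithinAt_Q_mul hL hz' hτ).congr (fun σ hσ => by rw [hL.Q_conj hz hσ])
        (by rw [hL.Q_conj hz hτ])
    have hQB := hX.hasDerivWithinAt_Q_mul hL hz hτ
    have hH : star ((L (conj z)).H r τ) = (L z).H r τ := (hL.isAdjointAt hz hτ).H
    refine (((hA.star.mul hQB).add (hQA.star.mul hB)).const_smul (1 / 2 : ℂ)).congr_deriv ?_
    have hs : star (-2 * Complex.I) = 2 * Complex.I := by simp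
    rw [star_sub, star_smul, hs]
    simp only [star_mul, star_star, hH, sub_mul, mul_sub, mul_smul_comm, smul_mul_assoc, mul_assoc]
    module
  have h0 := J.convex_cl.is_const_of_fderivWithin_eq_zero (𝕜 := ℝ)
    (fun τ hτ => (hd τ hτ).differentiableWithinAt)
    (fun τ hτ => by
      have := (hd τ hτ).hasFDerivWithinAt.fderivWithin (J.uniqueDiffOn τ hτ)
      rw [this]
      ext
      simp) ht J.zero_mem_cl
  rw [e t]
  refine h0.trans ?_
  simp only [← e]
  rw [(hX z hz).1, (hX _ hz').1]
  simp

/-- `(Re Q) X_λ (G⁻¹ X_{λ̄}*) = 1`: the left side is idempotent by the conserved quantity, depends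
continuously on the point and is the identity at `0`. -/
theorem IsFundamental.rePart_mul_mul_star (hL : NevanlinnaFamily J r ℬ L)
    (hX : IsFundamental J r L X) {z : ℂ} (hz : z.im ≠ 0) {t : ℝ} (ht : t ∈ J.cl) :
    rePart ((L z).Q r t) * X z t *
      (Ring.inverse (rePart ((L z).Q r 0)) * star (X (conj z) t)) = 1 := by
  have hz' : (conj z).im ≠ 0 := by simpa using hz
  have hG := hL.isUnit_rePart_Q hz J.zero_mem_cl
  have hQ : ContinuousOn ((L z).Q r) J.cl := (hL.differentiableOn_Q hz).continuousOn
  have hXc : ∀ {w : ℂ}, w.im ≠ 0 → ContinuousOn (X w) J.cl := fun hw τ hτ =>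
    (hX.hasDerivWithinAt hw hτ).continuousWithinAt
  refine eq_one_of_isIdempotent J.convex_cl.isPreconnected
    (P := fun t => rePart ((L z).Q r t) * X z t *
      (Ring.inverse (rePart ((L z).Q r 0)) * star (X (conj z) t))) ?_ ?_ J.zero_mem_cl ?_ t ht
  · have hs : ∀ B : ℝ → (HPow ℋ r →L[ℂ] HPow ℋ r), ContinuousOn B J.cl →
        ContinuousOn (fun τ => star (B τ)) J.cl := fun B hB =>
      ContinuousLinearMap.adjoint.continuous.comp_continuousOn hB
    have h1 : ContinuousOn (fun τ => (L z).Q r τ + star ((L z).Q r τ)) J.cl := hQ.add (hs _ hQ)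
    have h2 : ContinuousOn (fun τ => rePart ((L z).Q r τ)) J.cl := by
      simp only [rePart_eq_star]
      exact ContinuousOn.const_smul h1 (1 / 2 : ℂ)
    have h3 := hs _ (hXc hz')
    have h4 : ContinuousOn (fun τ => rePart ((L z).Q r τ) * X z τ) J.cl := h2.mul (hXc hz)
    exact h4.mul (continuousOn_const.mul h3)
  · intro τ hτ
    have h := hX.star_mul_rePart_mul hL hz hτ
    set A := star (X (conj z) τ)
    set G := rePart ((L z).Q r 0)
    set B := rePart ((L z).Q r τ)
    calc B * X z τ * (Ring.inverse G * A) * (B * X z τ * (Ring.inverse G * A))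
        = B * X z τ * (Ring.inverse G * (A * B * X z τ) * (Ring.inverse G * A)) := by noncomm_ring
      _ = _ := by rw [h, Ring.inverse_mul_cancel _ hG, one_mul]
  · simp only [(hX z hz).1, (hX _ hz').1, star_one, mul_one]
    exact Ring.mul_inverse_cancel _ hG

end Fundamental

/-! ### The inhomogeneous first order system -/

section Inhomogeneous

variable {ℋ : Type*} [NormedAddCommGroup ℋ] [InnerProductSpace ℂ ℋ] [CompleteSpace ℋ]
variable {J : BaseInterval} {r s : ℕ} {ℬ : Set ℂ} {L : ℂ → DiffExpr ℋ} {m : WeightExpr ℋ J s}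
variable {X : ℂ → ℝ → (HPow ℋ r →L[ℂ] HPow ℋ r)} {M : ℂ → (HPow ℋ r →L[ℂ] HPow ℋ r)}

open DiffExpr

theorem hasDerivAt_clm_apply {E F : Type*} [NormedAddCommGroup E] [NormedSpace ℂ E]
    [NormedAddCommGroup F] [NormedSpace ℂ F] {A : ℝ → (E →L[ℂ] F)} {A' : E →L[ℂ] F} {v : ℝ → E} {v' : E}
    {t : ℝ} (hA : HasDerivAt A A' t) (hv : HasDerivAt v v' t) :
    HasDerivAt (fun τ => A τ (v τ)) (A' (v t) + A t v') t :=
  (((ContinuousLinearMap.restrictScalarsL ℂ E F ℝ ℝ).hasFDerivAt.comp_hasDerivAt t hA).clm_apply hv)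

theorem BaseInterval.uIcc_subset_io (J : BaseInterval) {a b : ℝ} (ha : a ∈ J.io) (hb : b ∈ J.io) :
    uIcc a b ⊆ J.io := by
  rcases le_total a b with h | h
  · rw [uIcc_of_le h]
    exact J.Icc_subset_io ha hb
  · rw [uIcc_of_ge h]
    exact J.Icc_subset_io hb ha

/-- Variation of constants: on the open interval, the integral against the kernel `K_λ(t, ·)` is
`X_λ(t)` applied to a primitive of `(iG)⁻¹ X_{λ̄}* g`. -/
theorem IsFundamental.exists_eq_of_tendsto (hL : NevanlinnaFamily J r ℬ L)
    (hX : IsFundamental J r L X) {z : ℂ} (hz : z.im ≠ 0) {g : ℝ → HPow ℋ r}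
    (hg : ContinuousOn g J.cl) {x : ℝ → HPow ℋ r}
    (hx : ∀ t ∈ J.cl, Tendsto (fun e : ℝ × ℝ => ∫ τ in e.1..e.2, greenKernel r L X M z t τ (g τ))
      J.ends (𝓝 (x t))) :
    ∃ t₀ ∈ J.io, ∃ w₀, ∀ t ∈ J.io, x t = X z t (w₀ +
      Ring.inverse (Complex.I • rePart ((L z).Q r 0)) (∫ τ in t₀..t, star (X (conj z) τ) (g τ))) := by
  have hz' : (conj z).im ≠ 0 := by simpa using hz
  obtain ⟨t₀, ht₀⟩ := J.exists_mem_io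
  set B := Ring.inverse (Complex.I • rePart ((L z).Q r 0)) with hB
  set V : ℝ → HPow ℋ r := fun τ => star (X (conj z) τ) (g τ) with hV
  have hVc : ContinuousOn V J.io := by
    have h1 : ContinuousOn (X (conj z)) J.cl := fun τ hτ =>
      (hX.hasDerivWithinAt hz' hτ).continuousWithinAt
    have h2 : ContinuousOn (fun τ => star (X (conj z) τ)) J.cl :=
      ContinuousLinearMap.adjoint.continuous.comp_continuousOn h1
    exact (h2.clm_apply hg).mono J.io_subset_cl
  have hVi : ∀ a ∈ J.io, ∀ b ∈ J.io, IntervalIntegrable V volume a b := fun a ha b hb =>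
    (hVc.mono (J.uIcc_subset_io ha hb)).intervalIntegrable
  set c : ℝ × ℝ → HPow ℋ r := fun e => (M z + (1 / 2 : ℂ) • B) (∫ τ in e.1..t₀, V τ) +
    (M z - (1 / 2 : ℂ) • B) (∫ τ in t₀..e.2, V τ) with hc
  have key : ∀ t ∈ J.io, ∀ᶠ e in J.ends, ∫ τ in e.1..e.2, greenKernel r L X M z t τ (g τ) =
      X z t (c e + B (∫ τ in t₀..t, V τ)) := by
    intro t ht
    filter_upwards [J.eventually_ends ht] with e ⟨h1, h2, h3, h4⟩
    have kk : ∀ τ, greenKernel r L X M z t τ (g τ) =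
        X z t ((M z - ((1 / 2 * Real.sign (τ - t) : ℝ) : ℂ) • B) (V τ)) := fun τ => rfl
    have k1 : EqOn (fun τ => greenKernel r L X M z t τ (g τ))
        (fun τ => (X z t * (M z + (1 / 2 : ℂ) • B)) (V τ)) (Ioo e.1 t) := fun τ hτ => by
      have : Real.sign (τ - t) = -1 := Real.sign_of_neg (by linarith [hτ.2])
      have e1 : M z - ((1 / 2 * (-1) : ℝ) : ℂ) • B = M z + (1 / 2 : ℂ) • B := by
        push_cast
        module
      refine (kk τ).trans ?_
      rw [this, e1]
      rfl
    have k2 : EqOn (fun τ => greenKernel r L X M z t τ (g τ))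
        (fun τ => (X z t * (M z - (1 / 2 : ℂ) • B)) (V τ)) (Ioo t e.2) := fun τ hτ => by
      have : Real.sign (τ - t) = 1 := Real.sign_of_pos (by linarith [hτ.1])
      have e1 : M z - ((1 / 2 * (1) : ℝ) : ℂ) • B = M z - (1 / 2 : ℂ) • B := by
        push_cast
        module
      refine (kk τ).trans ?_
      rw [this, e1]
      rfl
    have i1 : IntervalIntegrable (fun τ => (X z t * (M z + (1 / 2 : ℂ) • B)) (V τ)) volume e.1 t :=
      (((X z t * (M z + (1 / 2 : ℂ) • B)).continuous.comp_continuousOn hVc).mono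
        (J.uIcc_subset_io h1 ht)).intervalIntegrable
    have i2 : IntervalIntegrable (fun τ => (X z t * (M z - (1 / 2 : ℂ) • B)) (V τ)) volume t e.2 :=
      (((X z t * (M z - (1 / 2 : ℂ) • B)).continuous.comp_continuousOn hVc).mono
        (J.uIcc_subset_io ht h2)).intervalIntegrable
    rw [← intervalIntegral.integral_add_adjacent_intervals
      (i1.congr_uIoo (by rw [uIoo_of_le h3.le]; exact k1.symm))
      (i2.congr_uIoo (by rw [uIoo_of_le h4.le]; exact k2.symm)),
      intervalIntegral.integral_congr_Ioo_of_le h3.le k1,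
      intervalIntegral.integral_congr_Ioo_of_le h4.le k2,
      ContinuousLinearMap.intervalIntegral_comp_comm _ (hVi _ h1 _ ht),
      ContinuousLinearMap.intervalIntegral_comp_comm _ (hVi _ ht _ h2),
      ← intervalIntegral.integral_add_adjacent_intervals (hVi _ h1 _ ht₀) (hVi _ ht₀ _ ht),
      ← intervalIntegral.integral_add_adjacent_intervals (hVi _ ht _ ht₀) (hVi _ ht₀ _ h2),
      intervalIntegral.integral_symm t₀ t]
    rw [mul_apply_eq_comp, mul_apply_eq_comp, ← map_add]
    congr 1
    simp only [hc]
    simp only [map_add, map_neg, add_apply, sub_apply, smul_apply]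
    module
  -- `X_λ(t₀)` is left invertible, so convergence at the single point `t₀` forces `c` to converge
  have hG := hL.isUnit_rePart_Q hz J.zero_mem_cl
  set Y := Ring.inverse (rePart ((L z).Q r 0)) * (star (X (conj z) t₀) * rePart ((L z).Q r t₀))
    with hY
  have hYX : ∀ w, Y (X z t₀ w) = w := fun w => by
    have h := hX.star_mul_rePart_mul hL hz (J.io_subset_cl ht₀)
    have : Y * X z t₀ = 1 := by rw [hY, mul_assoc, h, Ring.inverse_mul_cancel _ hG]
    change (Y * X z t₀) w = w
    rw [this]
    rfl
  have hc0 : Tendsto c J.ends (𝓝 (Y (x t₀))) := by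
    have h1 := (Y.continuous.tendsto _).comp (hx t₀ (J.io_subset_cl ht₀))
    refine h1.congr' ?_
    filter_upwards [key t₀ ht₀] with e he
    rw [Function.comp_apply, he, hYX, intervalIntegral.integral_same, map_zero, add_zero]
  refine ⟨t₀, ht₀, Y (x t₀), fun t ht => ?_⟩
  refine tendsto_nhds_unique (hx t (J.io_subset_cl ht)) ?_
  refine Tendsto.congr' ((key t ht).mono fun e he => he.symm) ?_
  exact ((X z t).continuous.tendsto _).comp (hc0.add tendsto_const_nhds)

theorem ringInverse_I_smul {𝔸 : Type*} [Ring 𝔸] [Algebra ℂ 𝔸] {G : 𝔸} (hG : IsUnit G) :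
    Ring.inverse (Complex.I • G) = -Complex.I • Ring.inverse G := by
  have h1 : (Complex.I • G) * (-Complex.I • Ring.inverse G) = 1 := by
    rw [smul_mul_smul_comm, Ring.mul_inverse_cancel _ hG]
    simp
  have h2 : (-Complex.I • Ring.inverse G) * (Complex.I • G) = 1 := by
    rw [smul_mul_smul_comm, Ring.inverse_mul_cancel _ hG]
    simp
  exact Ring.inverse_unit ⟨Complex.I • G, -Complex.I • Ring.inverse G, h1, h2⟩

theorem hasDerivAt_integral_of_continuousOn {E : Type*} [NormedAddCommGroup E] [NormedSpace ℝ E]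
    [CompleteSpace E] {V : ℝ → E} (hV : ContinuousOn V J.io) {t₀ t : ℝ} (ht₀ : t₀ ∈ J.io)
    (ht : t ∈ J.io) : HasDerivAt (fun u => ∫ τ in t₀..u, V τ) (V t) t :=
  intervalIntegral.integral_hasDerivAt_right
    ((hV.mono (J.uIcc_subset_io ht₀ ht)).intervalIntegrable)
    (hV.stronglyMeasurableAtFilter J.isOpen_io t ht)
    (hV.continuousAt (J.isOpen_io.mem_nhds ht))

/-- The improper integral of the kernel against `g` solves, inside the interval, the system
`(i/2) ((Q x)' + Q* x') - H x = g`; the derivative of `Q x` is isolated. -/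
theorem IsFundamental.exists_hasDerivAt (hL : NevanlinnaFamily J r ℬ L)
    (hX : IsFundamental J r L X) {z : ℂ} (hz : z.im ≠ 0) {g : ℝ → HPow ℋ r}
    (hg : ContinuousOn g J.cl) {x : ℝ → HPow ℋ r}
    (hx : ∀ t ∈ J.cl, Tendsto (fun e : ℝ × ℝ => ∫ τ in e.1..e.2, greenKernel r L X M z t τ (g τ))
      J.ends (𝓝 (x t))) :
    ∃ x' : ℝ → HPow ℋ r, ∀ t ∈ J.io, HasDerivAt x (x' t) t ∧
      HasDerivAt (fun τ => (L z).Q r τ (x τ))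
        ((-2 * Complex.I) • ((L z).H r t (x t) + g t) - star ((L z).Q r t) (x' t)) t := by
  have hz' : (conj z).im ≠ 0 := by simpa using hz
  obtain ⟨t₀, ht₀, w₀, hw⟩ := hX.exists_eq_of_tendsto hL hz hg hx
  have hG := hL.isUnit_rePart_Q hz J.zero_mem_cl
  rw [ringInverse_I_smul hG] at hw
  set Gi := Ring.inverse (rePart ((L z).Q r 0)) with hGi
  set V : ℝ → HPow ℋ r := fun τ => star (X (conj z) τ) (g τ) with hV
  have hVc : ContinuousOn V J.io := by
    have h1 : ContinuousOn (X (conj z)) J.cl := fun τ hτ =>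
      (hX.hasDerivWithinAt hz' hτ).continuousWithinAt
    have h2 : ContinuousOn (fun τ => star (X (conj z) τ)) J.cl :=
      ContinuousLinearMap.adjoint.continuous.comp_continuousOn h1
    exact (h2.clm_apply hg).mono J.io_subset_cl
  set w : ℝ → HPow ℋ r := fun t => w₀ + (-Complex.I • Gi) (∫ τ in t₀..t, V τ) with hwdef
  have hwd : ∀ t ∈ J.io, HasDerivAt w ((-Complex.I • Gi) (V t)) t := fun t ht => by
    have h1 := hasDerivAt_integral_of_continuousOn hVc ht₀ ht
    have h2 := hasDerivAt_clm_apply (hasDerivAt_const t (-Complex.I • Gi)) h1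
    rw [zero_apply, zero_add] at h2
    exact h2.const_add w₀
  refine ⟨fun t => derivWithin (X z) J.cl t (w t) + X z t ((-Complex.I • Gi) (V t)), fun t ht => ?_⟩
  have htc := J.io_subset_cl ht
  have hev : ∀ᶠ τ in 𝓝 t, x τ = X z τ (w τ) :=
    (J.isOpen_io.eventually_mem ht).mono fun τ hτ => hw τ hτ
  refine ⟨(hasDerivAt_clm_apply ((hX.hasDerivWithinAt hz htc).hasDerivAt (J.cl_mem_nhds ht))
    (hwd t ht)).congr_of_eventuallyEq hev, ?_⟩
  have h1 := hasDerivAt_clm_apply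
    ((hX.hasDerivWithinAt_Q_mul hL hz htc).hasDerivAt (J.cl_mem_nhds ht)) (hwd t ht)
  refine (h1.congr_of_eventuallyEq (hev.mono fun τ hτ => ?_)).congr_deriv ?_
  · simp only [hτ, mul_apply_eq_comp]
  · rw [show x t = X z t (w t) from hw t ht]
    have h2 : rePart ((L z).Q r t) (X z t (Gi (V t))) = g t := by
      have := congrArg (fun A => A (g t)) (hX.rePart_mul_mul_star hL hz htc)
      simpa only [mul_apply_eq_comp, one_apply_eq_self] using this
    rw [rePart_eq_star] at h2
    simp only [← h2, sub_apply, smul_apply, add_apply, mul_apply_eq_comp, map_add, map_smul]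
    module

end Inhomogeneous

/-! ### The right hand side `W F` of the system -/

section RightSide

variable {ℋ : Type*} [NormedAddCommGroup ℋ] [InnerProductSpace ℂ ℋ] [CompleteSpace ℋ]
variable {J : BaseInterval} {r s : ℕ} {ℬ : Set ℂ} {L : ℂ → DiffExpr ℋ} {m : WeightExpr ℋ J s}

open DiffExpr

theorem DiffExpr.coord_bigF (L : DiffExpr ℋ) (f : ℝ → ℋ) (t : ℝ) {i : ℕ} (hi : i < r) :
    coord (L.bigF r s J f t) i =
      if i < r / 2 then (if i ≤ s / 2 then jet J f t i else 0)
      else if r = 1 then f t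
      else if s = 2 * (r / 2) then
        (if Even r then L.quasi r J f (i - r / 2 + 1) t
        else if i = 2 * (r / 2) then -Complex.I • jet J f t (r / 2) else 0)
      else 0 :=
  coord_toLp (fun i : ℕ => if i < r / 2 then (if i ≤ s / 2 then jet J f t i else 0)
      else if r = 1 then f t
      else if s = 2 * (r / 2) then
        (if Even r then L.quasi r J f (i - r / 2 + 1) t
        else if i = 2 * (r / 2) then -Complex.I • jet J f t (r / 2) else 0)
      else 0) hi

/-- `T F` is the column of the derivatives of `f` up to the order of the form of `m`. -/
theorem DiffExpr.coord_toJet_bigF [NeZero r] (hsr : s ≤ r) (hs : Even s) {L : DiffExpr ℋ}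
    (ho : L.OrderLE J r) {t : ℝ} (ht : t ∈ J.cl) (hu : Even r → IsUnit (L.p (r / 2) t)) (f : ℝ → ℋ)
    {i : ℕ} (hi : i ≤ s / 2) :
    coord (L.toJet r t (L.bigF r s J f t)) i = jet J f t i := by
  have hr0 : r ≠ 0 := NeZero.ne r
  obtain ⟨k, hk⟩ := hs
  have hv := fun j (hj : j < r) => L.coord_bigF (s := s) (J := J) f t hj
  rw [DiffExpr.toJet, coord_opMatrix _ _ _ _ (by omega)]
  set v := coord (L.bigF r s J f t) with hvdef
  obtain ⟨n, hn⟩ : ∃ n, r / 2 = n := ⟨_, rfl⟩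
  simp only [hn] at hv hu ⊢
  rcases lt_or_ge i n with hin | hin
  · simp only [if_pos hin]
    have e : ∀ j : Fin r, (if i = (j : ℕ) then (1 : ℋ →L[ℂ] ℋ) else 0) (v j) =
        if (j : ℕ) = i then v j else 0 := fun j => by
      by_cases h : i = (j : ℕ)
      · rw [if_pos h, if_pos h.symm, one_apply_eq_self]
      · rw [if_neg h, if_neg (Ne.symm h), zero_apply]
    simp only [e]
    rw [sum_fin_ite_eq r i fun j => v j, if_pos (by omega), hv i (by omega), if_pos hin, if_pos hi]
  · obtain rfl : i = n := by omega
    simp only [lt_irrefl, if_false]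
    by_cases h1 : r = 1
    · subst h1
      obtain rfl : i = 0 := by omega
      simp only [if_true]
      rw [Fin.sum_univ_one, one_apply_eq_self, jet_zero]
      have := hv 0 (by omega)
      simpa using this
    · simp only [if_neg h1] at hv ⊢
      by_cases he : Even r
      · obtain ⟨k', hk'⟩ := he
        have he : Even r := ⟨k', hk'⟩
        simp only [if_pos he] at hv ⊢
        have e : ∀ j : Fin r, (if (j : ℕ) + 1 = i then (Complex.I / 2) • (L.pInv r t * L.q i t)
            else if (j : ℕ) + 1 = 2 * i then L.pInv r t else 0) (v j) =
            (if (j : ℕ) + 1 = i then (Complex.I / 2) • L.pInv r t (L.q i t (v j)) else 0) +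
            if (j : ℕ) + 1 = 2 * i then L.pInv r t (v j) else 0 := fun j => by
          split_ifs <;> first | omega | simp
        simp only [e, Finset.sum_add_distrib]
        rw [sum_fin_ite_succ_eq r i fun j => (Complex.I / 2) • L.pInv r t (L.q i t (v j)),
          sum_fin_ite_succ_eq r (2 * i) fun j => L.pInv r t (v j), if_pos (by omega),
          if_pos (by omega), hv (i - 1) (by omega), hv (2 * i - 1) (by omega), if_pos (by omega),
          if_pos (by omega), if_neg (by omega), if_pos (by omega), show 2 * i - 1 - i + 1 = i by omega,
          quasi_eq_quasiTerm (by omega), DiffExpr.quasiTerm, ((ho t ht).2 i (by omega)).2,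
          if_neg (by omega), zero_apply]
        have hp : L.pInv r t (L.p i t (jet J f t i)) = jet J f t i := by
          rw [DiffExpr.pInv, hn, ← mul_apply_eq_comp, Ring.inverse_mul_cancel _ (hu he),
            one_apply_eq_self]
        simp only [map_add, map_smul, map_sub, hp, map_zero]
        module
      · have hr : r = 2 * i + 1 := by
          rw [Nat.not_even_iff] at he
          omega
        simp only [if_neg he] at hv ⊢
        have e : ∀ j : Fin r, (if (j : ℕ) = 2 * i then Complex.I • (1 : ℋ →L[ℂ] ℋ) else 0) (v j) =
            if (j : ℕ) = 2 * i then Complex.I • v j else 0 := fun j => by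
          split_ifs <;> simp
        simp only [e]
        rw [sum_fin_ite_eq r (2 * i) fun j => Complex.I • v j, if_pos (by omega),
          hv (2 * i) (by omega), if_neg (by omega), if_pos (by omega), if_pos rfl, smul_smul]
        simp

theorem DiffExpr.coord_formMatrix (m : WeightExpr ℋ J s) (n : ℕ) (hsn : s / 2 ≤ n) {t : ℝ}
    (ht : t ∈ J.cl) (f : ℝ → ℋ) {u : HPow ℋ (n + 1)} (hu : ∀ i ≤ s / 2, coord u i = jet J f t i)
    {i : ℕ} (hi : i < n + 1) :
    coord (m.formMatrix n t u) i = m.quasiTerm J f i t := by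
  obtain ⟨k, hk⟩ := m.even
  have h := formMatrix_apply n m.toDiffExpr t (coord u) ⟨i, hi⟩
  rw [toLp_coord] at h
  rw [show coord (m.formMatrix n t u) i = (m.formMatrix n t u) ⟨i, hi⟩ from
    coord_fin (m.formMatrix n t u) ⟨i, hi⟩, h, DiffExpr.quasiTerm]
  have ho := m.order t ht
  congr 1
  · rcases le_or_gt i (s / 2) with h1 | h1
    · rw [hu i h1]
    · simp only [ho.1 i (by omega), zero_apply]
  · congr 2
    · simp only
      rcases le_or_gt (i + 1) (s / 2) with h1 | h1
      · rw [if_pos (by omega), hu _ h1]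
      · rw [(ho.2 i (by omega)).2]
        simp
    · simp only
      rcases Nat.eq_zero_or_pos i with h0 | h0
      · rw [if_pos h0, if_pos h0]
      · rw [if_neg h0.ne', if_neg h0.ne']
        obtain ⟨i', rfl⟩ := Nat.exists_eq_succ_of_ne_zero h0.ne'
        rcases le_or_gt i' (s / 2) with h1 | h1
        · rw [Nat.succ_sub_one, hu _ h1]
        · rw [(ho.2 i' (by omega)).1, zero_apply, zero_apply]

/-- The entries of `W(t, l_{λ̄}, m) F(t, l_{λ̄}, m)` in terms of `T*` applied to the column of the
`m.quasiTerm J f i t`. -/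
theorem NevanlinnaFamily.W_bigF [NeZero r] (hsr : s ≤ r) (hL : NevanlinnaFamily J r ℬ L) {z : ℂ}
    (hz : z.im ≠ 0) {t : ℝ} (ht : t ∈ J.cl) (f : ℝ → ℋ) :
    (L z).W r m.toDiffExpr t ((L z).bigF r s J f t) =
      ContinuousLinearMap.adjoint ((L z).toJet r t)
        (WithLp.toLp 2 fun i : Fin (r / 2 + 1) => m.quasiTerm J f i t) := by
  rw [DiffExpr.W, ContinuousLinearMap.comp_apply, ContinuousLinearMap.comp_apply]
  congr 1
  refine HPow_ext_coord fun i hi => ?_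
  rw [coord_toLp (fun i => m.quasiTerm J f i t) hi]
  refine coord_formMatrix m (r / 2) (by omega) ht f (fun j hj => ?_) hi
  exact coord_toJet_bigF hsr m.even (hL.order z (hL.nonreal z hz)) ht
    (fun he => hL.lead_even he z (hL.nonreal z hz) t ht) f hj

theorem coord_adjoint_toJet (L : DiffExpr ℋ) (t : ℝ) (μ : ℕ → ℋ) {i : ℕ} (hi : i < r) :
    coord (ContinuousLinearMap.adjoint (L.toJet r t)
      (WithLp.toLp 2 fun i : Fin (r / 2 + 1) => μ i)) i =
      (if i < r / 2 then μ i else 0) + ContinuousLinearMap.adjoint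
        (if r = 1 then 1
          else if Even r then
            (if i + 1 = r / 2 then (Complex.I / 2) • (L.pInv r t * L.q (r / 2) t)
            else if i + 1 = 2 * (r / 2) then L.pInv r t else 0)
          else if i = 2 * (r / 2) then Complex.I • (1 : ℋ →L[ℂ] ℋ) else 0) (μ (r / 2)) := by
  rw [DiffExpr.toJet, adjoint_opMatrix, coord_opMatrix _ _ _ _ hi, Fin.sum_univ_castSucc]
  congr 1
  · rw [← sum_fin_ite_eq (r / 2) i μ]
    refine Finset.sum_congr rfl fun j _ => ?_
    have hj := j.2
    rw [coord_toLp μ (j.castSucc).2]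
    simp only [Fin.val_castSucc, if_pos hj]
    split_ifs
    · simp [IsAdjointAt.adjoint_one]
    · simp
  · rw [coord_toLp μ (Fin.last (r / 2)).2]
    simp only [Fin.val_last, lt_irrefl, if_false]

theorem NevanlinnaFamily.coord_W_bigF_even [NeZero r] (hsr : s ≤ r) (hL : NevanlinnaFamily J r ℬ L)
    {z : ℂ} (hz : z.im ≠ 0) {t : ℝ} (ht : t ∈ J.cl) (f : ℝ → ℋ) {n : ℕ} (hr : r = 2 * n) {i : ℕ}
    (hi : i < r) :
    coord ((L (conj z)).W r m.toDiffExpr t ((L (conj z)).bigF r s J f t)) i =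
      (if i < n then m.quasiTerm J f i t else 0) +
        if i + 1 = n then -(Complex.I / 2) • (L z).s n t ((L z).pInv r t (m.quasiTerm J f n t))
        else if i + 1 = 2 * n then (L z).pInv r t (m.quasiTerm J f n t) else 0 := by
  have ha := hL.isAdjointAt hz ht
  have he : Even r := ⟨n, by omega⟩
  rw [hL.W_bigF hsr (by simpa using hz) ht,
    coord_adjoint_toJet _ _ (fun i => m.quasiTerm J f i t) hi, show r / 2 = n by omega,
    if_neg (by omega : ¬ r = 1), if_pos he]
  congr 1
  split_ifs with h1 h2
  · rw [map_smulₛₗ, IsAdjointAt.adjoint_mul, ha.q_pos (by omega), ha.pInv]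
    simp [Complex.conj_ofNat, neg_div]
  · rw [ha.pInv]
  · simp

theorem NevanlinnaFamily.coord_W_bigF_odd [NeZero r] (hsr : s ≤ r) (hL : NevanlinnaFamily J r ℬ L)
    {z : ℂ} (hz : z.im ≠ 0) {t : ℝ} (ht : t ∈ J.cl) (f : ℝ → ℋ) {n : ℕ} (hr : r = 2 * n + 1) {i : ℕ}
    (hi : i < r) :
    coord ((L (conj z)).W r m.toDiffExpr t ((L (conj z)).bigF r s J f t)) i =
      (if i < n then m.quasiTerm J f i t else 0) +
        if i = 2 * n then (if n = 0 then m.quasiTerm J f n t else -Complex.I • m.quasiTerm J f n t)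
        else 0 := by
  rw [hL.W_bigF hsr (by simpa using hz) ht,
    coord_adjoint_toJet _ _ (fun i => m.quasiTerm J f i t) hi, show r / 2 = n by omega]
  congr 1
  have he : ¬ Even r := by rw [Nat.not_even_iff]; omega
  rw [if_neg he]
  split_ifs <;> first | omega | simp [map_smulₛₗ, IsAdjointAt.adjoint_one]

theorem continuousOn_of_coord {k : ℕ} {S : Set ℝ} {g : ℝ → HPow ℋ k}
    (h : ∀ i < k, ContinuousOn (fun t => coord (g t) i) S) : ContinuousOn g S := by
  have h1 : ContinuousOn (fun t => WithLp.toLp 2 fun i : Fin k => g t i) S :=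
    (PiLp.continuous_toLp 2 (fun _ : Fin k => ℋ)).comp_continuousOn
      (continuousOn_pi.2 fun i => by simpa only [coord_fin] using h i i.2)
  exact h1

theorem NevanlinnaFamily.continuousOn_W_bigF [NeZero r] (hsr : s ≤ r) (hL : NevanlinnaFamily J r ℬ L)
    {z : ℂ} (hz : z.im ≠ 0) {f : ℝ → ℋ} (hf : ContDiffOn ℝ (s : ℕ) f J.cl) :
    ContinuousOn (fun t => (L (conj z)).W r m.toDiffExpr t ((L (conj z)).bigF r s J f t)) J.cl := by
  have hμ : ∀ j, ContinuousOn (m.quasiTerm J f j) J.cl := fun j =>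
    (contDiffOn_quasiTerm m.order m.smooth hf j).continuousOn
  have hzB := hL.nonreal z hz
  refine continuousOn_of_coord fun i hi => ?_
  rcases Nat.even_or_odd' r with ⟨n, hr | hr⟩
  · refine ContinuousOn.congr ?_ fun t ht => hL.coord_W_bigF_even hsr hz ht f hr hi
    have hP : ContinuousOn ((L z).pInv r) J.cl := fun t ht => by
      obtain ⟨u, hu⟩ := hL.lead_even ⟨n, by omega⟩ z hzB t ht
      have h1 := NormedRing.inverse_continuousAt u
      rw [hu] at h1
      exact h1.comp_continuousWithinAt
        (((hL.smooth z hzB).1 (r / 2) (by omega)).continuousOn t ht)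
    have hs : 0 < n → ContinuousOn ((L z).s n) J.cl := fun h => by
      have := ((hL.smooth z hzB).2 (n - 1) (by omega)).2.continuousOn
      rwa [Nat.sub_add_cancel h] at this
    have hPμ : ContinuousOn (fun t => (L z).pInv r t (m.quasiTerm J f n t)) J.cl :=
      hP.clm_apply (hμ n)
    split_ifs
    · exact (hμ i).add (((hs (by omega)).clm_apply hPμ).const_smul _)
    · exact (hμ i).add hPμ
    · exact (hμ i).add continuousOn_const
    · exact continuousOn_const.add (((hs (by omega)).clm_apply hPμ).const_smul _)
    · exact continuousOn_const.add hPμ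
    · exact continuousOn_const
  · refine ContinuousOn.congr ?_ fun t ht => hL.coord_W_bigF_odd hsr hz ht f hr hi
    split_ifs
    · exact (hμ i).add (hμ n)
    · exact (hμ i).add ((hμ n).const_smul _)
    · exact (hμ i).add continuousOn_const
    · exact continuousOn_const.add (hμ n)
    · exact continuousOn_const.add ((hμ n).const_smul _)
    · exact continuousOn_const

end RightSide

/-! ### The values of `R(λ)` solve `l_λ[y] = m[f]` -/

section ResolventValue

variable {ℋ : Type*} [NormedAddCommGroup ℋ] [InnerProductSpace ℂ ℋ] [CompleteSpace ℋ]
variable {J : BaseInterval} {r s : ℕ} {ℬ : Set ℂ} {L : ℂ → DiffExpr ℋ} {m : WeightExpr ℋ J s}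
variable {X : ℂ → ℝ → (HPow ℋ r →L[ℂ] HPow ℋ r)} {M : ℂ → (HPow ℋ r →L[ℂ] HPow ℋ r)}

open DiffExpr

/-- A first order system in the functions `ξ_k` and `δ_j` is the equation `L[y] = m[f]`: the
`ξ_k` are the derivatives of `y`, and the `δ_j` the differences `y^{[r-j]}(t | L) - f^{[s-j]}(t | m)`
of quasi-derivatives. -/
theorem isQuasiSolution_of_system (hsr : s ≤ r) {L : DiffExpr ℋ} (ho : L.OrderLE J r) {y f : ℝ → ℋ}
    (hf : ContDiffOn ℝ (s : ℕ) f J.cl) {ξ δ : ℕ → ℝ → ℋ} (hy : ∀ t ∈ J.io, y t = ξ 0 t)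
    (hξ : ∀ k < (r + 1) / 2, ∀ t ∈ J.io, HasDerivAt (ξ k) (ξ (k + 1) t) t)
    (hδ : ∀ j < (r + 1) / 2, ∀ t ∈ J.io, HasDerivAt (δ (j + 1))
      (L.term t (fun k => ξ k t) j - m.quasiTerm J f j t - δ j t) t)
    (hδ0 : ∀ t ∈ J.io, δ 0 t = 0)
    (hδN : ∀ t ∈ J.io, δ ((r + 1) / 2) t = L.term t (fun k => ξ k t) ((r + 1) / 2)
      - m.quasiTerm J f ((r + 1) / 2) t) :
    IsQuasiSolution r L m y f := by
  set N := (r + 1) / 2 with hN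
  have hev : ∀ {t}, t ∈ J.io → ∀ᶠ τ in 𝓝 t, τ ∈ J.io := fun ht => J.isOpen_io.eventually_mem ht
  have hjet : ∀ k ≤ N, ∀ t ∈ J.io, jet J y t k = ξ k t := by
    intro k
    induction k with
    | zero => exact fun _ t ht => by rw [jet_zero, hy t ht]
    | succ k ih =>
      intro hk t ht
      have h1 : HasDerivAt (fun τ => jet J y τ k) (ξ (k + 1) t) t :=
        (hξ k (by omega) t ht).congr_of_eventuallyEq
          ((hev ht).mono fun τ hτ => ih (by omega) τ hτ)
      rw [jet_succ]
      exact h1.hasDerivWithinAt.derivWithin (J.uniqueDiffOn t (J.io_subset_cl ht))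
  have hterm : ∀ j ≤ N, ∀ t ∈ J.io, L.quasiTerm J y j t = L.term t (fun k => ξ k t) j := by
    intro j hj t ht
    rw [quasiTerm_eq_term, DiffExpr.term, DiffExpr.term, hjet j hj t ht, hjet (j - 1) (by omega) t ht]
    rcases hj.lt_or_eq with h | h
    · rw [hjet (j + 1) h t ht]
    · rw [((ho t (J.io_subset_cl ht)).2 j (by omega)).2, zero_apply, zero_apply]
  have hmd : ∀ j, ∀ t ∈ J.io, HasDerivAt (m.quasi s J f (j + 1))
      (derivWithin (m.quasi s J f (j + 1)) J.cl t) t := fun j t ht =>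
    hasDerivAt_of_differentiableAt ht
      (((contDiffOn_quasi m.order m.smooth hf (j + 1)).differentiableOn
        (by norm_num)).differentiableAt (J.cl_mem_nhds ht))
  have hq : ∀ i ≤ N, ∀ t ∈ J.io,
      L.quasi r J y (N - i) t = m.quasi s J f (N - i) t + δ (N - i) t := by
    intro i
    induction i with
    | zero =>
      intro _ t ht
      rw [Nat.sub_zero, quasi_eq_quasiTerm le_rfl, quasi_eq_quasiTerm (by omega), hδN t ht,
        hterm N le_rfl t ht]
      abel
    | succ i ih =>
      intro hi t ht
      obtain ⟨j, hj⟩ : ∃ j, j = N - (i + 1) := ⟨_, rfl⟩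
      have hj1 : N - i = j + 1 := by omega
      rw [hj1] at ih
      rw [← hj]
      have ht' := J.io_subset_cl ht
      have h1 : HasDerivAt (L.quasi r J y (j + 1)) (derivWithin (m.quasi s J f (j + 1)) J.cl t
          + (L.term t (fun k => ξ k t) j - m.quasiTerm J f j t - δ j t)) t :=
        ((hmd j t ht).add (hδ j (by omega) t ht)).congr_of_eventuallyEq
          ((hev ht).mono fun τ hτ => ih (by omega) τ hτ)
      rw [quasi_rec ho j ht', quasi_rec m.order j ht',
        h1.hasDerivWithinAt.derivWithin (J.uniqueDiffOn t ht'), hterm j (by omega) t ht]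
      abel
  have hq' : ∀ j ≤ N, ∀ t ∈ J.io, L.quasi r J y j t = m.quasi s J f j t + δ j t := by
    intro j hj t ht
    have := hq (N - j) (by omega) t ht
    rwa [Nat.sub_sub_self hj] at this
  refine ⟨fun j hj t ht => ?_, fun j hj t ht => ?_, fun t ht => ?_⟩
  · exact ((hξ j hj t ht).congr_of_eventuallyEq
      ((hev ht).mono fun τ hτ => hjet j hj.le τ hτ)).differentiableAt
  · exact (((hmd j t ht).add (hδ j hj t ht)).congr_of_eventuallyEq
      ((hev ht).mono fun τ hτ => hq' (j + 1) hj τ hτ)).differentiableAt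
  · rw [hq' 0 (by omega) t ht, hδ0 t ht, add_zero]

theorem hasDerivAt_coord {k : ℕ} {x : ℝ → HPow ℋ k} {x' : HPow ℋ k} {t : ℝ} (hx : HasDerivAt x x' t)
    {i : ℕ} (hi : i < k) : HasDerivAt (fun τ => coord (x τ) i) (coord x' i) t := by
  have h := (((PiLp.proj 2 (𝕜 := ℂ) (fun _ : Fin k => ℋ) ⟨i, hi⟩).restrictScalars
    ℝ).hasFDerivAt.comp_hasDerivAt t hx)
  have e : ∀ v : HPow ℋ k, coord v i = v ⟨i, hi⟩ := fun v => coord_fin v ⟨i, hi⟩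
  simp only [e]
  exact h

theorem coord_sub {k : ℕ} (v w : HPow ℋ k) (i : ℕ) : coord (v - w) i = coord v i - coord w i := by
  have h := coord_add v ((-1 : ℂ) • w) i
  rw [coord_smul] at h
  rw [sub_eq_add_neg, sub_eq_add_neg]
  simpa using h

/-- The system `(i/2) ((Q x)' + Q* x') = K` row by row. -/
theorem coord_of_system {a : ℝ → (ℋ →L[ℂ] ℋ)} {x : ℝ → HPow ℋ r} {x' K : HPow ℋ r} {t : ℝ}
    (hx : HasDerivAt x x' t)
    (hQ : HasDerivAt (fun τ => qMatrix r (a τ) (x τ))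
      ((-2 * Complex.I) • K - star (qMatrix r (a t)) x') t) {n : ℕ} (hn : r / 2 = n) :
    (∀ i < n, coord x' (n + i) = -coord K i) ∧ (∀ i < n, coord x' i = coord K (n + i)) ∧
      (r = 2 * n + 1 → HasDerivAt (fun τ => a τ (coord (x τ) (2 * n)))
        ((-2 * Complex.I) • coord K (2 * n)
          - ContinuousLinearMap.adjoint (a t) (coord x' (2 * n))) t) := by
  rw [ContinuousLinearMap.star_eq_adjoint, adjoint_qMatrix] at hQ
  refine ⟨fun i hi => ?_, fun i hi => ?_, fun hr => ?_⟩
  · have h1 := hasDerivAt_coord hQ (by omega : i < r)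
    simp only [coord_sub, coord_smul, coord_qMatrix _ _ (by omega : i < r), hn, if_pos hi] at h1
    have h2 := (hasDerivAt_coord hx (by omega : i + n < r)).const_smul Complex.I
    have h3 := h2.unique h1
    rw [add_comm n i]
    have h4 : (2 * Complex.I) • (coord x' (i + n) + coord K i) = 0 := by
      rw [← sub_eq_zero.2 h3]
      module
    rw [smul_eq_zero] at h4
    rcases h4 with h4 | h4
    · simp at h4
    · exact eq_neg_of_add_eq_zero_left h4
  · have h1 := hasDerivAt_coord hQ (by omega : n + i < r)
    simp only [coord_sub, coord_smul, coord_qMatrix _ _ (by omega : n + i < r), hn,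
      if_neg (by omega : ¬ n + i < n), if_pos (by omega : n + i < 2 * n),
      Nat.add_sub_cancel_left] at h1
    have h2 := (hasDerivAt_coord hx (by omega : i < r)).const_smul (-Complex.I)
    have h3 := h2.unique h1
    have h4 : (2 * Complex.I) • (coord x' i - coord K (n + i)) = 0 := by
      rw [← neg_eq_zero, ← sub_eq_zero.2 h3]
      module
    rw [smul_eq_zero] at h4
    rcases h4 with h4 | h4
    · simp at h4
    · exact sub_eq_zero.1 h4
  · have h1 := hasDerivAt_coord hQ (by omega : 2 * n < r)
    simpa only [coord_sub, coord_smul, coord_qMatrix _ _ (by omega : 2 * n < r), hn,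
      if_neg (by omega : ¬ 2 * n < n), if_neg (lt_irrefl (2 * n))] using h1

end ResolventValue

/-! ### From the rows of the system to quasi-derivatives, in even and in odd order -/

section ResolventValue

variable {ℋ : Type*} [NormedAddCommGroup ℋ] [InnerProductSpace ℂ ℋ] [CompleteSpace ℋ]
variable {J : BaseInterval} {r s : ℕ} {ℬ : Set ℂ} {L : ℂ → DiffExpr ℋ} {m : WeightExpr ℋ J s}
variable {X : ℂ → ℝ → (HPow ℋ r →L[ℂ] HPow ℋ r)} {M : ℂ → (HPow ℋ r →L[ℂ] HPow ℋ r)}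

open DiffExpr

/-- The rows of the system with index below `n` give the derivatives of the quasi-derivatives, the
remaining ones those of `y, …, y^{(n-1)}`; the derivative of order `n` is recovered from `y^{[n]}`,
as `p_n` is invertible. -/
theorem isQuasiSolution_of_isResolventValue_even [NeZero r] (hsr : s ≤ r)
    (hL : NevanlinnaFamily J r ℬ L) {z : ℂ} (hz : z.im ≠ 0) {f y : ℝ → ℋ}
    (hf : ContDiffOn ℝ (s : ℕ) f J.cl) {n : ℕ} (hr : r = 2 * n) {x x' : ℝ → HPow ℋ r}
    (hy : ∀ t ∈ J.io, y t = coord (x t) 0)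
    (hx : ∀ t ∈ J.io, HasDerivAt x (x' t) t ∧ HasDerivAt (fun τ => (L z).Q r τ (x τ))
      ((-2 * Complex.I) • ((L z).H r t (x t) +
        (L (conj z)).W r m.toDiffExpr t ((L (conj z)).bigF r s J f t))
        - star ((L z).Q r t) (x' t)) t) :
    IsQuasiSolution r (L z) m y f := by
  have hr0 : r ≠ 0 := NeZero.ne r
  have hzB := hL.nonreal z hz
  have hn : r / 2 = n := by omega
  have hN : (r + 1) / 2 = n := by omega
  -- the derivative of order `n` is expressed through `y^{[n]}` by inverting `p_n`
  set ξ : ℕ → ℝ → ℋ := fun k t => if k < n then coord (x t) k else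
    (L z).pInv r t ((Complex.I / 2) • (L z).q n t (coord (x t) (n - 1)) + coord (x t) (2 * n - 1)
      + m.quasiTerm J f n t) with hξ
  set δ : ℕ → ℝ → ℋ := fun j t => if j = 0 then 0 else coord (x t) (n + j - 1) with hδ
  refine isQuasiSolution_of_system hsr (hL.order z hzB) hf (ξ := ξ) (δ := δ) (fun t ht => ?_)
    (fun k hk t ht => ?_) (fun j hj t ht => ?_) (fun t _ => by simp [hδ]) (fun t ht => ?_)
  · rw [hy t ht, hξ]
    simp only
    rw [if_pos (by omega)]
  · rw [hN] at hk
    have ht' := J.io_subset_cl ht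
    obtain ⟨-, h2, -⟩ := coord_of_system (hx t ht).1 (hx t ht).2 hn
    have h3 := hasDerivAt_coord (hx t ht).1 (by omega : k < r)
    rw [h2 k hk, coord_add, DiffExpr.coord_H_even_ge _ _ _ hr hk,
      hL.coord_W_bigF_even hsr hz ht' f hr (by omega), if_neg (by omega : ¬ n + k < n), zero_add,
      if_neg (by omega : ¬ n + k + 1 = n)] at h3
    have e1 : ξ k = fun τ => coord (x τ) k := by
      funext τ
      simp only [hξ, if_pos hk]
    rw [e1]
    convert h3 using 1
    simp only [hξ]
    by_cases hk1 : k + 1 = n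
    · rw [if_neg (by omega), if_pos hk1, if_pos (by omega), show n - 1 = k by omega]
      simp only [map_add, map_smul]
    · rw [if_pos (by omega), if_neg hk1, if_neg (by omega), add_zero]
  · rw [hN] at hj
    have ht' := J.io_subset_cl ht
    obtain ⟨h1, -, -⟩ := coord_of_system (hx t ht).1 (hx t ht).2 hn
    have h3 := hasDerivAt_coord (hx t ht).1 (by omega : n + j < r)
    rw [h1 j hj, coord_add, DiffExpr.coord_H_even_lt _ _ _ hr hj,
      hL.coord_W_bigF_even hsr hz ht' f hr (by omega), if_pos hj,
      if_neg (by omega : ¬ j + 1 = 2 * n)] at h3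
    have e1 : δ (j + 1) = fun τ => coord (x τ) (n + j) := by
      funext τ
      simp only [hδ, if_neg (Nat.succ_ne_zero j)]
      rfl
    rw [e1]
    convert h3 using 1
    simp only [DiffExpr.term, hξ, hδ, if_pos hj]
    by_cases hj1 : j + 1 = n
    · rw [if_neg (by omega : ¬ j + 1 < n), if_pos hj1, if_pos hj1, hj1]
      rw [show n - 1 = j by omega]
      rcases Nat.eq_zero_or_pos j with hj0 | hj0
      · rw [if_pos hj0, if_pos hj0, if_neg (by omega)]
        simp only [map_add, map_smul]
        match_scalars <;> first | ring1 | (ring_nf; simp only [Complex.I_sq]; ring1)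
      · rw [if_neg hj0.ne', if_neg hj0.ne', if_pos hj0, if_pos (by omega)]
        simp only [map_add, map_smul]
        match_scalars <;> first | ring1 | (ring_nf; simp only [Complex.I_sq]; ring1)
    · rw [if_pos (by omega : j + 1 < n), if_neg hj1, if_neg hj1]
      rcases Nat.eq_zero_or_pos j with hj0 | hj0
      · rw [if_pos hj0, if_pos hj0, if_neg (by omega)]
        module
      · rw [if_neg hj0.ne', if_neg hj0.ne', if_pos hj0, if_pos (by omega)]
        module
  · have ht' := J.io_subset_cl ht
    rw [hN]
    simp only [DiffExpr.term, hξ, hδ, lt_irrefl, if_false]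
    rw [if_neg (by omega : ¬ n = 0), if_neg (by omega : ¬ n = 0),
      if_pos (by omega : n - 1 < n),
      (((hL.order z hzB) t ht').2 n (by omega)).2, show n + n - 1 = 2 * n - 1 by omega]
    have hp : ∀ u, (L z).p n t ((L z).pInv r t u) = u := fun u => by
      have hu := hL.lead_even ⟨n, by omega⟩ z hzB t ht'
      rw [hn] at hu
      rw [DiffExpr.pInv, hn, ← mul_apply_eq_comp, Ring.mul_inverse_cancel _ hu, one_apply_eq_self]
    rw [hp, zero_apply]
    module

/-- In odd order the last entry of the column carries `y^{(n)}`, and the last row of the system gives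
the derivative of the quasi-derivative `y^{[n]}`, which is `q_{n+1} y^{(n)}` up to a constant. -/
theorem isQuasiSolution_of_isResolventValue_odd [NeZero r] (hsr : s ≤ r)
    (hL : NevanlinnaFamily J r ℬ L) {z : ℂ} (hz : z.im ≠ 0) {f y : ℝ → ℋ}
    (hf : ContDiffOn ℝ (s : ℕ) f J.cl) {n : ℕ} (hr : r = 2 * n + 1) {x x' : ℝ → HPow ℋ r}
    (hy : ∀ t ∈ J.io, y t = coord (x t) 0)
    (hx : ∀ t ∈ J.io, HasDerivAt x (x' t) t ∧ HasDerivAt (fun τ => (L z).Q r τ (x τ))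
      ((-2 * Complex.I) • ((L z).H r t (x t) +
        (L (conj z)).W r m.toDiffExpr t ((L (conj z)).bigF r s J f t))
        - star ((L z).Q r t) (x' t)) t) :
    IsQuasiSolution r (L z) m y f := by
  have hr0 : r ≠ 0 := NeZero.ne r
  obtain ⟨s', hs'⟩ := m.even
  have hzB := hL.nonreal z hz
  have hn : r / 2 = n := by omega
  have hN : (r + 1) / 2 = n + 1 := by omega
  -- the last entry of the column is `-i y^{(n)}`, except for `r = 1`, where it is `y`
  set c : ℂ := if n = 0 then 1 else Complex.I with hc
  set ξ : ℕ → ℝ → ℋ := fun k t => if k < n then coord (x t) k else if k = n then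
    c • coord (x t) (2 * n) else c • coord (x' t) (2 * n) with hξ
  set δ : ℕ → ℝ → ℋ := fun j t => if j = 0 then 0 else if j ≤ n then coord (x t) (n + j - 1) else
    -(Complex.I / 2) • c • (L z).q (n + 1) t (coord (x t) (2 * n)) with hδ
  refine isQuasiSolution_of_system hsr (hL.order z hzB) hf (ξ := ξ) (δ := δ) (fun t ht => ?_)
    (fun k hk t ht => ?_) (fun j hj t ht => ?_) (fun t _ => by simp [hδ]) (fun t ht => ?_)
  · rw [hy t ht, hξ]
    simp only
    by_cases h0 : n = 0
    · subst h0
      simp [hc]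
    · rw [if_pos (by omega)]
  · rw [hN] at hk
    have ht' := J.io_subset_cl ht
    obtain ⟨-, h2, -⟩ := coord_of_system (hx t ht).1 (hx t ht).2 hn
    rcases (Nat.lt_succ_iff.1 hk).lt_or_eq with hkn | hkn
    · have h3 := hasDerivAt_coord (hx t ht).1 (by omega : k < r)
      rw [h2 k hkn, coord_add, DiffExpr.coord_H_odd_ge _ _ _ hr hkn,
        hL.coord_W_bigF_odd hsr hz ht' f hr (by omega), if_neg (by omega : ¬ n + k < n), zero_add,
        if_neg (by omega : ¬ n + k = 2 * n), add_zero] at h3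
      have e1 : ξ k = fun τ => coord (x τ) k := by
        funext τ
        simp only [hξ, if_pos hkn]
      rw [e1]
      convert h3 using 1
      simp only [hξ]
      by_cases hk1 : k + 1 = n
      · rw [if_neg (by omega), if_pos hk1, if_pos hk1, hc, if_neg (by omega)]
      · rw [if_pos (by omega), if_neg hk1]
    · subst hkn
      have h3 := (hasDerivAt_coord (hx t ht).1 (by omega : 2 * k < r)).const_smul c
      have e1 : ξ k = fun τ => c • coord (x τ) (2 * k) := by
        funext τ
        simp only [hξ, lt_irrefl, if_false, if_true]
      rw [e1]
      refine h3.congr_deriv (Eq.symm ?_)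
      simp only [hξ]
      rw [if_neg (by omega), if_neg (by omega)]
  · rw [hN] at hj
    have ht' := J.io_subset_cl ht
    obtain ⟨h1, -, h4⟩ := coord_of_system (hx t ht).1 (hx t ht).2 hn
    rcases (Nat.lt_succ_iff.1 hj).lt_or_eq with hjn | hjn
    · have h3 := hasDerivAt_coord (hx t ht).1 (by omega : n + j < r)
      rw [h1 j hjn, coord_add, DiffExpr.coord_H_odd_lt _ _ _ hr hjn,
        hL.coord_W_bigF_odd hsr hz ht' f hr (by omega), if_pos hjn,
        if_neg (by omega : ¬ j = 2 * n), add_zero] at h3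
      have e1 : δ (j + 1) = fun τ => coord (x τ) (n + j) := by
        funext τ
        simp only [hδ, if_neg (Nat.succ_ne_zero j), if_pos (by omega : j + 1 ≤ n)]
        rfl
      rw [e1]
      convert h3 using 1
      simp only [DiffExpr.term, hξ, hδ, if_pos hjn]
      have hcI : c = Complex.I := by rw [hc, if_neg (by omega)]
      by_cases hj1 : j + 1 = n
      · rw [if_neg (by omega : ¬ j + 1 < n), if_pos hj1, if_pos hj1, hj1, hcI]
        rcases Nat.eq_zero_or_pos j with hj0 | hj0
        · rw [if_pos hj0, if_pos hj0, if_neg (by omega)]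
          simp only [map_smul, smul_sub, smul_smul, smul_zero]
          match_scalars <;> first | ring1 | (ring_nf; simp only [Complex.I_sq]; ring1)
        · rw [if_neg hj0.ne', if_neg hj0.ne', if_pos hj0, if_pos (by omega), if_pos (by omega)]
          simp only [map_smul, smul_sub, smul_smul]
          match_scalars <;> first | ring1 | (ring_nf; simp only [Complex.I_sq]; ring1)
      · rw [if_pos (by omega : j + 1 < n), if_neg hj1]
        rcases Nat.eq_zero_or_pos j with hj0 | hj0
        · rw [if_pos hj0, if_pos hj0, if_neg (by omega)]
          module
        · rw [if_neg hj0.ne', if_neg hj0.ne', if_pos hj0, if_pos (by omega), if_pos (by omega)]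
          module
    · subst hjn
      have h3 := ((h4 hr).const_smul c).const_smul (-(Complex.I / 2))
      rw [hn] at h3
      rw [← hL.lead_adjoint hr hz ht', coord_add, DiffExpr.coord_H_odd_last _ _ _ hr,
        hL.coord_W_bigF_odd hsr hz ht' f hr (by omega), if_pos rfl] at h3
      have e1 : δ (j + 1) =
          fun τ => -(Complex.I / 2) • c • (L z).q (j + 1) τ (coord (x τ) (2 * j)) := by
        funext τ
        simp only [hδ, if_neg (Nat.succ_ne_zero j), if_neg (by omega : ¬ j + 1 ≤ j)]
      rw [e1]
      refine h3.congr_deriv (Eq.symm ?_)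
      simp only [DiffExpr.term, hξ, hδ, lt_irrefl, if_false, if_true,
        if_neg (by omega : ¬ j + 1 < j), if_neg (by omega : ¬ j + 1 = j)]
      by_cases h0 : j = 0
      · subst h0
        have hc1 : c = 1 := by rw [hc, if_pos rfl]
        simp only [hc1, if_true, lt_irrefl, if_false, one_smul]
        match_scalars <;> first
          | ring1
          | (ring_nf; simp only [Complex.I_sq]; done)
          | (ring_nf; simp only [Complex.I_sq]; ring1)
      · have hcI : c = Complex.I := by rw [hc, if_neg h0]
        rw [if_neg h0, if_neg h0, if_neg h0, if_pos (by omega : j - 1 < j), if_pos le_rfl,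
          if_pos (by omega : 0 < j), if_neg (by omega : ¬ 2 * j < j), hcI,
          show j + j - 1 = 2 * j - 1 by omega]
        simp only [map_smul]
        match_scalars <;> first
          | ring1
          | (ring_nf; simp only [Complex.I_pow_three]; ring1)
          | (ring_nf; simp only [Complex.I_pow_four])
  · have ht' := J.io_subset_cl ht
    have ho := (hL.order z hzB) t ht'
    rw [hN, quasiTerm_eq_zero m.order (by omega) ht', sub_zero]
    simp only [DiffExpr.term, hξ, hδ, if_neg (Nat.succ_ne_zero n), if_neg (by omega : ¬ n + 1 ≤ n),
      Nat.add_sub_cancel, lt_irrefl, if_false, if_true]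
    rw [ho.1 (n + 1) (by omega), (ho.2 (n + 1) (by omega)).2, zero_apply, zero_apply, map_smul]
    module

/-- The values of `R(λ)` on `H` solve `l_λ[y] = m[f]` inside the interval in the sense of
quasi-derivatives. -/
theorem IsResolventValue.isQuasiSolution [NeZero r] (hsr : s ≤ r) (hL : NevanlinnaFamily J r ℬ L)
    (hX : IsFundamental J r L X) {z : ℂ} (hz : z.im ≠ 0) {f y : ℝ → ℋ}
    (hf : ContDiffOn ℝ (s : ℕ) f J.cl) (h : IsResolventValue r L m X M z f y) :
    IsQuasiSolution r (L z) m y f := by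
  obtain ⟨x, hx⟩ := h
  obtain ⟨x', hx'⟩ := hX.exists_hasDerivAt hL hz (hL.continuousOn_W_bigF (m := m) hsr hz hf)
    (fun t ht => (hx t ht).1)
  have hy : ∀ t ∈ J.io, y t = coord (x t) 0 := fun t ht => by
    rw [(hx t (J.io_subset_cl ht)).2, ← coord_fin (x t) 0, Fin.val_zero]
  rcases Nat.even_or_odd' r with ⟨n, hr | hr⟩
  · exact isQuasiSolution_of_isResolventValue_even hsr hL hz hf hr hy hx'
  · exact isQuasiSolution_of_isResolventValue_odd hsr hL hz hf hr hy hx'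

end ResolventValue

/-! ### Comparison of the two resolvents -/

section Comparison

variable {ℋ : Type*} [NormedAddCommGroup ℋ] [InnerProductSpace ℂ ℋ] [CompleteSpace ℋ]
variable {J : BaseInterval} {r s : ℕ} {ℬ : Set ℂ} {L : ℂ → DiffExpr ℋ} {m : WeightExpr ℋ J s}

open DiffExpr

theorem contDiffOn_adjoint {E : Type*} [NormedAddCommGroup E] [InnerProductSpace ℂ E] [CompleteSpace E]
    {N : ℕ} {S : Set ℝ} {A : ℝ → (E →L[ℂ] E)} (h : ContDiffOn ℝ N A S) :
    ContDiffOn ℝ N (fun t => ContinuousLinearMap.adjoint (A t)) S := by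
  let T : (E →L[ℂ] E) →L[ℝ] (E →L[ℂ] E) :=
    LinearMap.mkContinuous
      { toFun := fun A => ContinuousLinearMap.adjoint A
        map_add' := fun A B => map_add _ A B
        map_smul' := fun c A => by
          change ContinuousLinearMap.adjoint (((c : ℂ)) • A) = ((c : ℂ)) • ContinuousLinearMap.adjoint A
          rw [map_smulₛₗ, Complex.conj_ofReal] } 1
      (fun A => by
        rw [one_mul]
        exact (LinearIsometryEquiv.norm_map ContinuousLinearMap.adjoint A).le)
  exact T.contDiff.comp_contDiffOn h

theorem DiffExpr.Smooth.adj {L : DiffExpr ℋ} {k : ℕ} (h : L.Smooth J k) : L.adj.Smooth J k :=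
  ⟨fun j hj => contDiffOn_adjoint (h.1 j hj),
    fun j hj => ⟨contDiffOn_adjoint (h.2 j hj).2, contDiffOn_adjoint (h.2 j hj).1⟩⟩

theorem DiffExpr.Smooth.comb {L L' : DiffExpr ℋ} {k : ℕ} (h : L.Smooth J k) (h' : L'.Smooth J k)
    (x y : ℂ) : (DiffExpr.comb x L y L').Smooth J k :=
  ⟨fun j hj => ((h.1 j hj).const_smul x).add ((h'.1 j hj).const_smul y),
    fun j hj => ⟨((h.2 j hj).1.const_smul x).add ((h'.2 j hj).1.const_smul y),
      ((h.2 j hj).2.const_smul x).add ((h'.2 j hj).2.const_smul y)⟩⟩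

theorem DiffExpr.Smooth.of_orderLE {L : DiffExpr ℋ} {k l : ℕ} (h : L.Smooth J k)
    (ho : L.OrderLE J k) : L.Smooth J l := by
  refine ⟨fun j _ => ?_, fun j _ => ?_⟩
  · by_cases hj : 2 * j ≤ k
    · exact h.1 j hj
    · exact contDiffOn_const.congr fun t ht => (ho t ht).1 j (by omega)
  · by_cases hj : 2 * j + 1 ≤ k
    · exact h.2 j hj
    · exact ⟨contDiffOn_const.congr fun t ht => ((ho t ht).2 j (by omega)).1,
        contDiffOn_const.congr fun t ht => ((ho t ht).2 j (by omega)).2⟩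

theorem smooth_linPart (hL : NevanlinnaFamily J r ℬ L) (z : ℂ) :
    (linPart L m.toDiffExpr z).Smooth J r := by
  have h := hL.smooth Complex.I (hL.nonreal _ (by simp))
  exact (h.comb h.adj _ _).comb (m.smooth.of_orderLE m.order) _ _

end Comparison

end OpDiff

end

theorem mainTheorem7 {ℋ : Type u} [NormedAddCommGroup ℋ] [InnerProductSpace ℂ ℋ]
    [CompleteSpace ℋ] [TopologicalSpace.SeparableSpace ℋ]
    (J : BaseInterval) (r s : ℕ) [NeZero r] (hsr : s ≤ r)
    (ℬ : Set ℂ) (L : ℂ → DiffExpr ℋ) (m : WeightExpr ℋ J s)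
    (hL : NevanlinnaFamily J r ℬ L) (hLm : Dominates J r s L m.toDiffExpr)
    -- the operators `R(λ)` and their spectral family
    (X : ℂ → ℝ → (HPow ℋ r →L[ℂ] HPow ℋ r)) (hX : IsFundamental J r L X)
    (M : ℂ → (HPow ℋ r →L[ℂ] HPow ℋ r)) (hM : IsCharacteristicOperator J r L X M)
    (hdef : ¬ J.Finite → Definite J r s ℬ L m.toDiffExpr)
    (R : ℂ → (m.L2 →L[ℂ] m.L2)) (hR : IsResolvent r L m X M R)
    (E : SpectralFamily m.L2) (hE : E.Represents R)
    -- the generalized resolvent of the minimal relation and its spectral family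
    (Rgen : ℂ → (m.L2 →L[ℂ] m.L2))
    (hRgen : IsGeneralizedResolvent.{u, w} (minimalRelation r (lPart L) m) Rgen)
    (Egen : SpectralFamily m.L2) (hEgen : Egen.Represents Rgen)
    (y : ℂ → m.H → m.H)
    (hy : ∀ z : ℂ, z.im ≠ 0 → ∀ f : m.H, m.cls (y z f) = Rgen z (m.cls f) ∧
      ContDiffOn ℝ (r : ℕ) (y z f : ℝ → ℋ) J.cl ∧
      ∀ t ∈ J.cl, (linPart L m.toDiffExpr z).apply r J (y z f) t = m.apply s J f t)
    -- the order of `n_λ` does not exceed the order of `l - λ m`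
    (hord : ∀ z : ℂ, z.im ≠ 0 → ∀ k : ℕ, (linPart L m.toDiffExpr z).OrderLE J k →
      (nPart L m.toDiffExpr z).OrderLE J k)
    -- the boundary condition, for large `τ`
    (hbdry : ∀ᶠ τ : ℝ in Filter.atTop, ∀ z : ℂ, z = Complex.I * τ → ∀ f y₁ : m.H,
      IsResolventValue r L m X M z f y₁ → ∃ ℓ : ℝ, ℓ ≤ 0 ∧
        Filter.Tendsto (fun e : ℝ × ℝ =>
          (energy r L z e.2 ((L z).vec r s J m.toDiffExpr y₁ f e.2
              - (linPart L m.toDiffExpr z).vec r s J m.toDiffExpr (y z f) f e.2)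
            - energy r L z e.1 ((L z).vec r s J m.toDiffExpr y₁ f e.1
              - (linPart L m.toDiffExpr z).vec r s J m.toDiffExpr (y z f) f e.1)) / z.im)
          J.ends (nhds ℓ))
    -- `Im n(t, iτ) ≤ c(t, τ) m(t)` with `sup_t c(t, τ) = o(τ)`
    (c : ℝ → ℝ → ℝ)
    (hn : ∀ᶠ τ : ℝ in Filter.atTop, ∀ t ∈ J.cl,
      ((c t τ : ℂ) • m.formMatrix (r / 2) t
        - imPart ((nPart L m.toDiffExpr (Complex.I * τ)).formMatrix (r / 2) t)).IsPositive)
    (hc_bdd : ∀ᶠ τ : ℝ in Filter.atTop, BddAbove ((fun t => c t τ) '' J.cl))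
    (hc : (fun τ : ℝ => sSup ((fun t => c t τ) '' J.cl)) =o[Filter.atTop] (fun τ : ℝ => τ)) :
    ∃ T : m.L2 →L[ℂ] m.L2, E.HasTop T ∧ Egen.HasTop T := by
  have key : ∀ ε : ℝ, 0 < ε → ∀ᶠ τ : ℝ in atTop, ∀ u : m.L2,
      ‖R (Complex.I * τ) u - Rgen (Complex.I * τ) u‖ ≤ 2 * ε * ‖Rgen (Complex.I * τ) u‖ := by
    intro ε hε
    filter_upwards [exists_norm_nPart_form_le hsr hL hLm c hn hc_bdd hc hε, hbdry,
      eventually_gt_atTop 0] with τ hN hb hτ u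
    obtain ⟨z, hzτ⟩ : ∃ z : ℂ, z = Complex.I * τ := ⟨_, rfl⟩
    have hz : z.im ≠ 0 := by simp [hzτ, hτ.ne']
    rw [← hzτ] at hN ⊢
    -- `R z` is the closure of its restriction to `H`, so the estimate has to be proved only there
    have hclosed : IsClosed {u : m.L2 × m.L2 | ‖u.2 - Rgen z u.1‖ ≤ 2 * ε * ‖Rgen z u.1‖} :=
      isClosed_le (by fun_prop) (by fun_prop)
    have hsub : {u : m.L2 × m.L2 | u.2 = R z u.1} ⊆
        {u : m.L2 × m.L2 | ‖u.2 - Rgen z u.1‖ ≤ 2 * ε * ‖Rgen z u.1‖} := by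
      rw [← hR z hz]
      refine closure_minimal ?_ hclosed
      rintro _ ⟨f, y₁, hv, rfl⟩
      obtain ⟨hyR, hyC, hyE⟩ := hy z hz f
      obtain ⟨ℓ, hℓ, hlim⟩ := hb z hzτ f y₁ hv
      simp only [mem_ofPred_eq, ← hyR]
      exact norm_sub_le_of_isQuasiSolution hsr hL hLm hτ hε hzτ hN
        (hv.isQuasiSolution hsr hL hX hz f.2.1)
        (isQuasiSolution_of_contDiffOn (orderLE_linPart hsr hL z) (smooth_linPart hL z) hyC f.2.1
          hyE) hℓ hlim
    exact hsub (show (u, R z u) ∈ {u : m.L2 × m.L2 | u.2 = R z u.1} from rfl)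
  refine SpectralFamily.exists_common_top hE hEgen fun u => ?_
  -- `τ ‖R_{iτ} u‖ ≤ ‖u‖`, so that the difference of the two resolvents is `o(1 / τ)`
  rw [Metric.tendsto_nhds]
  intro ε hε
  have hε' : 0 < ε / (2 * (‖u‖ + 1)) := by positivity
  filter_upwards [key _ hε', eventually_gt_atTop 0] with τ h hτ
  have hz : (Complex.I * (τ : ℂ)).im ≠ 0 := by simp [hτ.ne']
  have h1 := hRgen.norm_apply_le hz u
  have him : |(Complex.I * (τ : ℂ)).im| = τ := by simp [abs_of_pos hτ]
  rw [him] at h1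
  rw [Real.dist_eq, sub_zero, abs_of_nonneg (by positivity)]
  calc τ * ‖R (Complex.I * τ) u - Rgen (Complex.I * τ) u‖
      ≤ τ * (2 * (ε / (2 * (‖u‖ + 1))) * ‖Rgen (Complex.I * τ) u‖) := by gcongr; exact h u
    _ = 2 * (ε / (2 * (‖u‖ + 1))) * (τ * ‖Rgen (Complex.I * τ) u‖) := by ring
    _ ≤ 2 * (ε / (2 * (‖u‖ + 1))) * ‖u‖ := by gcongr
    _ = ε * (‖u‖ / (‖u‖ + 1)) := by field_simp
    _ < ε * 1 := by
        gcongr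
        rw [div_lt_one (by positivity)]
        linarith
    _ = ε := mul_one ε
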